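/- **Conventions.** Let $V$ be a finite set, $n=|V|$. A *connectivity function* is $f:2^V\to\mathbb Z_{\ge 0}$ with $f(\emptyset)=0$, $f(W)=f(\overline W)$ (where $\overline W=V\setminus W$) and $f(U\cup W)+f(U\cap W)\le f(U)+f(W)$. A *branch decomposition* of $f$ is a pair $(T,L)$ of a tree $T$ all of whose nodes have degree 1 or 3 and a bijection $L$ from $V$ to the leaves of $T$. For an edge $uv$ of $T$ let $T[uv]\subseteq V$ be the set of leaves in the component of $u$ in $T-uv$; the width of $uv$ is $f(T[uv])$, the width of $(T,L)$ is the maximum width of an edge, and $\mathrm{bw}(f)$ is the minimum width of a branch decomposition of $f$. For an edge $r=uv$ and a node $w$, let $T_r[w]$ be the set of leaves $x$ such that $w$ lies on the path from $x$ to $r$. For $W\subseteq V$, a *$W$-improvement* is a tripartition $(C_1,C_2,C_3)$ of $V$ (parts may be empty) with $f(C_i)<f(W)/2$, $f(C_i\cap W)<f(W)$ and $f(C_i\cap\overline W)<f(W)$ for all $i$. It is *minimum* if it minimizes $\max_i f(C_i)$, subject to that the number of non-empty parts, and subject to both $\sum_i f(C_i)$. The *edit set* of a tripartition with respect to $r$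 is the set $R$ of nodes $w$ such that $T_r[w]$ meets at least two of the $C_i$. A *global $T$-improvement* on $r=uv$ is a minimum $T[uv]$-improvement whose edit set has minimum size among all minimum $T[uv]$-improvements. Its *neighbor partition* is $(N_1,N_2,N_3)$, where $N_i$ consists of the nodes $w\notin R$ adjacent to $R$ with $T_r[w]\subseteq C_i$. The *refinement* of $T$ with $(uv,C_1,C_2,C_3)$ is obtained from three copies $T_1,T_2,T_3$ of $T$, where in $T_i$ only the leaves of $C_i$ keep their labels, by subdividing the copy of $uv$ in $T_i$ by a node $w_i$, joining $w_1,w_2,w_3$ to a new node, and then iteratively deleting unlabelled nodes of degree 1 and suppressing nodes of degree 2. **Refinement data structure.** Let $t:\mathbb N\to[1,\infty)$. A *refinement data structure of $f$ with time complexity $t(k)$* maintains, for each $k$, a branch decomposition $T$ of $f$ of width at most $k$, stored by adjacency lists and rooted at an edge $r=uv$, and supports: * Init$(T,uv)$ in time $O(t(k)|V(T)|)$: start with $T$ rooted at $uv$; * Move$(vw)$ in time $O(t(k))$: replace the root $uv$ by an incident edge $vw$; * Width$()$ in time $O(t(k))$: return $f(T[uv])$; * CanRefine$()$ in time $O(t(k))$: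 decide whether there is a $T[uv]$-improvement. Once it has returned true, the following can be invoked: * EditSet$()$ in time $O(t(k)|R|)$: return the edit set $R$ and the neighbor partition $(N_1,N_2,N_3)$ of some global $T$-improvement $(r,C_1,C_2,C_3)$; * Refine$(R,(N_1,N_2,N_3))$, with the sets just returned by EditSet, in time $O(t(k)|R|)$: turn $T$ into its refinement with $(r,C_1,C_2,C_3)$ by removing $R$ and inserting a connected subtree of $|R|$ new nodes in its place, the rest of $T$ being unchanged, and set $r$ to some edge between two inserted nodes, which is returned; * Output$()$ in time $O(t(k)|V(T)|)$: output $T$. **Theorem.** There is a single algorithm (a random access machine program that reads the adjacency lists of the current tree and calls the operations of a refinement data structure, each call being charged its running time plus one step) such that the following holds for every connectivity function $f$ on a finite set $V$ with a refinement data structure of time complexity $t(k)$. Given a branch decomposition $(T,L)$ of $f$, of width $k$, stored by adjacency lists, a node of $T$, and access to the refinement data structure for this $k$, the algorithm runs in time $t(k)\cdot 2^{O(k)}\cdot n$ and either outputs a branch decomposition of $f$ of width at most $k-1$, or correctly concludes that $k\le 2\,\mathrm{bw}(f)$. Precisely, there is an absolute constant $c$, and for every constant $A$ a constant $B$, such that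 if the $O(\cdot)$ bounds for the operations hold with the factor $A$, then the running time is at most $B\cdot t(k)\cdot 2^{ck}\cdot n$. -/

import Mathlib

universe u v

/-! ### Connectivity functions and branch decompositions -/

/-- A connectivity function on `V`: it vanishes on the empty set, is symmetric and submodular. -/
structure IsConnectivityFunction {V : Type u} (f : Set V → ℕ) : Prop where
  empty : f ∅ = 0
  symm : ∀ W : Set V, f Wᶜ = f W
  submodular : ∀ U W : Set V, f (U ∪ W) + f (U ∩ W) ≤ f U + f W

/-- A branch decomposition `(T, L)` over the ground set `V`. The nodes of the tree `T` are named by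
natural numbers; `graph` has no edges outside `nodes`. `T` is a tree (connected and acyclic) all of
whose nodes have degree 1 or 3, and `leaf` is a bijection from `V` onto the nodes of degree 1. -/
structure BranchDecomposition (V : Type u) where
  nodes : Finset ℕ
  graph : SimpleGraph ℕ
  mem_of_adj : ∀ x y : ℕ, graph.Adj x y → x ∈ nodes
  nonempty : nodes.Nonempty
  reachable : ∀ x ∈ nodes, ∀ y ∈ nodes, graph.Reachable x y
  acyclic : graph.IsAcyclic
  cubic : ∀ x ∈ nodes, (graph.neighborSet x).ncard = 1 ∨ (graph.neighborSet x).ncard = 3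
  leaf : V → ℕ
  leaf_bijOn : Set.BijOn leaf Set.univ {x | x ∈ nodes ∧ (graph.neighborSet x).ncard = 1}

namespace BranchDecomposition

variable {V : Type u}

/-- `T[uv]`: the elements of `V` whose leaves lie in the component of `u` in `T - uv`. -/
def side (T : BranchDecomposition V) (a b : ℕ) : Set V :=
  {x | (T.graph.deleteEdges {s(a, b)}).Reachable a (T.leaf x)}

open Classical in
/-- The width of a branch decomposition: the maximum of `f (T[uv])` over the edges `uv`. -/
noncomputable def width (T : BranchDecomposition V) (f : Set V → ℕ) : ℕ :=
  T.nodes.sup fun a => T.nodes.sup fun b => if T.graph.Adj a b then f (T.side a b) else 0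

/-- `T_r[w]` for `r = ab`: the leaves of the `r`-subtree of `w`, that is, the leaves `x` such that
`w` lies on the path from `x` to the edge `r`. (That path is the common part of the path from `x`
to `a` and the path from `x` to `b`.) -/
def below (T : BranchDecomposition V) (a b w : ℕ) : Set V :=
  {x | (∀ p : T.graph.Walk (T.leaf x) a, w ∈ p.support) ∧
       (∀ p : T.graph.Walk (T.leaf x) b, w ∈ p.support)}

end BranchDecomposition

/-- The branchwidth of `f`: the minimum width of a branch decomposition. -/
noncomputable def branchwidth {V : Type u} (f : Set V → ℕ) : ℕ :=
  sInf (Set.range fun T : BranchDecomposition V => T.width f)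

/-! ### Improvements

A tripartition `(C₀, C₁, C₂)` of `V`, possibly with empty parts, is given by the function
`c : V → Fin 3` that maps each element to the index of its part. -/

/-- The part `C_i` of a tripartition. -/
def part {V : Type u} (c : V → Fin 3) (i : Fin 3) : Set V := {x | c x = i}

/-- `c` is a `W`-improvement; `f (C_i) < f (W) / 2` is written without division. -/
def IsImprovement {V : Type u} (f : Set V → ℕ) (W : Set V) (c : V → Fin 3) : Prop :=
  ∀ i, 2 * f (part c i) < f W ∧ f (part c i ∩ W) < f W ∧ f (part c i ∩ Wᶜ) < f W

/-- The width of an improvement: the maximum of the `f (C_i)`. -/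
def impWidth {V : Type u} (f : Set V → ℕ) (c : V → Fin 3) : ℕ :=
  Finset.univ.sup fun i => f (part c i)

/-- The arity of an improvement: the number of non-empty parts. -/
noncomputable def impArity {V : Type u} (c : V → Fin 3) : ℕ :=
  {i | (part c i).Nonempty}.ncard

/-- The sum-width of an improvement. -/
def impSumWidth {V : Type u} (f : Set V → ℕ) (c : V → Fin 3) : ℕ :=
  ∑ i, f (part c i)

/-- A minimum `W`-improvement: of minimum width, subject to that of minimum arity, and subject to
both of minimum sum-width. -/
structure IsMinimumImprovement {V : Type u} (f : Set V → ℕ) (W : Set V) (c : V → Fin 3) :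
    Prop where
  improvement : IsImprovement f W c
  width_min : ∀ d, IsImprovement f W d → impWidth f c ≤ impWidth f d
  arity_min : ∀ d, IsImprovement f W d → impWidth f d = impWidth f c → impArity c ≤ impArity d
  sumWidth_min : ∀ d, IsImprovement f W d → impWidth f d = impWidth f c →
    impArity d = impArity c → impSumWidth f c ≤ impSumWidth f d

/-- The nodes of `T` intersected by the tripartition `c`, with `T` rooted at the edge `r = ab`:
those `w` for which `T_r[w]` meets at least two parts. -/
def editSet {V : Type u} (T : BranchDecomposition V) (a b : ℕ) (c : V → Fin 3) : Set ℕ :=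
  {w | w ∈ T.nodes ∧ ∃ x ∈ T.below a b w, ∃ y ∈ T.below a b w, c x ≠ c y}

/-- A global `T`-improvement on the edge `ab`: a minimum `T[ab]`-improvement that intersects the
minimum number of nodes among all minimum `T[ab]`-improvements. -/
structure IsGlobalImprovement {V : Type u} (f : Set V → ℕ) (T : BranchDecomposition V)
    (a b : ℕ) (c : V → Fin 3) : Prop where
  minimum : IsMinimumImprovement f (T.side a b) c
  edit_min : ∀ d, IsMinimumImprovement f (T.side a b) d →
    (editSet T a b c).ncard ≤ (editSet T a b d).ncard

/-- The class `N_i` of the neighbor partition of the edit set `R`: the nodes `w` of `N_T(R)` with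
`T_r[w] ⊆ C_i`. -/
def neighborPart {V : Type u} (T : BranchDecomposition V) (a b : ℕ) (c : V → Fin 3) (i : Fin 3) :
    Set ℕ :=
  {w | w ∉ editSet T a b c ∧ (∃ x ∈ editSet T a b c, T.graph.Adj x w) ∧
    T.below a b w ⊆ part c i}

/-! ### Refinement -/

/-- The nodes of the tree from which the refinement is obtained by simplification: three copies of
the nodes of `T`, a node on the copy of the edge `uv` in each of them, and a center. -/
inductive RefNode : Type
  | copy (i : Fin 3) (x : ℕ)
  | mid (i : Fin 3)
  | center

/-- Adjacency (in one of the two orders) before simplification, for refinement at the edge `ab`. -/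
def refRel {V : Type u} (T : BranchDecomposition V) (a b : ℕ) : RefNode → RefNode → Prop
  | .copy i x, .copy j y => i = j ∧ T.graph.Adj x y ∧ s(x, y) ≠ s(a, b)
  | .copy i x, .mid j => i = j ∧ (x = a ∨ x = b)
  | .mid _, .center => True
  | _, _ => False

/-- The tree before simplification. -/
def refGraph {V : Type u} (T : BranchDecomposition V) (a b : ℕ) : SimpleGraph RefNode :=
  SimpleGraph.fromRel (refRel T a b)

/-- The nodes of the tree before simplification. -/
def refNodes {V : Type u} (T : BranchDecomposition V) : Set RefNode :=
  {z | ∀ i x, z = .copy i x → x ∈ T.nodes}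

/-- The labelling of the tree before simplification: `x` is the label of the copy of its leaf in
the copy of `T` that belongs to the part of `x`. -/
def refLabel {V : Type u} (T : BranchDecomposition V) (c : V → Fin 3) (x : V) : RefNode :=
  .copy (c x) (T.leaf x)

/-- One simplification step on a graph `p.2` with set of nodes `p.1`, where `K` is the set of
labelled nodes. -/
inductive SimplifyStep (K : Set RefNode) :
    Set RefNode × SimpleGraph RefNode → Set RefNode × SimpleGraph RefNode → Prop
  /-- Remove a node of degree 1 that is not labelled. -/
  | prune (S : Set RefNode) (G : SimpleGraph RefNode) (z : RefNode) :
      z ∈ S → z ∉ K → (G.neighborSet z).ncard = 1 →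
      SimplifyStep K (S, G) (S \ {z}, G.deleteIncidenceSet z)
  /-- Suppress a node of degree 2. -/
  | suppress (S : Set RefNode) (G : SimpleGraph RefNode) (z p q : RefNode) :
      z ∈ S → p ≠ q → G.neighborSet z = {p, q} →
      SimplifyStep K (S, G) (S \ {z}, G.deleteIncidenceSet z ⊔ SimpleGraph.edge p q)

/-- `T'` is (up to the names of the nodes) the refinement of `T` with `(ab, C₀, C₁, C₂)`. -/
def IsRefinement {V : Type u} (T : BranchDecomposition V) (a b : ℕ) (c : V → Fin 3)
    (T' : BranchDecomposition V) : Prop :=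
  ∃ (S : Set RefNode) (G : SimpleGraph RefNode) (φ : ℕ → RefNode),
    Relation.ReflTransGen (SimplifyStep (Set.range (refLabel T c)))
      (refNodes T, refGraph T a b) (S, G) ∧
    (∀ q, ¬ SimplifyStep (Set.range (refLabel T c)) (S, G) q) ∧
    Set.BijOn φ (T'.nodes : Set ℕ) S ∧
    (∀ x ∈ T'.nodes, ∀ y ∈ T'.nodes, T'.graph.Adj x y ↔ G.Adj (φ x) (φ y)) ∧
    (∀ x : V, φ (T'.leaf x) = refLabel T c x)

/-- `T'`, rooted at `r'`, is the refinement of `T` with `(ab, C₀, C₁, C₂)`, obtained in place: the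
edit set `R` is removed, a connected subtree on a set `M` of `|R|` inserted nodes takes its place,
all the rest of `T` stays as it is, and `r'` is an edge between two inserted nodes. (The names of
the removed nodes may be used again.) -/
def IsInPlaceRefinement {V : Type u} (T : BranchDecomposition V) (a b : ℕ) (c : V → Fin 3)
    (T' : BranchDecomposition V) (r' : ℕ × ℕ) : Prop :=
  IsRefinement T a b c T' ∧ T'.leaf = T.leaf ∧
  ∃ M : Finset ℕ,
    M.card = (editSet T a b c).ncard ∧
    Disjoint (M : Set ℕ) ((T.nodes : Set ℕ) \ editSet T a b c) ∧
    (T'.nodes : Set ℕ) = ((T.nodes : Set ℕ) \ editSet T a b c) ∪ (M : Set ℕ) ∧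
    (T'.graph.induce (M : Set ℕ)).Connected ∧
    (∀ x ∈ (T.nodes : Set ℕ) \ editSet T a b c, ∀ y ∈ (T.nodes : Set ℕ) \ editSet T a b c,
      (T'.graph.Adj x y ↔ T.graph.Adj x y)) ∧
    r'.1 ∈ M ∧ r'.2 ∈ M ∧ T'.graph.Adj r'.1 r'.2

/-! ### Refinement data structures -/

/-- A branch decomposition whose tree is stored by adjacency lists, in any order. -/
structure StoredDecomposition (V : Type u) extends BranchDecomposition V where
  nbrs : ℕ → List ℕ
  nbrs_nodup : ∀ x ∈ nodes, (nbrs x).Nodup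
  mem_nbrs : ∀ x ∈ nodes, ∀ y, y ∈ nbrs x ↔ graph.Adj x y

/-- What `EditSet()` returns, as lists: the edit set `R` and its neighbor partition
`(N₀, N₁, N₂)`. The tripartition `c` they come from is recorded too, for the specification. -/
structure EditInfo (V : Type u) where
  c : V → Fin 3
  R : List ℕ
  N : Fin 3 → List ℕ

/-- `e` describes a global `T`-improvement on the edge `ab`, its edit set and neighbor partition. -/
structure IsEditInfo {V : Type u} (f : Set V → ℕ) (T : BranchDecomposition V) (a b : ℕ)
    (e : EditInfo V) : Prop where
  globalImprovement : IsGlobalImprovement f T a b e.c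
  R_nodup : e.R.Nodup
  mem_R : ∀ w, w ∈ e.R ↔ w ∈ editSet T a b e.c
  N_nodup : ∀ i, (e.N i).Nodup
  mem_N : ∀ i w, w ∈ e.N i ↔ w ∈ neighborPart T a b e.c i

/-- A refinement data structure of `f` for branch decompositions of width at most `k`. It maintains
a branch decomposition `tree s` rooted at an edge `root s`, where `s` is its internal state. Each
operation may change the internal state and comes with its running time. Its arguments include
proofs that it is invoked as intended. -/
structure RefinementDataStructure {V : Type u} (f : Set V → ℕ) (k : ℕ) where
  State : Type v
  tree : State → StoredDecomposition V
  root : State → ℕ × ℕ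
  root_adj : ∀ s, (tree s).graph.Adj (root s).1 (root s).2
  width_le : ∀ s, (tree s).width f ≤ k
  /-- The states in which `EditSet()` can be invoked (reached by `CanRefine()` returning true). -/
  Ready : State → Prop
  /-- The arguments, if any, with which `Refine` can be invoked (those just returned by
  `EditSet()`). -/
  pending : State → Option (EditInfo V)
  /- `Init(T, ab)`. -/
  init : (T : StoredDecomposition V) → (a b : ℕ) → T.width f ≤ k → T.graph.Adj a b → State
  initTime : (T : StoredDecomposition V) → (a b : ℕ) → T.width f ≤ k → T.graph.Adj a b → ℕ
  init_tree : ∀ T a b hw h,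
    (tree (init T a b hw h)).toBranchDecomposition = T.toBranchDecomposition
  init_root : ∀ T a b hw h, root (init T a b hw h) = (a, b)
  /- `Move(ab)`: replace the root edge by another edge `ab`, where `a` is an end of the root. -/
  move : (s : State) → (a b : ℕ) → (a = (root s).1 ∨ a = (root s).2) →
    (tree s).graph.Adj a b → s(a, b) ≠ s((root s).1, (root s).2) → State
  moveTime : (s : State) → (a b : ℕ) → (a = (root s).1 ∨ a = (root s).2) →
    (tree s).graph.Adj a b → s(a, b) ≠ s((root s).1, (root s).2) → ℕ
  move_tree : ∀ s a b h₁ h₂ h₃,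
    (tree (move s a b h₁ h₂ h₃)).toBranchDecomposition = (tree s).toBranchDecomposition
  move_root : ∀ s a b h₁ h₂ h₃, root (move s a b h₁ h₂ h₃) = (a, b)
  /- `Width()`. -/
  width : State → State
  widthTime : State → ℕ
  widthValue : State → ℕ
  width_tree : ∀ s, (tree (width s)).toBranchDecomposition = (tree s).toBranchDecomposition
  width_root : ∀ s, root (width s) = root s
  width_value : ∀ s, widthValue s = f ((tree s).side (root s).1 (root s).2)
  /- `CanRefine()`. -/
  canRefine : State → State
  canRefineTime : State → ℕ
  canRefineValue : State → Bool
  canRefine_tree : ∀ s,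
    (tree (canRefine s)).toBranchDecomposition = (tree s).toBranchDecomposition
  canRefine_root : ∀ s, root (canRefine s) = root s
  canRefine_value : ∀ s, canRefineValue s = true ↔
    ∃ c, IsImprovement f ((tree s).side (root s).1 (root s).2) c
  canRefine_ready : ∀ s, canRefineValue s = true → Ready (canRefine s)
  /- `EditSet()`. -/
  editSet : (s : State) → Ready s → State
  editSetTime : (s : State) → Ready s → ℕ
  editSetValue : (s : State) → Ready s → EditInfo V
  editSet_tree : ∀ s h,
    (tree (editSet s h)).toBranchDecomposition = (tree s).toBranchDecomposition
  editSet_root : ∀ s h, root (editSet s h) = root s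
  editSet_value : ∀ s h, IsEditInfo f (tree s).toBranchDecomposition (root s).1 (root s).2
    (editSetValue s h)
  editSet_pending : ∀ s h, pending (editSet s h) = some (editSetValue s h)
  /- `Refine(R, (N₀, N₁, N₂))`. -/
  refine : (s : State) → (e : EditInfo V) → pending s = some e → State
  refineTime : (s : State) → (e : EditInfo V) → pending s = some e → ℕ
  refine_tree : ∀ s e h, IsInPlaceRefinement (tree s).toBranchDecomposition
    (root s).1 (root s).2 e.c (tree (refine s e h)).toBranchDecomposition (root (refine s e h))
  /- `Output()`. -/
  output : State → State
  outputTime : State → ℕ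
  outputValue : State → BranchDecomposition V
  output_tree : ∀ s, (tree (output s)).toBranchDecomposition = (tree s).toBranchDecomposition
  output_root : ∀ s, root (output s) = root s
  output_value : ∀ s, outputValue s = (tree s).toBranchDecomposition

/-- The operations of `D` obey the time bounds of a refinement data structure, where `τ` is the
bound for the operations that take "constant" time (`τ` is to be a constant times `t(k)`). -/
structure RefinementDataStructure.RunsInTime {V : Type u} {f : Set V → ℕ} {k : ℕ}
    (D : RefinementDataStructure.{u, v} f k) (τ : ℝ) : Prop where
  init : ∀ T a b hw h, (D.initTime T a b hw h : ℝ) ≤ τ * T.nodes.card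
  move : ∀ s a b h₁ h₂ h₃, (D.moveTime s a b h₁ h₂ h₃ : ℝ) ≤ τ
  width : ∀ s, (D.widthTime s : ℝ) ≤ τ
  canRefine : ∀ s, (D.canRefineTime s : ℝ) ≤ τ
  editSet : ∀ s h, (D.editSetTime s h : ℝ) ≤ τ * (D.editSetValue s h).R.length
  refine : ∀ s e h, (D.refineTime s e h : ℝ) ≤ τ * e.R.length
  output : ∀ s, (D.outputTime s : ℝ) ≤ τ * (D.tree s).nodes.card

/-! ### Programs and their running time

Programs run on a random access machine with registers and arrays (both named by natural numbers)
that hold natural numbers. Besides its own memory, a program can follow the adjacency lists of the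
current tree and call the operations of a refinement data structure. -/

/-- Comparisons of two registers. -/
inductive Test : Type
  | lt (x y : ℕ)
  | eq (x y : ℕ)

/-- The value of a comparison. -/
def Test.Holds (reg : ℕ → ℕ) : Test → Prop
  | .lt x y => reg x < reg y
  | .eq x y => reg x = reg y

/-- Programs. The arguments `x y z` are names of registers, `A A₀ A₁ A₂` are names of arrays, and
`m` is a constant. -/
inductive Prog : Type
  | skip
  | const (x m : ℕ)
  | copy (x y : ℕ)
  | add (x y z : ℕ)
  | sub (x y z : ℕ)
  | load (x A y : ℕ)
  | store (A x y : ℕ)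
  | degree (x y : ℕ)
  | neighbor (x y z : ℕ)
  | seq (p q : Prog)
  | cond (b : Test) (p q : Prog)
  | loop (b : Test) (p : Prog)
  | callInit (x y : ℕ)
  | callMove (x y : ℕ)
  | callWidth (x : ℕ)
  | callCanRefine (x : ℕ)
  | callEditSet (A A₀ A₁ A₂ : ℕ)
  | callRefine (A A₀ A₁ A₂ x y : ℕ)
  | callOutput
  | conclude

/-- The answers of the algorithm: a branch decomposition, or the conclusion that the width of the
given one is at most twice the branchwidth. -/
inductive Answer (V : Type u) : Type u
  | decomposition (T : BranchDecomposition V)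
  | twoApproximation

/-- A configuration: the memory of the program, the internal state of the data structure (`none`
before `Init`), and the answer given so far. -/
structure Config {V : Type u} {f : Set V → ℕ} {k : ℕ} (D : RefinementDataStructure.{u, v} f k) where
  reg : ℕ → ℕ
  arr : ℕ → ℕ → ℕ
  ds : Option D.State
  out : Option (Answer V)

section Machine

variable {V : Type u} {f : Set V → ℕ} {k : ℕ} {D : RefinementDataStructure.{u, v} f k}

/-- Assignment to a register. -/
def Config.setReg (C : Config D) (x m : ℕ) : Config D :=
  { C with reg := Function.update C.reg x m }

/-- Assignment to a whole array. -/
def Config.setArr (C : Config D) (A : ℕ) (g : ℕ → ℕ) : Config D :=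
  { C with arr := Function.update C.arr A g }

/-- A change of the internal state of the data structure. -/
def Config.setDS (C : Config D) (s : D.State) : Config D :=
  { C with ds := some s }

/-- Giving an answer. -/
def Config.setOut (C : Config D) (a : Answer V) : Config D :=
  { C with out := some a }

/-- The adjacency lists that the program can follow: those of the input `T₀` before `Init`, and
those of the tree maintained by the data structure afterwards. -/
def Config.nbrs (T₀ : StoredDecomposition V) (C : Config D) : ℕ → List ℕ :=
  match C.ds with
  | none => T₀.nbrs
  | some s => (D.tree s).nbrs

/-- A list is held in an array as its length followed by its entries. -/
def HoldsList (g : ℕ → ℕ) (l : List ℕ) : Prop :=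
  g 0 = l.length ∧ ∀ i < l.length, g (i + 1) = l.getD i 0

/-- Write a list to an array. -/
def writeList (g : ℕ → ℕ) (l : List ℕ) : ℕ → ℕ := fun i =>
  if i = 0 then l.length else if i ≤ l.length then l.getD (i - 1) 0 else g i

/-- The initial configuration: all of the memory is 0, except that register 0 points to a node `p`
of the input tree. -/
def Config.start (D : RefinementDataStructure.{u, v} f k) (p : ℕ) : Config D where
  reg := Function.update (fun _ => 0) 0 p
  arr := fun _ _ => 0
  ds := none
  out := none

/-- `Exec D T₀ p C n C'`: on the input `T₀`, and with access to `D`, the program `p` started in `C`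
halts in `C'` after `n` steps. Each elementary instruction and each evaluation of a test takes one
step; a call takes one step and the running time of the operation. There is no rule for a call that
the data structure does not allow, so that a program which makes such a call has no execution. -/
inductive Exec (D : RefinementDataStructure.{u, v} f k) (T₀ : StoredDecomposition V) :
    Prog → Config D → ℕ → Config D → Prop
  | skip (C) : Exec D T₀ .skip C 1 C
  | const (x m C) : Exec D T₀ (.const x m) C 1 (C.setReg x m)
  | copy (x y C) : Exec D T₀ (.copy x y) C 1 (C.setReg x (C.reg y))
  | add (x y z C) : Exec D T₀ (.add x y z) C 1 (C.setReg x (C.reg y + C.reg z))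
  | sub (x y z C) : Exec D T₀ (.sub x y z) C 1 (C.setReg x (C.reg y - C.reg z))
  | load (x A y C) : Exec D T₀ (.load x A y) C 1 (C.setReg x (C.arr A (C.reg y)))
  | store (A x y C) : Exec D T₀ (.store A x y) C 1
      (C.setArr A (Function.update (C.arr A) (C.reg x) (C.reg y)))
  | degree (x y C) : Exec D T₀ (.degree x y) C 1 (C.setReg x (C.nbrs T₀ (C.reg y)).length)
  | neighbor (x y z C) : Exec D T₀ (.neighbor x y z) C 1
      (C.setReg x ((C.nbrs T₀ (C.reg y)).getD (C.reg z) 0))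
  | seq {p q C C₁ C₂ n₁ n₂} : Exec D T₀ p C n₁ C₁ → Exec D T₀ q C₁ n₂ C₂ →
      Exec D T₀ (.seq p q) C (n₁ + n₂) C₂
  | condTrue {b p q C C₁ n} : Test.Holds C.reg b → Exec D T₀ p C n C₁ →
      Exec D T₀ (.cond b p q) C (n + 1) C₁
  | condFalse {b p q C C₁ n} : ¬ Test.Holds C.reg b → Exec D T₀ q C n C₁ →
      Exec D T₀ (.cond b p q) C (n + 1) C₁
  | loopTrue {b p C C₁ C₂ n₁ n₂} : Test.Holds C.reg b → Exec D T₀ p C n₁ C₁ →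
      Exec D T₀ (.loop b p) C₁ n₂ C₂ → Exec D T₀ (.loop b p) C (n₁ + n₂ + 1) C₂
  | loopFalse {b p C} : ¬ Test.Holds C.reg b → Exec D T₀ (.loop b p) C 1 C
  | callInit (x y C) (hC : C.ds = none) (hw : T₀.width f ≤ k)
      (h : T₀.graph.Adj (C.reg x) (C.reg y)) :
      Exec D T₀ (.callInit x y) C (D.initTime T₀ (C.reg x) (C.reg y) hw h + 1)
        (C.setDS (D.init T₀ (C.reg x) (C.reg y) hw h))
  | callMove (x y C s) (hC : C.ds = some s)
      (h₁ : C.reg x = (D.root s).1 ∨ C.reg x = (D.root s).2)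
      (h₂ : (D.tree s).graph.Adj (C.reg x) (C.reg y))
      (h₃ : s(C.reg x, C.reg y) ≠ s((D.root s).1, (D.root s).2)) :
      Exec D T₀ (.callMove x y) C (D.moveTime s (C.reg x) (C.reg y) h₁ h₂ h₃ + 1)
        (C.setDS (D.move s (C.reg x) (C.reg y) h₁ h₂ h₃))
  | callWidth (x C s) (hC : C.ds = some s) :
      Exec D T₀ (.callWidth x) C (D.widthTime s + 1)
        ((C.setDS (D.width s)).setReg x (D.widthValue s))
  | callCanRefine (x C s) (hC : C.ds = some s) :
      Exec D T₀ (.callCanRefine x) C (D.canRefineTime s + 1)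
        ((C.setDS (D.canRefine s)).setReg x (D.canRefineValue s).toNat)
  | callEditSet (A A₀ A₁ A₂ C s) (hC : C.ds = some s) (h : D.Ready s) :
      Exec D T₀ (.callEditSet A A₀ A₁ A₂) C (D.editSetTime s h + 1)
        (((((C.setDS (D.editSet s h)).setArr
          A (writeList (C.arr A) (D.editSetValue s h).R)).setArr
          A₀ (writeList (C.arr A₀) ((D.editSetValue s h).N 0))).setArr
          A₁ (writeList (C.arr A₁) ((D.editSetValue s h).N 1))).setArr
          A₂ (writeList (C.arr A₂) ((D.editSetValue s h).N 2)))
  | callRefine (A A₀ A₁ A₂ x y C s e) (hC : C.ds = some s) (h : D.pending s = some e)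
      (hR : HoldsList (C.arr A) e.R) (h₀ : HoldsList (C.arr A₀) (e.N 0))
      (h₁ : HoldsList (C.arr A₁) (e.N 1)) (h₂ : HoldsList (C.arr A₂) (e.N 2)) :
      Exec D T₀ (.callRefine A A₀ A₁ A₂ x y) C (D.refineTime s e h + 1)
        (((C.setDS (D.refine s e h)).setReg
          x (D.root (D.refine s e h)).1).setReg y (D.root (D.refine s e h)).2)
  | callOutput (C s) (hC : C.ds = some s) :
      Exec D T₀ .callOutput C (D.outputTime s + 1)
        ((C.setDS (D.output s)).setOut (.decomposition (D.outputValue s)))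
  | conclude (C) : Exec D T₀ .conclude C 1 (C.setOut .twoApproximation)

end Machine

/-!
# Improving branch decompositions by refinement in amortized linear time

The algorithm walks through the tree by depth-first search, moving the root edge along. A first
search computes the width `k`. In a second search, whenever an edge of width `k` is met, the data
structure is asked for an improvement. If there is none, then `k` is at most twice the branchwidth.
Otherwise the tree is refined and the search goes on at an inserted node. When the second search
comes to its end, no edge of width `k` is left. The following facts carry the proof.

*Existence of improvements* (`exists_isImprovement`). Let `f W` be more than twice the branchwidth,
and take an optimal branch decomposition. For each of its edges, one of the two sides meets both `W`
and its complement in sets of value less than `f W`, by submodularity. If this holds for both sides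
of some edge, they form an improvement; otherwise all edges can be directed, and the three sides
around a sink do.

*A refinement lowers widths* (`IsGlobalImprovement.below_inter_part_lt`). If `A` is the rooted
subtree of a node of the edit set and `C` a part of a global improvement, then `f (A ∩ C) < f A`:
otherwise, `A` could be moved into the part `C`, which would give a minimum improvement with a
smaller edit set. The sides of the refinement are the parts `C` and the sets `A ∩ C` for rooted
subtrees `A`, up to complements (`IsRefinement.side`), because the simplification steps contract
edges and so create no new sides. Therefore edges between inserted nodes have width less than `k`
(`IsReplacement.side_lt`), while the edges at kept nodes keep their sides
(`IsReplacement.exists_parent`).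

*Refinements are paid for by a potential* (`IsRefinement.potential_le`). Let the potential be the
sum of `16 ^ f(A)` over all sides `A` of the tree. A refinement with edit set `R` lowers it by at
least `|R|`, since each side that disappears is replaced by at most six sides of smaller value. The
potential is at most `16 ^ k` times the number of directed edges, so that all edit sets together have
size `O(16 ^ k n)`.

*The search survives a refinement* (`IsSearch.repair`). The root edge leads from the current node to
an unseen one, and the edit set is closed under parents. Hence the removed nodes on the stack are its
upper part, and closed nodes stay closed. The inserted nodes become unseen, except for a path from
the new current node to the inserted neighbour of the remaining stack, if there is one. This path is
found by a breadth-first search through the inserted nodes (`runs_repairProg`), which takes time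
`O(|R|)`.

Executions of programs are handled with `Runs`: `Runs D T₀ p C Q` says that `p` halts when started
in `C`, and that the number of steps and the last configuration satisfy `Q`. Loops have an invariant
that also bounds the remaining number of steps (`runs_loop`); for the searches, this bound is
`searchCost`.
-/

/-! ### Components of a graph after removal of an edge -/

/-- The nodes in the component of `x` after removal of the edge `xy`. -/
def edgeComp {α : Type*} (G : SimpleGraph α) (x y : α) : Set α :=
  {z | (G.deleteEdges {s(x, y)}).Reachable x z}

section EdgeComp

variable {α : Type*} {G : SimpleGraph α} {x y z z' t : α}

theorem self_mem_edgeComp : x ∈ edgeComp G x y := SimpleGraph.Reachable.refl _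

theorem edgeComp_step (h : z ∈ edgeComp G x y) (hz : G.Adj z z') (hne : s(z, z') ≠ s(x, y)) :
    z' ∈ edgeComp G x y := by
  refine SimpleGraph.Reachable.trans h (SimpleGraph.Adj.reachable ?_)
  simp only [SimpleGraph.deleteEdges_adj, Set.mem_singleton_iff]
  exact ⟨hz, hne⟩

/-- A set that contains `x` and that no edge but `xy` leaves contains the component of `x`. -/
theorem edgeComp_subset {X : Set α} (hx : x ∈ X)
    (hX : ∀ z z', z ∈ X → z ∈ edgeComp G x y → G.Adj z z' → s(z, z') ≠ s(x, y) → z' ∈ X) :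
    edgeComp G x y ⊆ X := by
  intro z hz
  have hz' := (SimpleGraph.reachable_iff_reflTransGen _ _).1 hz
  suffices h : z ∈ X ∧ z ∈ edgeComp G x y from h.1
  clear hz
  induction hz' with
  | refl => exact ⟨hx, self_mem_edgeComp⟩
  | tail _ h ih =>
    simp only [SimpleGraph.deleteEdges_adj, Set.mem_singleton_iff] at h
    exact ⟨hX _ _ ih.1 ih.2 h.1 h.2, edgeComp_step ih.2 h.1 h.2⟩

theorem mem_edgeComp_or (h : G.Reachable x z) : z ∈ edgeComp G x y ∨ z ∈ edgeComp G y x := by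
  have h' := (SimpleGraph.reachable_iff_reflTransGen _ _).1 h
  clear h
  induction h' with
  | refl => exact Or.inl self_mem_edgeComp
  | @tail b c _ h ih =>
    by_cases hne : s(b, c) = s(x, y)
    · rcases Sym2.eq_iff.1 hne with ⟨_, rfl⟩ | ⟨_, rfl⟩
      · exact Or.inr self_mem_edgeComp
      · exact Or.inl self_mem_edgeComp
    · rcases ih with ih | ih
      · exact Or.inl (edgeComp_step ih h hne)
      · exact Or.inr (edgeComp_step ih h (by rwa [Sym2.eq_swap (a := y)]))

theorem SimpleGraph.IsAcyclic.notMem_edgeComp (hG : G.IsAcyclic) (h : G.Adj x y) :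
    y ∉ edgeComp G x y :=
  SimpleGraph.isBridge_iff.1 (SimpleGraph.isAcyclic_iff_forall_adj_isBridge.1 hG h)

theorem SimpleGraph.IsAcyclic.notMem_edgeComp_swap (hG : G.IsAcyclic) (h : G.Adj x y)
    (hz : z ∈ edgeComp G x y) : z ∉ edgeComp G y x := by
  intro hz'
  refine hG.notMem_edgeComp h (SimpleGraph.Reachable.trans hz (SimpleGraph.Reachable.symm ?_))
  have := hz'
  rwa [edgeComp, Set.mem_ofPred_eq, Sym2.eq_swap] at this

theorem edgeComp_reachable (h : z ∈ edgeComp G x y) : G.Reachable x z :=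
  h.mono (SimpleGraph.deleteEdges_le _)

/-- An edge that leaves the component of `x` after removal of `xy` is `xy`. -/
theorem eq_of_edgeComp_leave (hG : G.IsAcyclic) (h : G.Adj x y) (hz : z ∈ edgeComp G x y)
    (hz' : z' ∉ edgeComp G x y) (hzz : G.Adj z z') : z = x ∧ z' = y := by
  by_cases hne : s(z, z') = s(x, y)
  · rcases Sym2.eq_iff.1 hne with h' | ⟨h1, h2⟩
    · exact h'
    · exact absurd (h1 ▸ hz) (hG.notMem_edgeComp h)
  · exact absurd (edgeComp_step hz hzz hne) hz'

theorem edgeComp_subset_of_mem (hG : G.IsAcyclic) (h : G.Adj x y) (hz : z ∈ edgeComp G x y)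
    (hy : y ∉ edgeComp G z z') : edgeComp G z z' ⊆ edgeComp G x y := by
  refine edgeComp_subset hz fun u u' hu hu2 huu hne => ?_
  by_contra hcon
  obtain ⟨rfl, rfl⟩ := eq_of_edgeComp_leave hG h hu hcon huu
  exact hy (edgeComp_step hu2 huu hne)

theorem edgeComp_neighbor_subset (hG : G.IsAcyclic) (h : G.Adj x y) (ht : G.Adj x t)
    (hty : t ≠ y) : edgeComp G t x ⊆ edgeComp G x y := by
  have hxt : x ∉ edgeComp G t x := hG.notMem_edgeComp ht.symm
  refine edgeComp_subset_of_mem hG h (edgeComp_step self_mem_edgeComp ht ?_) ?_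
  · intro h'
    rcases Sym2.eq_iff.1 h' with ⟨_, h2⟩ | ⟨h1, _⟩
    · exact hty h2
    · exact h.ne h1
  · intro hy
    refine hxt (edgeComp_step hy h.symm ?_)
    intro h'
    rcases Sym2.eq_iff.1 h' with ⟨h1, _⟩ | ⟨_, h2⟩
    · exact hty h1.symm
    · exact ht.ne h2

theorem exists_neighbor_of_reachable (h : G.Reachable x z) (hne : z ≠ x) :
    ∃ t, G.Adj x t ∧ z ∈ edgeComp G t x := by
  have h' := (SimpleGraph.reachable_iff_reflTransGen _ _).1 h
  clear h
  suffices H : z = x ∨ ∃ t, G.Adj x t ∧ z ∈ edgeComp G t x from H.resolve_left hne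
  clear hne
  induction h' with
  | refl => exact Or.inl rfl
  | @tail b c _ h ih =>
    by_cases hc : c = x
    · exact Or.inl hc
    right
    rcases ih with rfl | ⟨t, ht, hb⟩
    · exact ⟨c, h, self_mem_edgeComp⟩
    · by_cases hne : s(b, c) = s(t, x)
      · rcases Sym2.eq_iff.1 hne with ⟨_, h2⟩ | ⟨_, h2⟩
        · exact absurd h2 hc
        · exact ⟨t, ht, h2 ▸ self_mem_edgeComp⟩
      · exact ⟨t, ht, edgeComp_step hb h hne⟩

theorem exists_neighbor_of_mem_edgeComp (hG : G.IsAcyclic) (h : G.Adj x y)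
    (hz : z ∈ edgeComp G x y) (hne : z ≠ x) : ∃ t, G.Adj x t ∧ t ≠ y ∧ z ∈ edgeComp G t x := by
  obtain ⟨t, ht, hzt⟩ := exists_neighbor_of_reachable (edgeComp_reachable hz) hne
  refine ⟨t, ht, ?_, hzt⟩
  rintro rfl
  exact hG.notMem_edgeComp_swap h hz hzt

theorem mem_support_of_edgeComp (hG : G.IsAcyclic) (h : G.Adj x y) {w w' : α}
    (p : G.Walk w w') (hw : w ∈ edgeComp G x y) (hw' : w' ∉ edgeComp G x y) : x ∈ p.support := by
  induction p with
  | nil => exact absurd hw hw'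
  | @cons a b c hab p ih =>
    by_cases hb : b ∈ edgeComp G x y
    · simp [ih hb hw']
    · obtain ⟨rfl, rfl⟩ := eq_of_edgeComp_leave hG h hw hb hab
      simp

theorem exists_walk_in_edgeComp (hz : z ∈ edgeComp G x y) :
    ∃ p : G.Walk z x, ∀ u ∈ p.support, u ∈ edgeComp G x y := by
  refine edgeComp_subset (X := {z | ∃ p : G.Walk z x, ∀ u ∈ p.support, u ∈ edgeComp G x y})
    ⟨.nil, by simp [self_mem_edgeComp]⟩ ?_ hz
  rintro z z' ⟨p, hp⟩ hzc hzz hne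
  refine ⟨.cons hzz.symm p, ?_⟩
  intro u hu
  rw [SimpleGraph.Walk.support_cons, List.mem_cons] at hu
  rcases hu with rfl | hu
  · exact edgeComp_step hzc hzz hne
  · exact hp u hu

end EdgeComp

/-! ### Sides of edges and rooted subtrees of a branch decomposition -/

section Decomposition

variable {V : Type u} (T : BranchDecomposition V) {a b w q x y z : ℕ}

namespace BranchDecomposition

theorem mem_side {p : V} : p ∈ T.side x y ↔ T.leaf p ∈ edgeComp T.graph x y := Iff.rfl

theorem mem_nodes_right (h : T.graph.Adj x y) : y ∈ T.nodes := T.mem_of_adj _ _ h.symm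

theorem leaf_mem (p : V) : T.leaf p ∈ T.nodes := (T.leaf_bijOn.mapsTo (Set.mem_univ p)).1

theorem edgeComp_subset_nodes (h : T.graph.Adj x y) : edgeComp T.graph x y ⊆ T.nodes :=
  edgeComp_subset (T.mem_of_adj _ _ h) fun _ _ _ _ hz _ => T.mem_nodes_right hz

theorem mem_edgeComp_or (hx : x ∈ T.nodes) (hz : z ∈ T.nodes) :
    z ∈ edgeComp T.graph x y ∨ z ∈ edgeComp T.graph y x :=
  _root_.mem_edgeComp_or (T.reachable _ hx _ hz)

theorem side_compl (h : T.graph.Adj x y) : T.side y x = (T.side x y)ᶜ := by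
  ext p
  rw [Set.mem_compl_iff, mem_side, mem_side]
  constructor
  · exact fun hp => T.acyclic.notMem_edgeComp_swap h.symm hp
  · exact fun hp => (T.mem_edgeComp_or (T.mem_of_adj _ _ h) (T.leaf_mem p)).resolve_left hp

theorem neighborSet_finite (x : ℕ) : (T.graph.neighborSet x).Finite :=
  T.nodes.finite_toSet.subset fun _ hy => T.mem_nodes_right hy

/-- A node with two neighbours has a third one. -/
theorem exists_third (h : T.graph.Adj x y) (h' : T.graph.Adj x z) (hne : y ≠ z) :
    ∃ t, T.graph.Adj x t ∧ t ≠ y ∧ t ≠ z := by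
  have h1 : ({y, z} : Set ℕ) ⊆ T.graph.neighborSet x := by
    rintro t (rfl | rfl)
    exacts [h, h']
  have h2 := Set.ncard_le_ncard h1 (T.neighborSet_finite x)
  rw [Set.ncard_pair hne] at h2
  have h3 : (T.graph.neighborSet x).ncard = 3 := by
    rcases T.cubic x (T.mem_of_adj _ _ h) with h | h <;> omega
  by_contra hcon
  push Not at hcon
  have h4 : T.graph.neighborSet x ⊆ {y, z} := by
    intro t ht
    by_cases hty : t = y
    · exact Or.inl hty
    · exact Or.inr (hcon t ht hty)
  have h5 := Set.ncard_le_ncard h4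
  rw [Set.ncard_pair hne] at h5
  omega

theorem exists_leaf_eq (hx : x ∈ T.nodes) (h : (T.graph.neighborSet x).ncard = 1) :
    ∃ p, T.leaf p = x := by
  obtain ⟨p, _, hp⟩ := T.leaf_bijOn.surjOn ⟨hx, h⟩
  exact ⟨p, hp⟩

theorem side_nonempty (h : T.graph.Adj x y) : (T.side x y).Nonempty := by
  suffices H : ∀ n x y, T.graph.Adj x y → (edgeComp T.graph x y).ncard ≤ n →
      (T.side x y).Nonempty from H _ x y h le_rfl
  intro n
  induction n with
  | zero =>
    intro x y h hn
    have hf : (edgeComp T.graph x y).Finite :=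
      T.nodes.finite_toSet.subset (T.edgeComp_subset_nodes h)
    rw [Nat.le_zero, Set.ncard_eq_zero hf] at hn
    have := self_mem_edgeComp (G := T.graph) (x := x) (y := y)
    simp [hn] at this
  | succ n ih =>
    intro x y h hn
    have hf : (edgeComp T.graph x y).Finite :=
      T.nodes.finite_toSet.subset (T.edgeComp_subset_nodes h)
    rcases T.cubic x (T.mem_of_adj _ _ h) with h1 | h1
    · obtain ⟨p, hp⟩ := T.exists_leaf_eq (T.mem_of_adj _ _ h) h1
      exact ⟨p, by rw [mem_side, hp]; exact self_mem_edgeComp⟩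
    · obtain ⟨t, ht, hty⟩ : ∃ t, T.graph.Adj x t ∧ t ≠ y := by
        obtain ⟨t, ht, hty⟩ := Set.exists_ne_of_one_lt_ncard (by omega :
          1 < (T.graph.neighborSet x).ncard) y
        exact ⟨t, ht, hty⟩
      have hs := edgeComp_neighbor_subset T.acyclic h ht hty
      have hlt : (edgeComp T.graph t x).ncard < (edgeComp T.graph x y).ncard :=
        Set.ncard_lt_ncard (hs.ssubset_of_ne fun he => T.acyclic.notMem_edgeComp ht.symm
          (he ▸ self_mem_edgeComp)) hf
      obtain ⟨p, hp⟩ := ih t x ht.symm (by omega)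
      exact ⟨p, hs hp⟩

theorem side_ssubset {z' : ℕ} (h : T.graph.Adj x y) (hz : T.graph.Adj z z')
    (hzx : z ∈ edgeComp T.graph x y) (hz'x : z' ∈ edgeComp T.graph x y)
    (hy : y ∉ edgeComp T.graph z z') : T.side z z' ⊂ T.side x y := by
  have hG := T.acyclic
  have hsub : T.side z z' ⊆ T.side x y := fun p hp => edgeComp_subset_of_mem hG h hzx hy hp
  have hxz : x ∉ edgeComp T.graph z z' := by
    intro hx
    obtain ⟨_, rfl⟩ := eq_of_edgeComp_leave hG hz hx hy h
    exact hG.notMem_edgeComp h hz'x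
  have hne : z ≠ x := by
    rintro rfl
    exact hxz self_mem_edgeComp
  obtain ⟨t, ht, hty, hzt⟩ := exists_neighbor_of_mem_edgeComp hG h hzx hne
  obtain ⟨t', ht', ht'y, ht't⟩ := T.exists_third h ht hty.symm
  obtain ⟨p, hp⟩ := T.side_nonempty ht'.symm
  refine hsub.ssubset_of_mem_notMem (a := p) (edgeComp_neighbor_subset hG h ht' ht'y hp) ?_
  intro hp'
  have h1 : T.leaf p ∈ edgeComp T.graph t x := edgeComp_subset_of_mem hG ht.symm hzt hxz hp'
  exact hG.notMem_edgeComp_swap ht (edgeComp_neighbor_subset hG ht ht' ht't hp) h1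

/-- Different directed edges have different sides. -/
theorem side_injective {z' : ℕ} (h : T.graph.Adj x y) (hz : T.graph.Adj z z')
    (he : T.side x y = T.side z z') : x = z ∧ y = z' := by
  have hG := T.acyclic
  have hxn := T.mem_of_adj _ _ h
  have key : ∀ x y z z', T.graph.Adj x y → T.graph.Adj z z' → T.side x y = T.side z z' →
      z ∈ edgeComp T.graph x y → z' ∈ edgeComp T.graph x y → False := by
    intro x y z z' h hz he h1 h2
    by_cases hy : y ∈ edgeComp T.graph z z'
    · have := T.side_ssubset h hz.symm h2 h1 (hG.notMem_edgeComp_swap hz hy)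
      rw [T.side_compl hz, he] at this
      obtain ⟨p, hp⟩ := T.side_nonempty hz.symm
      rw [T.side_compl hz] at hp
      exact hp (this.1 hp)
    · exact (T.side_ssubset h hz h1 h2 hy).ne he.symm
  rcases T.mem_edgeComp_or hxn (T.mem_of_adj _ _ hz) (y := y) with h1 | h1 <;>
  rcases T.mem_edgeComp_or hxn (T.mem_nodes_right hz) (y := y) with h2 | h2
  · exact (key x y z z' h hz he h1 h2).elim
  · obtain ⟨rfl, rfl⟩ := eq_of_edgeComp_leave hG h h1 (hG.notMem_edgeComp_swap h.symm h2) hz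
    exact ⟨rfl, rfl⟩
  · obtain ⟨rfl, rfl⟩ := eq_of_edgeComp_leave hG h h2 (hG.notMem_edgeComp_swap h.symm h1) hz.symm
    rw [T.side_compl h] at he
    obtain ⟨p, hp⟩ := T.side_nonempty h
    exact absurd hp (Set.ext_iff.1 he p |>.1 hp)
  · exact (key y x z' z h.symm hz.symm (by rw [T.side_compl h, T.side_compl hz, he]) h2 h1).elim

/-- `q` is the parent of `w` in the tree rooted at the edge `ab`: the edge `wq` does not have the
whole root on the side of `w`. Each end of the root is the parent of the other. -/
def IsParent (a b w q : ℕ) : Prop :=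
  T.graph.Adj w q ∧ ¬ (a ∈ edgeComp T.graph w q ∧ b ∈ edgeComp T.graph w q)

variable {T}

theorem isParent_total (h : T.graph.Adj x y) : T.IsParent a b x y ∨ T.IsParent a b y x := by
  by_cases h' : a ∈ edgeComp T.graph x y ∧ b ∈ edgeComp T.graph x y
  · exact Or.inr ⟨h.symm, fun h2 => T.acyclic.notMem_edgeComp_swap h h'.1 h2.1⟩
  · exact Or.inl ⟨h, h'⟩

theorem isParent_swap : T.IsParent a b w q ↔ T.IsParent b a w q := by
  unfold IsParent
  rw [and_comm (a := a ∈ _)]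

theorem isParent_root (hab : T.graph.Adj a b) : T.IsParent a b a b :=
  ⟨hab, fun h => T.acyclic.notMem_edgeComp hab h.2⟩

theorem IsParent.exists_notMem (h : T.IsParent a b w q) (hab : T.graph.Adj a b) :
    ∃ e, (e = a ∨ e = b) ∧ e ∈ edgeComp T.graph q w ∧ e ∉ edgeComp T.graph w q := by
  obtain ⟨h1, h2⟩ := h
  have hw := T.mem_of_adj _ _ h1
  by_cases ha : a ∈ edgeComp T.graph w q
  · have hb : b ∉ edgeComp T.graph w q := fun hb => h2 ⟨ha, hb⟩
    exact ⟨b, Or.inr rfl, (T.mem_edgeComp_or hw (T.mem_nodes_right hab)).resolve_left hb, hb⟩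
  · exact ⟨a, Or.inl rfl, (T.mem_edgeComp_or hw (T.mem_of_adj _ _ hab)).resolve_left ha, ha⟩

theorem IsParent.unique {q' : ℕ} (hab : T.graph.Adj a b) (h : T.IsParent a b w q)
    (h' : T.IsParent a b w q') : q = q' := by
  by_contra hne
  have hG := T.acyclic
  have s1 := edgeComp_neighbor_subset hG h.1 h'.1 (Ne.symm hne)
  have s2 := edgeComp_neighbor_subset hG h'.1 h.1 hne
  obtain ⟨e, he, h1, h2⟩ := h.exists_notMem hab
  obtain ⟨e', he', h1', h2'⟩ := h'.exists_notMem hab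
  have hee : T.graph.Adj e' e := by
    rcases he with rfl | rfl <;> rcases he' with rfl | rfl
    · exact absurd (s1 h1') h2
    · exact hab.symm
    · exact hab
    · exact absurd (s1 h1') h2
  obtain ⟨rfl, rfl⟩ := eq_of_edgeComp_leave hG h.1 (s1 h1') h2 hee
  exact hG.notMem_edgeComp h'.1.symm h1'

theorem exists_isParent (hab : T.graph.Adj a b) (hw : w ∈ T.nodes) : ∃ q, T.IsParent a b w q := by
  by_cases hwa : a = w
  · exact ⟨b, hwa ▸ isParent_root hab⟩
  · obtain ⟨t, ht, hat⟩ := exists_neighbor_of_reachable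
      (T.reachable _ hw _ (T.mem_of_adj _ _ hab)) hwa
    exact ⟨t, ht, fun h => T.acyclic.notMem_edgeComp_swap ht h.1 hat⟩

/-- The rooted subtree of `w` is cut off by the edge from `w` to its parent. -/
theorem IsParent.below_eq (hab : T.graph.Adj a b) (h : T.IsParent a b w q) :
    T.below a b w = T.side w q := by
  have hG := T.acyclic
  ext p
  constructor
  · rintro ⟨h1, h2⟩
    by_contra hp
    have hp' : T.leaf p ∈ edgeComp T.graph q w :=
      (T.mem_edgeComp_or (T.mem_of_adj _ _ h.1) (T.leaf_mem p)).resolve_left hp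
    obtain ⟨e, he, he1, _⟩ := h.exists_notMem hab
    obtain ⟨p1, hp1⟩ := exists_walk_in_edgeComp hp'
    obtain ⟨p2, hp2⟩ := exists_walk_in_edgeComp he1
    have hw : w ∉ (p1.append p2.reverse).support := by
      intro hw
      rw [SimpleGraph.Walk.mem_support_append_iff, SimpleGraph.Walk.support_reverse,
        List.mem_reverse] at hw
      exact hG.notMem_edgeComp h.1.symm (hw.elim (hp1 _) (hp2 _))
    rcases he with rfl | rfl
    · exact hw (h1 _)
    · exact hw (h2 _)
  · intro hp
    have key : ∀ e, e = a ∨ e = b → ∀ p : T.graph.Walk (T.leaf p) e, w ∈ p.support := by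
      intro e he p
      by_cases hew : e ∈ edgeComp T.graph w q
      · have : e = w := by
          obtain ⟨e', he', he1, he2⟩ := h.exists_notMem hab
          have hee : T.graph.Adj e e' := by
            rcases he with rfl | rfl <;> rcases he' with rfl | rfl
            · exact absurd hew he2
            · exact hab
            · exact hab.symm
            · exact absurd hew he2
          exact (eq_of_edgeComp_leave hG h.1 hew he2 hee).1
        subst this
        simp
      · exact mem_support_of_edgeComp hG h.1 p hp hew
    exact ⟨key a (Or.inl rfl), key b (Or.inr rfl)⟩

theorem below_root_left (hab : T.graph.Adj a b) : T.below a b a = T.side a b :=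
  (isParent_root hab).below_eq hab

theorem below_root_right (hab : T.graph.Adj a b) : T.below a b b = T.side b a :=
  (isParent_swap.1 (isParent_root hab.symm)).below_eq hab

theorem below_nonempty (hab : T.graph.Adj a b) (hw : w ∈ T.nodes) : (T.below a b w).Nonempty := by
  obtain ⟨q, hq⟩ := exists_isParent hab hw
  rw [hq.below_eq hab]
  exact T.side_nonempty hq.1

/-- The rooted subtree of a node in the rooted subtree of `w` is contained in the latter. -/
theorem IsParent.edgeComp_subset {q' : ℕ} (hab : T.graph.Adj a b) (h : T.IsParent a b w q)
    (h' : T.IsParent a b z q') (hz : z ∈ edgeComp T.graph w q) :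
    edgeComp T.graph z q' ⊆ edgeComp T.graph w q := by
  have hG := T.acyclic
  by_cases hq : q ∈ edgeComp T.graph z q'
  · obtain ⟨e, he, he1, he2⟩ := h'.exists_notMem hab
    have hne : z = w := by
      by_cases hq' : q' ∈ edgeComp T.graph w q
      · obtain ⟨e', he', he1', he2'⟩ := h.exists_notMem hab
        have s := edgeComp_subset_of_mem hG h'.1 hq (hG.notMem_edgeComp_swap h.1 hq')
        have hee : T.graph.Adj e' e := by
          rcases he with rfl | rfl <;> rcases he' with rfl | rfl
          · exact absurd (s he1') he2
          · exact hab.symm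
          · exact hab
          · exact absurd (s he1') he2
        obtain ⟨h1, h2⟩ := eq_of_edgeComp_leave hG h'.1 (s he1') he2 hee
        have he3 : e ∈ edgeComp T.graph w q := h2 ▸ hq'
        exact h1.symm.trans (by
          have := eq_of_edgeComp_leave hG h.1 he3 he2' hee.symm
          rw [h1] at this
          exact absurd (this.2 ▸ hz) (hG.notMem_edgeComp h.1))
      · exact (eq_of_edgeComp_leave hG h.1 hz hq' h'.1).1
    subst hne
    rw [h.unique hab h']
  · exact edgeComp_subset_of_mem hG h.1 hz hq

theorem IsParent.below_subset (hab : T.graph.Adj a b) (h : T.IsParent a b w q)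
    (hz : z ∈ edgeComp T.graph w q) : T.below a b z ⊆ T.below a b w := by
  obtain ⟨q', hq'⟩ := exists_isParent hab (T.edgeComp_subset_nodes h.1 hz)
  rw [h.below_eq hab, hq'.below_eq hab]
  exact fun p hp => h.edgeComp_subset hab hq' hz hp

/-- Rooted subtrees are nested or disjoint. -/
theorem below_laminar (hab : T.graph.Adj a b) (hw : w ∈ T.nodes) (hz : z ∈ T.nodes) :
    T.below a b w ⊆ T.below a b z ∨ T.below a b z ⊆ T.below a b w ∨
      Disjoint (T.below a b w) (T.below a b z) := by
  have hG := T.acyclic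
  obtain ⟨q, hq⟩ := exists_isParent hab hw
  obtain ⟨q', hq'⟩ := exists_isParent hab hz
  by_cases h1 : z ∈ edgeComp T.graph w q
  · exact Or.inr (Or.inl (hq.below_subset hab h1))
  by_cases h2 : w ∈ edgeComp T.graph z q'
  · exact Or.inl (hq'.below_subset hab h2)
  right; right
  have h1' := (T.mem_edgeComp_or hw hz).resolve_left h1
  rw [hq.below_eq hab, hq'.below_eq hab, Set.disjoint_left]
  intro p hp hp'
  exact hG.notMem_edgeComp_swap hq.1.symm (edgeComp_subset_of_mem hG hq.1.symm h1' h2 hp') hp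

/-- The rooted subtree of a node other than the ends of the root is part of that of its parent. -/
theorem IsParent.below_subset_parent (hab : T.graph.Adj a b) (h : T.IsParent a b w q)
    (hne : s(w, q) ≠ s(a, b)) : T.below a b w ⊆ T.below a b q := by
  obtain ⟨q', hq'⟩ := exists_isParent hab (T.mem_nodes_right h.1)
  by_cases hw : w = q'
  · subst hw
    exfalso
    obtain ⟨e, he, he1, he2⟩ := h.exists_notMem hab
    obtain ⟨e', he', he1', he2'⟩ := hq'.exists_notMem hab
    have hee : T.graph.Adj e' e ∧ s(e', e) = s(a, b) := by
      rcases he with rfl | rfl <;> rcases he' with rfl | rfl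
      · exact absurd he1 he2'
      · exact ⟨hab.symm, Sym2.eq_swap⟩
      · exact ⟨hab, rfl⟩
      · exact absurd he1 he2'
    obtain ⟨rfl, rfl⟩ := eq_of_edgeComp_leave T.acyclic h.1 he1' he2 hee.1
    exact hne hee.2
  · rw [h.below_eq hab, hq'.below_eq hab]
    exact fun p hp => edgeComp_neighbor_subset T.acyclic hq'.1 h.1.symm hw hp

theorem below_injective (hab : T.graph.Adj a b) (hw : w ∈ T.nodes) (hz : z ∈ T.nodes)
    (he : T.below a b w = T.below a b z) : w = z := by
  obtain ⟨q, hq⟩ := exists_isParent hab hw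
  obtain ⟨q', hq'⟩ := exists_isParent hab hz
  rw [hq.below_eq hab, hq'.below_eq hab] at he
  exact (T.side_injective hq.1 hq'.1 he).1

/-- The rooted subtree of a node lies on one side of the root. -/
theorem below_subset_root (hab : T.graph.Adj a b) (hw : w ∈ T.nodes) :
    T.below a b w ⊆ T.side a b ∨ T.below a b w ⊆ (T.side a b)ᶜ := by
  rw [← T.side_compl hab, ← below_root_left hab, ← below_root_right hab]
  rcases T.mem_edgeComp_or (T.mem_of_adj _ _ hab) hw (y := b) with h | h
  · exact Or.inl ((isParent_root hab).below_subset hab h)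
  · exact Or.inr ((isParent_swap.1 (isParent_root hab.symm)).below_subset hab h)

end BranchDecomposition

end Decomposition

/-! ### Existence of improvements -/

section Width

variable {V : Type u} {f : Set V → ℕ}

theorem BranchDecomposition.le_width (T : BranchDecomposition V) {x y : ℕ} (h : T.graph.Adj x y) :
    f (T.side x y) ≤ T.width f := by
  classical
  refine le_trans ?_ (Finset.le_sup (T.mem_of_adj _ _ h))
  refine le_trans ?_ (Finset.le_sup (T.mem_nodes_right h))
  rw [if_pos h]

theorem BranchDecomposition.width_le_iff (T : BranchDecomposition V) {m : ℕ} :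
    T.width f ≤ m ↔ ∀ x y, T.graph.Adj x y → f (T.side x y) ≤ m := by
  classical
  constructor
  · exact fun h x y hxy => (T.le_width hxy).trans h
  · intro h
    refine Finset.sup_le fun x _ => Finset.sup_le fun y _ => ?_
    split_ifs with hxy
    · exact h x y hxy
    · exact Nat.zero_le _

theorem exists_width_eq_branchwidth (T : BranchDecomposition V) (f : Set V → ℕ) :
    ∃ T' : BranchDecomposition V, T'.width f = branchwidth f :=
  Nat.sInf_mem (s := Set.range fun T : BranchDecomposition V => T.width f) ⟨_, T, rfl⟩

namespace IsConnectivityFunction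

theorem union_le (hf : IsConnectivityFunction f) (A B : Set V) : f (A ∪ B) ≤ f A + f B :=
  le_trans (Nat.le_add_right _ _) (hf.submodular A B)

/-- Submodularity for a difference of sets. -/
theorem diff_le (hf : IsConnectivityFunction f) (X Y : Set V) :
    f (X \ Y) + f (Y \ X) ≤ f X + f Y := by
  have h := hf.submodular Xᶜ Y
  rw [hf.symm, ← hf.symm (Xᶜ ∪ Y), Set.compl_union, compl_compl] at h
  rwa [Set.inter_comm Xᶜ Y] at h

/-- A set of small value or its complement meets both `W` and its complement in sets of value less
than `f W`. -/
theorem small_or (hf : IsConnectivityFunction f) {A W : Set V} (h : 2 * f A < f W) :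
    (f (A ∩ W) < f W ∧ f (A ∩ Wᶜ) < f W) ∨ (f (Aᶜ ∩ W) < f W ∧ f (Aᶜ ∩ Wᶜ) < f W) := by
  have s1 := hf.submodular A W
  have s2 := hf.submodular A Wᶜ
  have u1 := hf.union_le (A ∩ W) (Aᶜ ∩ W)
  have u2 := hf.union_le (A ∩ Wᶜ) (Aᶜ ∩ Wᶜ)
  rw [← Set.union_inter_distrib_right, Set.union_compl_self, Set.univ_inter] at u1 u2
  rw [← hf.symm (A ∪ W), Set.compl_union] at s1
  rw [← hf.symm (A ∪ Wᶜ), Set.compl_union, compl_compl] at s2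
  rw [hf.symm] at s2 u2
  omega

end IsConnectivityFunction

theorem IsImprovement.compl (hf : IsConnectivityFunction f) {W : Set V} {c : V → Fin 3}
    (h : IsImprovement f W c) : IsImprovement f Wᶜ c := by
  intro i
  rw [hf.symm, compl_compl]
  exact ⟨(h i).1, (h i).2.2, (h i).2.1⟩

theorem isImprovement_compl_iff (hf : IsConnectivityFunction f) {W : Set V} {c : V → Fin 3} :
    IsImprovement f Wᶜ c ↔ IsImprovement f W c :=
  ⟨fun h => compl_compl W ▸ h.compl hf, fun h => h.compl hf⟩

/-- If `f W` is more than twice the branchwidth, then there is a `W`-improvement. In an optimal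
branch decomposition, either both sides of some edge are small (in the sense of `small_or`), or
there is a smallest side that is not small; it is not a single leaf, and the three sides around its
end are the parts of an improvement. -/
theorem exists_isImprovement (hf : IsConnectivityFunction f) (T₀ : BranchDecomposition V)
    {W : Set V} (hW : 2 * branchwidth f < f W) : ∃ c, IsImprovement f W c := by
  classical
  obtain ⟨T, hT⟩ := exists_width_eq_branchwidth T₀ f
  have hle : ∀ x y, T.graph.Adj x y → 2 * f (T.side x y) < f W := fun x y h => by
    have := T.le_width (f := f) h
    omega
  let small : Set V → Prop := fun A => f (A ∩ W) < f W ∧ f (A ∩ Wᶜ) < f W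
  by_cases hbig : ∃ x y, T.graph.Adj x y ∧ ¬ small (T.side x y)
  · have hex : ∃ n x y, T.graph.Adj x y ∧ ¬ small (T.side x y) ∧
        (edgeComp T.graph x y).ncard = n := by
      obtain ⟨x, y, h1, h2⟩ := hbig
      exact ⟨_, x, y, h1, h2, rfl⟩
    obtain ⟨x, y, hxy, hns, hn⟩ := Nat.find_spec hex
    have hmin : ∀ t, T.graph.Adj x t → t ≠ y → small (T.side t x) := by
      intro t ht hty
      by_contra hcon
      refine Nat.find_min hex (m := (edgeComp T.graph t x).ncard) ?_ ⟨t, x, ht.symm, hcon, rfl⟩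
      rw [← hn]
      refine Set.ncard_lt_ncard ?_ (T.nodes.finite_toSet.subset (T.edgeComp_subset_nodes hxy))
      refine (edgeComp_neighbor_subset T.acyclic hxy ht hty).ssubset_of_ne fun he => ?_
      exact T.acyclic.notMem_edgeComp ht.symm (he ▸ self_mem_edgeComp)
    have hxn := T.mem_of_adj _ _ hxy
    have hcs : small (T.side y x) := by
      rw [T.side_compl hxy]
      exact (hf.small_or (hle x y hxy)).resolve_left hns
    rcases T.cubic x hxn with h1 | h3
    · exfalso
      obtain ⟨p, hp⟩ := T.exists_leaf_eq hxn h1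
      have hside : T.side x y = {p} := by
        ext p'
        rw [T.mem_side, Set.mem_singleton_iff]
        constructor
        · intro hp'
          by_contra hne
          have hne' : T.leaf p' ≠ x := fun h =>
            hne (T.leaf_bijOn.injOn (Set.mem_univ _) (Set.mem_univ _) (h.trans hp.symm))
          obtain ⟨t, ht, hty, _⟩ := exists_neighbor_of_mem_edgeComp T.acyclic hxy hp' hne'
          obtain ⟨z, hz⟩ := Set.ncard_eq_one.1 h1
          have e1 : t ∈ ({z} : Set ℕ) := hz ▸ ht
          have e2 : y ∈ ({z} : Set ℕ) := hz ▸ hxy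
          exact hty (e1.trans e2.symm)
        · rintro rfl
          exact hp ▸ self_mem_edgeComp
      apply hns
      have hh := hle x y hxy
      rw [hside] at hh ⊢
      by_cases hpW : p ∈ W
      · have e1 : ({p} : Set V) ∩ W = {p} := by simpa using hpW
        have e2 : ({p} : Set V) ∩ Wᶜ = ∅ := by simpa using hpW
        simp only [small, e1, e2, hf.empty]
        omega
      · have e1 : ({p} : Set V) ∩ W = ∅ := by simpa using hpW
        have e2 : ({p} : Set V) ∩ Wᶜ = {p} := by simpa using hpW
        simp only [small, e1, e2, hf.empty]
        omega
    · obtain ⟨t, ht, hty⟩ : ∃ t, T.graph.Adj x t ∧ t ≠ y := by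
        obtain ⟨t, ht, hty⟩ := Set.exists_ne_of_one_lt_ncard (by omega :
          1 < (T.graph.neighborSet x).ncard) y
        exact ⟨t, ht, hty⟩
      obtain ⟨t', ht', ht'y, ht't⟩ := T.exists_third hxy ht hty.symm
      have hnb : ∀ z, T.graph.Adj x z → z = y ∨ z = t ∨ z = t' := by
        have hsub : ({y, t, t'} : Set ℕ) ⊆ T.graph.neighborSet x := by
          rintro z (rfl | rfl | rfl)
          exacts [hxy, ht, ht']
        have hcard : ({y, t, t'} : Set ℕ).ncard = 3 :=
          Set.ncard_eq_three.2 ⟨y, t, t', hty.symm, ht'y.symm, ht't.symm, rfl⟩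
        have heq := Set.eq_of_subset_of_ncard_le hsub (by omega) (T.neighborSet_finite x)
        intro z hz
        have : z ∈ ({y, t, t'} : Set ℕ) := heq ▸ hz
        simpa using this
      have hcov : ∀ p, p ∈ T.side y x ∨ p ∈ T.side t x ∨ p ∈ T.side t' x := by
        intro p
        have hne : T.leaf p ≠ x := by
          intro h
          have := (T.leaf_bijOn.mapsTo (Set.mem_univ p)).2
          rw [h] at this
          omega
        obtain ⟨z, hz, hpz⟩ := exists_neighbor_of_reachable
          (T.reachable _ hxn _ (T.leaf_mem p)) hne
        rcases hnb z hz with rfl | rfl | rfl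
        exacts [Or.inl hpz, Or.inr (Or.inl hpz), Or.inr (Or.inr hpz)]
      have hdis : ∀ s s' p, T.graph.Adj x s → T.graph.Adj x s' → s ≠ s' → p ∈ T.side s x →
          p ∉ T.side s' x := by
        intro s s' p hs hs' hne hp hp'
        exact T.acyclic.notMem_edgeComp_swap hs.symm hp
          (edgeComp_neighbor_subset T.acyclic hs hs' hne.symm hp')
      let c : V → Fin 3 := fun p => if p ∈ T.side y x then 0 else if p ∈ T.side t x then 1 else 2
      have c0 : part c 0 = T.side y x := by
        ext p
        simp only [part, c, Set.mem_ofPred_eq]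
        split_ifs <;> simp_all
      have c1 : part c 1 = T.side t x := by
        ext p
        have := hdis y t p hxy ht hty.symm
        simp only [part, c, Set.mem_ofPred_eq]
        split_ifs <;> simp_all
      have c2 : part c 2 = T.side t' x := by
        ext p
        have h1 := hdis y t' p hxy ht' ht'y.symm
        have h2 := hdis t t' p ht ht' ht't.symm
        have h3 := hcov p
        simp only [part, c, Set.mem_ofPred_eq]
        split_ifs <;> simp_all
      refine ⟨c, fun i => ?_⟩
      match i with
      | 0 => rw [c0]; exact ⟨hle y x hxy.symm, hcs⟩
      | 1 => rw [c1]; exact ⟨hle t x ht.symm, hmin t ht hty⟩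
      | 2 => rw [c2]; exact ⟨hle t' x ht'.symm, hmin t' ht' ht'y⟩
  · push Not at hbig
    obtain ⟨x, hx⟩ := T.nonempty
    obtain ⟨y, hxy⟩ : ∃ y, T.graph.Adj x y := by
      have : (T.graph.neighborSet x).ncard ≠ 0 := by rcases T.cubic x hx with h | h <;> omega
      exact Set.nonempty_of_ncard_ne_zero this
    let c : V → Fin 3 := fun p => if p ∈ T.side x y then 0 else 1
    have c0 : part c 0 = T.side x y := by
      ext p
      simp only [part, c, Set.mem_ofPred_eq]
      split_ifs <;> simp_all
    have c1 : part c 1 = T.side y x := by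
      ext p
      rw [T.side_compl hxy]
      simp only [part, c, Set.mem_ofPred_eq, Set.mem_compl_iff]
      split_ifs <;> simp_all
    have c2 : part c 2 = ∅ := by
      ext p
      simp only [part, c, Set.mem_ofPred_eq, Set.mem_empty_iff_false]
      split_ifs <;> simp
    refine ⟨c, fun i => ?_⟩
    match i with
    | 0 => rw [c0]; exact ⟨hle x y hxy, hbig x y hxy⟩
    | 1 => rw [c1]; exact ⟨hle y x hxy.symm, hbig y x hxy.symm⟩
    | 2 =>
      rw [c2, Set.empty_inter, Set.empty_inter, hf.empty]
      exact ⟨by omega, by omega, by omega⟩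

end Width

/-! ### A global improvement does not raise the values of rooted subtrees -/

section Push

variable {V : Type u} {f : Set V → ℕ} {W A Y : Set V} {c : V → Fin 3} {i : Fin 3}

open Classical in
/-- The tripartition obtained from `c` by moving the elements of `Y` to the part `i`. -/
noncomputable def pushTo (c : V → Fin 3) (Y : Set V) (i : Fin 3) : V → Fin 3 :=
  fun p => if p ∈ Y then i else c p

theorem part_pushTo_self : part (pushTo c Y i) i = part c i ∪ Y := by
  ext p
  simp only [part, pushTo, Set.mem_ofPred_eq, Set.mem_union]
  split_ifs <;> simp_all

theorem part_pushTo_of_ne {j : Fin 3} (h : j ≠ i) : part (pushTo c Y i) j = part c j \ Y := by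
  ext p
  simp only [part, pushTo, Set.mem_ofPred_eq, Set.mem_sdiff]
  split_ifs <;> simp_all [Ne.symm h]

/-- A set `Y` of minimum value between `A ∩ C_i` and `A`. -/
structure IsPush (f : Set V → ℕ) (c : V → Fin 3) (A : Set V) (i : Fin 3) (Y : Set V) : Prop where
  subset_left : A ∩ part c i ⊆ Y
  subset_right : Y ⊆ A
  le : ∀ Z, A ∩ part c i ⊆ Z → Z ⊆ A → f Y ≤ f Z

theorem exists_isPush (f : Set V → ℕ) (c : V → Fin 3) (A : Set V) (i : Fin 3) :
    ∃ Y, IsPush f c A i Y := by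
  classical
  have hex : ∃ n Y, A ∩ part c i ⊆ Y ∧ Y ⊆ A ∧ f Y = n :=
    ⟨_, A, Set.inter_subset_left, subset_rfl, rfl⟩
  obtain ⟨Y, h1, h2, h3⟩ := Nat.find_spec hex
  exact ⟨Y, h1, h2, fun Z hZ hZ' => h3 ▸ Nat.find_min' hex ⟨Z, hZ, hZ', rfl⟩⟩

namespace IsPush

theorem union_le (hY : IsPush f c A i Y) (hf : IsConnectivityFunction f) {X : Set V}
    (hX : A ∩ part c i ⊆ X) (hX' : X ⊆ part c i) : f (X ∪ Y) + f (A ∩ part c i) ≤ f X + f Y := by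
  have h := hf.submodular X Y
  have : X ∩ Y = A ∩ part c i :=
    Set.Subset.antisymm (fun p hp => ⟨hY.subset_right hp.2, hX' hp.1⟩)
      fun p hp => ⟨hX hp, hY.subset_left hp⟩
  rwa [this] at h

theorem diff_le (hY : IsPush f c A i Y) (hf : IsConnectivityFunction f) {X : Set V}
    (hX : Disjoint X (part c i)) :
    f (X \ Y) ≤ f X := by
  have h := hf.diff_le X Y
  have := hY.le (Y \ X) (fun p hp => ⟨hY.subset_left hp, fun h => Set.disjoint_left.1 hX h hp.2⟩)
    (Set.sdiff_subset.trans hY.subset_right)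
  omega

theorem part_disjoint {j : Fin 3} (h : j ≠ i) : Disjoint (part c j) (part c i) := by
  rw [Set.disjoint_left]
  intro p hp hp'
  exact h (hp.symm.trans hp')

/-- No part of a tripartition gets a larger value when a set of minimum value is moved. -/
theorem part_le (hY : IsPush f c A i Y) (hf : IsConnectivityFunction f) (j : Fin 3) :
    f (part (pushTo c Y i) j) ≤ f (part c j) := by
  by_cases hj : j = i
  · subst hj
    rw [part_pushTo_self]
    have := hY.union_le hf (X := part c j) Set.inter_subset_right subset_rfl
    have := hY.le _ subset_rfl Set.inter_subset_left
    omega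
  · rw [part_pushTo_of_ne hj]
    exact hY.diff_le hf (part_disjoint hj)

theorem isImprovement (hY : IsPush f c A i Y) (hf : IsConnectivityFunction f) (hA : A ⊆ W)
    (hc : IsImprovement f W c) : IsImprovement f W (pushTo c Y i) := by
  intro j
  have h1 := hY.part_le hf j
  have hYW : Y ⊆ W := hY.subset_right.trans hA
  obtain ⟨c1, c2, c3⟩ := hc j
  refine ⟨by omega, lt_of_le_of_lt ?_ c2, ?_⟩
  · by_cases hj : j = i
    · subst hj
      rw [part_pushTo_self, Set.union_inter_distrib_right, Set.inter_eq_left.2 hYW]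
      have := hY.union_le hf (X := part c j ∩ W)
        (fun p hp => ⟨hp.2, hA hp.1⟩) Set.inter_subset_left
      have := hY.le _ subset_rfl Set.inter_subset_left
      omega
    · rw [part_pushTo_of_ne hj]
      have : part c j \ Y ∩ W = (part c j ∩ W) \ Y := by
        ext p
        simp only [Set.mem_inter_iff, Set.mem_sdiff]
        tauto
      rw [this]
      exact hY.diff_le hf ((part_disjoint hj).mono_left Set.inter_subset_left)
  · have : part (pushTo c Y i) j ∩ Wᶜ = part c j ∩ Wᶜ := by
      ext p
      by_cases hp : p ∈ W
      · simp [hp]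
      · have hpY : p ∉ Y := fun h => hp (hYW h)
        simp [part, pushTo, hpY]
    rw [this]
    exact c3

theorem impWidth_le (hY : IsPush f c A i Y) (hf : IsConnectivityFunction f) :
    impWidth f (pushTo c Y i) ≤ impWidth f c :=
  Finset.sup_mono_fun fun j _ => hY.part_le hf j

theorem impArity_le (hi : (part c i).Nonempty) : impArity (pushTo c Y i) ≤ impArity c := by
  refine Set.ncard_le_ncard ?_
  intro j hj
  by_cases h : j = i
  · exact h ▸ hi
  · have hj' : (part (pushTo c Y i) j).Nonempty := hj
    rw [part_pushTo_of_ne h] at hj'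
    exact hj'.mono Set.sdiff_subset

theorem impSumWidth_add_le (hY : IsPush f c A i Y) (hf : IsConnectivityFunction f) :
    impSumWidth f (pushTo c Y i) + f (A ∩ part c i) ≤ impSumWidth f c + f Y := by
  classical
  unfold impSumWidth
  have h1 := hY.union_le hf (X := part c i) Set.inter_subset_right subset_rfl
  rw [← part_pushTo_self] at h1
  rw [← Finset.add_sum_erase _ _ (Finset.mem_univ i), ← Finset.add_sum_erase (a := i)
    (f := fun j => f (part c j)) _ (Finset.mem_univ i)]
  have h2 : ∑ j ∈ Finset.univ.erase i, f (part (pushTo c Y i) j) ≤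
      ∑ j ∈ Finset.univ.erase i, f (part c j) := Finset.sum_le_sum fun j _ => hY.part_le hf j
  omega

end IsPush

theorem IsMinimumImprovement.compl (hf : IsConnectivityFunction f)
    (h : IsMinimumImprovement f W c) : IsMinimumImprovement f Wᶜ c := by
  refine ⟨h.improvement.compl hf, fun d hd => h.width_min d ?_, fun d hd => h.arity_min d ?_,
    fun d hd => h.sumWidth_min d ?_⟩ <;> exact (isImprovement_compl_iff hf).1 hd

namespace IsMinimumImprovement

/-- The value of a set on one side of `W` is at least that of its parts: otherwise pushing the set
into a part would give an improvement of smaller sum-width. -/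
theorem le_of_isPush (hf : IsConnectivityFunction f) (hc : IsMinimumImprovement f W c)
    (hA : A ⊆ W) (hY : IsPush f c A i Y) (hi : (part c i).Nonempty) :
    f (A ∩ part c i) ≤ f Y := by
  have h1 := hY.impSumWidth_add_le hf
  have himp := hY.isImprovement hf hA hc.improvement
  have hw := le_antisymm (hY.impWidth_le hf) (hc.width_min _ himp)
  have ha := le_antisymm (IsPush.impArity_le hi) (hc.arity_min _ himp hw)
  have := hc.sumWidth_min _ himp hw ha
  omega

theorem isPush_self (hf : IsConnectivityFunction f) (hc : IsMinimumImprovement f W c)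
    (hA : A ⊆ W) (hi : (part c i).Nonempty) (he : f A ≤ f (A ∩ part c i)) :
    IsPush f c A i A := by
  refine ⟨Set.inter_subset_left, subset_rfl, fun Z hZ hZ' => ?_⟩
  obtain ⟨Y, hY⟩ := exists_isPush f c A i
  exact he.trans ((hc.le_of_isPush hf hA hY hi).trans (hY.le Z hZ hZ'))

theorem pushTo_self (hf : IsConnectivityFunction f) (hc : IsMinimumImprovement f W c)
    (hA : A ⊆ W) (hi : (part c i).Nonempty) (he : f A ≤ f (A ∩ part c i)) :
    IsMinimumImprovement f W (pushTo c A i) := by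
  have hY := hc.isPush_self hf hA hi he
  have himp := hY.isImprovement hf hA hc.improvement
  have hw := le_antisymm (hY.impWidth_le hf) (hc.width_min _ himp)
  have ha := le_antisymm (IsPush.impArity_le hi) (hc.arity_min _ himp hw)
  have hs : impSumWidth f (pushTo c A i) ≤ impSumWidth f c := by
    have := hY.impSumWidth_add_le hf
    omega
  refine ⟨himp, fun d hd => hw ▸ hc.width_min d hd, fun d hd h => ha ▸ hc.arity_min d hd
    (h.trans hw), fun d hd h h' => hs.trans (hc.sumWidth_min d hd (h.trans hw) (h'.trans ha))⟩

end IsMinimumImprovement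

end Push

section Global

variable {V : Type u} {f : Set V → ℕ} {T : BranchDecomposition V} {a b w q : ℕ} {c : V → Fin 3}

open BranchDecomposition

theorem editSet_subset : editSet T a b c ⊆ T.nodes := fun _ h => h.1

theorem editSet_finite : (editSet T a b c).Finite := T.nodes.finite_toSet.subset editSet_subset

/-- The rooted subtree of a node outside of the edit set lies in one part. -/
theorem exists_below_subset_part (hab : T.graph.Adj a b) (hw : w ∈ T.nodes)
    (h : w ∉ editSet T a b c) : ∃ i, T.below a b w ⊆ part c i := by
  obtain ⟨p, hp⟩ := T.below_nonempty hab hw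
  refine ⟨c p, fun p' hp' => ?_⟩
  by_contra hne
  exact h ⟨hw, p', hp', p, hp, hne⟩

theorem notMem_editSet_of_below_subset {i : Fin 3} (h : T.below a b w ⊆ part c i) :
    w ∉ editSet T a b c := by
  rintro ⟨_, x, hx, y, hy, hne⟩
  exact hne ((h hx).trans (h hy).symm)

/-- Otherwise the rooted subtree of `w` could be pushed into a part, which would give a minimum
improvement with a smaller edit set. -/
theorem IsGlobalImprovement.below_inter_part_lt (hf : IsConnectivityFunction f)
    (hab : T.graph.Adj a b) (hc : IsGlobalImprovement f T a b c)
    (hw : w ∈ editSet T a b c) (i : Fin 3) :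
    f (T.below a b w ∩ part c i) < f (T.below a b w) := by
  have hwn := hw.1
  obtain ⟨_, p, hp, p', hp', hne⟩ := id hw
  -- It suffices to treat a part that meets the subtree, as the empty set has value 0.
  suffices H : ∀ j, (T.below a b w ∩ part c j).Nonempty →
      f (T.below a b w ∩ part c j) < f (T.below a b w) by
    by_cases hi : (T.below a b w ∩ part c i).Nonempty
    · exact H i hi
    · rw [Set.not_nonempty_iff_eq_empty.1 hi, hf.empty]
      exact (Nat.zero_le _).trans_lt (H (c p) ⟨p, hp, rfl⟩)
  intro j hj
  by_contra hcon
  have hle : f (T.below a b w) ≤ f (T.below a b w ∩ part c j) := not_lt.1 hcon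
  have hjp : (part c j).Nonempty := hj.mono Set.inter_subset_right
  have hmin : IsMinimumImprovement f (T.side a b) (pushTo c (T.below a b w) j) := by
    rcases below_subset_root hab hwn with h | h
    · exact hc.minimum.pushTo_self hf h hjp hle
    · have := ((hc.minimum.compl hf).pushTo_self hf h hjp hle).compl hf
      rwa [compl_compl] at this
  have hss : editSet T a b (pushTo c (T.below a b w) j) ⊂ editSet T a b c := by
    have hw' : w ∉ editSet T a b (pushTo c (T.below a b w) j) :=
      notMem_editSet_of_below_subset (i := j) (by
        rw [part_pushTo_self]; exact Set.subset_union_right)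
    refine LE.le.ssubset_of_mem_notMem ?_ hw hw'
    intro z hz
    by_contra hzc
    obtain ⟨i', hi'⟩ := exists_below_subset_part hab hz.1 hzc
    refine absurd hz ?_
    rcases below_laminar hab hwn hz.1 with h | h | h
    · exact absurd hw (notMem_editSet_of_below_subset (h.trans hi'))
    · refine notMem_editSet_of_below_subset (i := j) ?_
      rw [part_pushTo_self]
      exact h.trans Set.subset_union_right
    · refine notMem_editSet_of_below_subset (i := i') fun y hy => ?_
      have hyw : y ∉ T.below a b w := fun h' => Set.disjoint_left.1 h h' hy
      have : c y = i' := hi' hy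
      simp [part, pushTo, hyw, this]
  have h1 := hc.edit_min _ hmin
  have h2 := Set.ncard_lt_ncard hss editSet_finite
  omega

/-- Both sides of the root meet at least two parts of an improvement. -/
theorem IsImprovement.root_mem_editSet (hf : IsConnectivityFunction f) (hab : T.graph.Adj a b)
    (hc : IsImprovement f (T.side a b) c) : a ∈ editSet T a b c ∧ b ∈ editSet T a b c := by
  constructor
  · by_contra h
    obtain ⟨i, hi⟩ := exists_below_subset_part hab (T.mem_of_adj _ _ hab) h
    rw [below_root_left hab] at hi
    have := (hc i).2.1
    rw [Set.inter_eq_right.2 hi] at this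
    exact this.false
  · by_contra h
    obtain ⟨i, hi⟩ := exists_below_subset_part hab (T.mem_nodes_right hab) h
    rw [below_root_right hab, T.side_compl hab] at hi
    have := (hc i).2.2
    rw [Set.inter_eq_right.2 hi, hf.symm] at this
    exact this.false

theorem IsImprovement.parent_mem_editSet (hf : IsConnectivityFunction f) (hab : T.graph.Adj a b)
    (hc : IsImprovement f (T.side a b) c) (hw : w ∈ editSet T a b c)
    (hq : T.IsParent a b w q) : q ∈ editSet T a b c := by
  by_cases hne : s(w, q) = s(a, b)
  · rcases Sym2.eq_iff.1 hne with ⟨_, rfl⟩ | ⟨_, rfl⟩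
    · exact (hc.root_mem_editSet hf hab).2
    · exact (hc.root_mem_editSet hf hab).1
  · obtain ⟨_, x, hx, y, hy, h⟩ := hw
    have := hq.below_subset_parent hab hne
    exact ⟨T.mem_nodes_right hq.1, x, this hx, y, this hy, h⟩

/-- No node of the rooted subtree of a node outside of the edit set is in the edit set. -/
theorem notMem_editSet_of_mem_edgeComp {z : ℕ} (hab : T.graph.Adj a b)
    (hq : T.IsParent a b w q) (hw : w ∉ editSet T a b c) (hz : z ∈ edgeComp T.graph w q) :
    z ∉ editSet T a b c := by
  obtain ⟨i, hi⟩ := exists_below_subset_part hab (T.mem_of_adj _ _ hq.1) hw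
  exact notMem_editSet_of_below_subset ((hq.below_subset hab hz).trans hi)

end Global

/-! ### The sides of a refinement -/

/-- A tree with set of nodes `S` and with labels `lab`, all of whose edges split the labels in a way
that belongs to `F`. -/
structure IsLabelledTree {V : Type u} {α : Type*} (lab : V → α) (F : Set (Set V)) (S : Set α)
    (G : SimpleGraph α) : Prop where
  acyclic : G.IsAcyclic
  mem : ∀ x y, G.Adj x y → x ∈ S
  reachable : ∀ x ∈ S, ∀ y ∈ S, G.Reachable x y
  lab_mem : ∀ p, lab p ∈ S
  side_mem : ∀ x y, G.Adj x y → {p | lab p ∈ edgeComp G x y} ∈ F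

section LabelledTree

variable {V : Type u} {α β : Type*} {lab : V → α} {lab' : V → β} {F : Set (Set V)} {S S' : Set α}
  {G G' : SimpleGraph α}

/-- Two edges of labelled trees split the labels in the same way if the sides of the one are
contained in those of the other. -/
theorem side_eq_of_subset {H : SimpleGraph β} (hG : G.IsAcyclic) {x y : α} {x' y' : β}
    (h : G.Adj x y) (hr : ∀ p, H.Reachable x' (lab' p))
    (h1 : ∀ p, lab' p ∈ edgeComp H x' y' → lab p ∈ edgeComp G x y)
    (h2 : ∀ p, lab' p ∈ edgeComp H y' x' → lab p ∈ edgeComp G y x) :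
    {p | lab' p ∈ edgeComp H x' y'} = {p | lab p ∈ edgeComp G x y} := by
  ext p
  refine ⟨h1 p, fun hp => (mem_edgeComp_or (hr p)).resolve_right fun hp' => ?_⟩
  exact hG.notMem_edgeComp_swap h hp (h2 p hp')

theorem isAcyclic_of_edgeComp (h : ∀ x y, G.Adj x y → y ∉ edgeComp G x y) : G.IsAcyclic :=
  SimpleGraph.isAcyclic_iff_forall_adj_isBridge.2 fun x y hxy => h x y hxy

/-- If `G'` arises from `G` by contraction of the edge `zp` into `p`, then every edge of `G'` comes
from an edge of `G` with at least the same components. -/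
theorem exists_edgeComp_subset_of_contract {z p : α} (hzp : G.Adj z p)
    (h : ∀ x y, G'.Adj x y → x ≠ z ∧ y ≠ z ∧
      (G.Adj x y ∨ (x = p ∧ G.Adj z y) ∨ (y = p ∧ G.Adj z x))) {x y : α} (hxy : G'.Adj x y) :
    ∃ x' y', G.Adj x' y' ∧ edgeComp G' x y ⊆ edgeComp G x' y' ∧
      edgeComp G' y x ⊆ edgeComp G y' x' := by
  have hsame : ∀ x y, x ≠ z → y ≠ z → edgeComp G' x y ⊆ edgeComp G x y := by
    intro x y hx hy
    have hz : ∀ t, s(z, t) ≠ s(x, y) ∧ s(t, z) ≠ s(x, y) := by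
      intro t
      constructor <;>
      · intro he
        rcases Sym2.eq_iff.1 he with ⟨h1, h2⟩ | ⟨h1, h2⟩ <;> subst_vars <;> contradiction
    refine edgeComp_subset self_mem_edgeComp fun u u' hu _ huu hne => ?_
    rcases (h _ _ huu).2.2 with h1 | ⟨rfl, h1⟩ | ⟨rfl, h1⟩
    · exact edgeComp_step hu h1 hne
    · exact edgeComp_step (edgeComp_step hu hzp.symm (hz _).2) h1 (hz _).1
    · exact edgeComp_step (edgeComp_step hu h1.symm (hz _).2) hzp (hz _).1
  have hmerge : ∀ y, G'.Adj p y → G.Adj z y → edgeComp G' p y ⊆ edgeComp G z y ∧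
      edgeComp G' y p ⊆ edgeComp G y z := by
    intro y hpy hzy
    have hyz : y ≠ z := hzy.ne'
    have hpz : p ≠ z := hzp.ne'
    have hpy' : p ≠ y := hpy.ne
    have hz : ∀ t, t ≠ y → s(z, t) ≠ s(z, y) := by
      intro t ht he
      rcases Sym2.eq_iff.1 he with ⟨_, h2⟩ | ⟨h1, h2⟩
      · exact ht h2
      · exact hyz h1.symm
    have hstep : ∀ u u', G'.Adj u u' → s(u, u') ≠ s(p, y) → ∀ X : Set α,
        (∀ s s', s ∈ X → G.Adj s s' → s(s, s') ≠ s(z, y) → s' ∈ X) → u ∈ X → u' ∈ X := by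
      intro u u' huu hne X hX hu
      obtain ⟨hu1, hu2, h1 | ⟨rfl, h1⟩ | ⟨rfl, h1⟩⟩ := h _ _ huu
      · refine hX u u' hu h1 fun he => ?_
        rcases Sym2.eq_iff.1 he with ⟨h1, _⟩ | ⟨_, h1⟩
        · exact hu1 h1
        · exact hu2 h1
      · have : u' ≠ y := by
          rintro rfl
          exact hne rfl
        exact hX z u' (hX u z hu hzp.symm (by rw [Sym2.eq_swap]; exact hz _ hpy')) h1 (hz _ this)
      · have : u ≠ y := by
          rintro rfl
          exact hne Sym2.eq_swap
        exact hX z u' (hX u z hu h1.symm (by rw [Sym2.eq_swap]; exact hz _ this)) hzp (hz _ hpy')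
    constructor
    · refine edgeComp_subset (edgeComp_step self_mem_edgeComp hzp (hz _ hpy')) ?_
      intro u u' hu _ huu hne
      exact hstep u u' huu hne _ (fun s s' hs h1 h2 => edgeComp_step hs h1 h2) hu
    · refine edgeComp_subset self_mem_edgeComp ?_
      intro u u' hu _ huu hne
      rw [Sym2.eq_swap (a := y)] at hne
      exact hstep u u' huu hne _ (fun s s' hs h1 h2 => edgeComp_step hs h1
        (by rwa [Sym2.eq_swap (a := y)])) hu
  obtain ⟨hx, hy, h1 | ⟨rfl, h1⟩ | ⟨rfl, h1⟩⟩ := h x y hxy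
  · exact ⟨x, y, h1, hsame x y hx hy, hsame y x hy hx⟩
  · exact ⟨z, y, h1, hmerge y hxy h1⟩
  · exact ⟨x, z, h1.symm, (hmerge x hxy.symm h1).2, (hmerge x hxy.symm h1).1⟩

/-- Contraction of an edge preserves labelled trees. -/
theorem IsLabelledTree.contract (hT : IsLabelledTree lab F S G) {z p : α} (hzp : G.Adj z p)
    (h : ∀ x y, G'.Adj x y → x ≠ z ∧ y ≠ z ∧
      (G.Adj x y ∨ (x = p ∧ G.Adj z y) ∨ (y = p ∧ G.Adj z x)))
    (h1 : ∀ x y, G.Adj x y → x ≠ z → y ≠ z → G'.Adj x y)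
    (h2 : ∀ y, G.Adj z y → y ≠ p → G'.Adj p y) (hlab : ∀ q, lab q ≠ z) :
    IsLabelledTree lab F (S \ {z}) G' := by
  classical
  have hpz : p ≠ z := hzp.ne'
  have hac : G'.IsAcyclic := by
    refine isAcyclic_of_edgeComp fun x y hxy hy => ?_
    obtain ⟨x', y', h', hs1, hs2⟩ := exists_edgeComp_subset_of_contract hzp h hxy
    exact hT.acyclic.notMem_edgeComp_swap h' (hs1 hy) (hs2 self_mem_edgeComp)
  have hreach : ∀ x y, G.Reachable x y →
      G'.Reachable (if x = z then p else x) (if y = z then p else y) := by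
    intro x y hxy
    have hxy' := (SimpleGraph.reachable_iff_reflTransGen _ _).1 hxy
    clear hxy
    induction hxy' with
    | refl => exact SimpleGraph.Reachable.refl _
    | @tail b c _ hbc ih =>
      refine ih.trans ?_
      split_ifs with hb hc hc
      · exact SimpleGraph.Reachable.refl _
      · subst hb
        by_cases hcp : c = p
        · subst hcp
          exact SimpleGraph.Reachable.refl _
        · exact (h2 c hbc hcp).reachable
      · subst hc
        by_cases hcp : b = p
        · subst hcp
          exact SimpleGraph.Reachable.refl _
        · exact (h2 b hbc.symm hcp).reachable.symm
      · exact (h1 b c hbc hb hc).reachable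
  have hreach' : ∀ x ∈ S \ {z}, ∀ y ∈ S \ {z}, G'.Reachable x y := by
    rintro x ⟨hx, hxz⟩ y ⟨hy, hyz⟩
    have := hreach x y (hT.reachable x hx y hy)
    rwa [if_neg (by simpa using hxz), if_neg (by simpa using hyz)] at this
  have hmem : ∀ x y, G'.Adj x y → x ∈ S \ {z} := by
    intro x y hxy
    obtain ⟨hx, hy, h3⟩ := h x y hxy
    refine ⟨?_, hx⟩
    rcases h3 with h3 | ⟨rfl, h3⟩ | ⟨rfl, h3⟩
    · exact hT.mem _ _ h3
    · exact hT.mem _ _ hzp.symm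
    · exact hT.mem _ _ h3.symm
  refine ⟨hac, hmem, hreach', fun q => ⟨hT.lab_mem q, hlab q⟩, fun x y hxy => ?_⟩
  obtain ⟨x', y', h', hs1, hs2⟩ := exists_edgeComp_subset_of_contract hzp h hxy
  rw [side_eq_of_subset hT.acyclic h' (fun q => hreach' x (hmem x y hxy) _
    ⟨hT.lab_mem q, hlab q⟩) (fun q hq => hs1 hq) (fun q hq => hs2 hq)]
  exact hT.side_mem _ _ h'

end LabelledTree

section Simplify

variable {V : Type u} {lab : V → RefNode} {F : Set (Set V)}

theorem IsLabelledTree.simplifyStep {P Q : Set RefNode × SimpleGraph RefNode}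
    (hT : IsLabelledTree lab F P.1 P.2) (hstep : SimplifyStep (Set.range lab) P Q)
    (hlab : ∀ p, lab p ∈ Q.1) : IsLabelledTree lab F Q.1 Q.2 := by
  cases hstep with
  | prune S G z hz hzK h1 =>
    obtain ⟨p, hp⟩ := Set.ncard_eq_one.1 h1
    have hzp : G.Adj z p := by
      have : p ∈ G.neighborSet z := by rw [hp]; rfl
      exact this
    have hnb : ∀ y, G.Adj z y → y = p := fun y hy => by
      have : y ∈ G.neighborSet z := hy
      rwa [hp] at this
    refine hT.contract hzp ?_ ?_ ?_ fun q => (hlab q).2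
    · intro x y hxy
      rw [SimpleGraph.deleteIncidenceSet_adj] at hxy
      exact ⟨hxy.2.1, hxy.2.2, Or.inl hxy.1⟩
    · intro x y hxy hx hy
      exact SimpleGraph.deleteIncidenceSet_adj.2 ⟨hxy, hx, hy⟩
    · exact fun y hy hyp => absurd (hnb y hy) hyp
  | suppress S G z p q hz hpq hnb =>
    have hzp : G.Adj z p := by
      have : p ∈ G.neighborSet z := by rw [hnb]; exact Or.inl rfl
      exact this
    have hzq : G.Adj z q := by
      have : q ∈ G.neighborSet z := by rw [hnb]; exact Or.inr rfl
      exact this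
    refine hT.contract hzp ?_ ?_ ?_ fun q => (hlab q).2
    · intro x y hxy
      rw [SimpleGraph.sup_adj, SimpleGraph.deleteIncidenceSet_adj, SimpleGraph.edge_adj] at hxy
      rcases hxy with ⟨h1, h2, h3⟩ | ⟨⟨rfl, rfl⟩ | ⟨rfl, rfl⟩, _⟩
      · exact ⟨h2, h3, Or.inl h1⟩
      · exact ⟨hzp.ne', hzq.ne', Or.inr (Or.inl ⟨rfl, hzq⟩)⟩
      · exact ⟨hzq.ne', hzp.ne', Or.inr (Or.inr ⟨rfl, hzq⟩)⟩
    · intro x y hxy hx hy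
      rw [SimpleGraph.sup_adj, SimpleGraph.deleteIncidenceSet_adj]
      exact Or.inl ⟨hxy, hx, hy⟩
    · intro y hy hyp
      have : y ∈ G.neighborSet z := hy
      rw [hnb] at this
      rcases this with rfl | rfl
      · exact absurd rfl hyp
      · rw [SimpleGraph.sup_adj, SimpleGraph.edge_adj]
        exact Or.inr ⟨Or.inl ⟨rfl, rfl⟩, hpq⟩

theorem IsLabelledTree.simplify {P Q : Set RefNode × SimpleGraph RefNode}
    (hT : IsLabelledTree lab F P.1 P.2)
    (hstep : Relation.ReflTransGen (SimplifyStep (Set.range lab)) P Q)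
    (hlab : ∀ p, lab p ∈ Q.1) : IsLabelledTree lab F Q.1 Q.2 := by
  induction hstep with
  | refl => exact hT
  | tail _ h ih =>
    refine (ih fun p => ?_).simplifyStep h hlab
    have := hlab p
    cases h with
    | prune S G z hz hzK h1 => exact this.1
    | suppress S G z p q hz hpq hnb => exact this.1

end Simplify

section Refinement

variable {V : Type u} {T T' : BranchDecomposition V} {a b : ℕ} {c : V → Fin 3}

open BranchDecomposition

/-- The sets that occur as sides of the refinement, up to complements: the parts of the tripartition
and their intersections with rooted subtrees. -/
def IsRefinedSide (T : BranchDecomposition V) (a b : ℕ) (c : V → Fin 3) (A : Set V) : Prop :=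
  ∃ i, A = part c i ∨ ∃ w ∈ T.nodes, A = T.below a b w ∩ part c i

/-- An explicit cut of a graph that consists of a single edge. -/
theorem edgeComp_subset_of_cut {α : Type*} {G : SimpleGraph α} {x y : α} {X : Set α}
    (hx : x ∈ X) (hy : y ∉ X) (h : ∀ u v, G.Adj u v → u ∈ X → v ∉ X → u = x ∧ v = y) :
    edgeComp G x y ⊆ X ∧ edgeComp G y x ⊆ Xᶜ := by
  constructor
  · refine edgeComp_subset hx fun u u' hu _ huu hne => ?_
    by_contra hu'
    obtain ⟨rfl, rfl⟩ := h u u' huu hu hu'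
    exact hne rfl
  · refine edgeComp_subset hy fun u u' hu _ huu hne hu' => ?_
    obtain ⟨rfl, rfl⟩ := h u' u huu.symm hu' hu
    exact hne rfl

theorem refGraph_copy_copy {i j : Fin 3} {x y : ℕ} : (refGraph T a b).Adj (.copy i x) (.copy j y) ↔
    i = j ∧ T.graph.Adj x y ∧ s(x, y) ≠ s(a, b) := by
  rw [refGraph, SimpleGraph.fromRel_adj]
  simp only [refRel]
  constructor
  · rintro ⟨_, h | ⟨h1, h2, h3⟩⟩
    · exact h
    · exact ⟨h1.symm, h2.symm, by rwa [Sym2.eq_swap]⟩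
  · rintro ⟨rfl, h2, h3⟩
    refine ⟨fun h => ?_, Or.inl ⟨rfl, h2, h3⟩⟩
    injection h with _ h
    exact h2.ne h

theorem refGraph_copy_mid {i j : Fin 3} {x : ℕ} : (refGraph T a b).Adj (.copy i x) (.mid j) ↔
    i = j ∧ (x = a ∨ x = b) := by
  rw [refGraph, SimpleGraph.fromRel_adj]
  simp [refRel]

theorem refGraph_mid_center {i : Fin 3} : (refGraph T a b).Adj (.mid i) .center := by
  rw [refGraph, SimpleGraph.fromRel_adj]
  simp [refRel]

theorem refGraph_not_copy_center {i : Fin 3} {x : ℕ} :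
    ¬ (refGraph T a b).Adj (.copy i x) .center := by
  rw [refGraph, SimpleGraph.fromRel_adj]
  simp [refRel]

theorem refGraph_not_mid_mid {i j : Fin 3} : ¬ (refGraph T a b).Adj (.mid i) (.mid j) := by
  rw [refGraph, SimpleGraph.fromRel_adj]
  simp [refRel]

/-- The edge `xy` of the tree before simplification is the only edge that leaves some set of nodes,
and the labels in this set form a refined side or the complement of one. -/
def HasRefinedCut (T : BranchDecomposition V) (a b : ℕ) (c : V → Fin 3) (x y : RefNode) : Prop :=
  ∃ X : Set RefNode, x ∈ X ∧ y ∉ X ∧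
    (∀ u v, (refGraph T a b).Adj u v → u ∈ X → v ∉ X → u = x ∧ v = y) ∧
    (IsRefinedSide T a b c {p | refLabel T c p ∈ X} ∨
      IsRefinedSide T a b c {p | refLabel T c p ∈ X}ᶜ)

theorem HasRefinedCut.symm {x y : RefNode} (h : HasRefinedCut T a b c x y) :
    HasRefinedCut T a b c y x := by
  obtain ⟨X, h1, h2, h3, h4⟩ := h
  refine ⟨Xᶜ, h2, fun h => h h1, fun u v huv hu hv => ?_, ?_⟩
  · exact (h3 v u huv.symm (not_not.1 hv) hu).symm
  · have : {p | refLabel T c p ∈ Xᶜ} = {p | refLabel T c p ∈ X}ᶜ := rfl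
    rw [this, compl_compl]
    exact h4.symm

theorem hasRefinedCut (hab : T.graph.Adj a b) {x y : RefNode}
    (h : (refGraph T a b).Adj x y) : HasRefinedCut T a b c x y := by
  -- The copy of the rooted subtree of a node `w` in the copy `i` of the tree.
  have hcut : ∀ (i : Fin 3) (w q : ℕ), T.IsParent a b w q →
      ∀ z, (z = .copy i q ∧ s(w, q) ≠ s(a, b) ∨ z = .mid i ∧ s(w, q) = s(a, b)) →
      HasRefinedCut T a b c (.copy i w) z := by
    intro i w q hq z hz
    refine ⟨{u | ∃ t ∈ edgeComp T.graph w q, u = .copy i t}, ⟨w, self_mem_edgeComp, rfl⟩, ?_, ?_,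
      Or.inl ⟨i, Or.inr ⟨w, T.mem_of_adj _ _ hq.1, ?_⟩⟩⟩
    · rintro ⟨t, ht, rfl⟩
      rcases hz with ⟨hz, _⟩ | ⟨hz, _⟩
      · injection hz with _ hz
        exact T.acyclic.notMem_edgeComp hq.1 (hz ▸ ht)
      · exact RefNode.noConfusion hz
    · rintro u v huv ⟨t, ht, rfl⟩ hv
      cases v with
      | copy j t' =>
        obtain ⟨rfl, h1, h2⟩ := refGraph_copy_copy.1 huv
        obtain ⟨rfl, rfl⟩ := eq_of_edgeComp_leave T.acyclic hq.1 ht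
          (fun h => hv ⟨t', h, rfl⟩) h1
        refine ⟨rfl, ?_⟩
        rcases hz with ⟨rfl, _⟩ | ⟨_, hz⟩
        · rfl
        · exact absurd hz h2
      | mid j =>
        obtain ⟨rfl, h1⟩ := refGraph_copy_mid.1 huv
        -- An end of the root lies in the subtree of `w` only if it is `w`.
        obtain ⟨e, he, _, he2⟩ := hq.exists_notMem hab
        have hte : T.graph.Adj t e ∧ s(t, e) = s(a, b) := by
          rcases h1 with rfl | rfl <;> rcases he with rfl | rfl
          · exact absurd ht he2
          · exact ⟨hab, rfl⟩
          · exact ⟨hab.symm, Sym2.eq_swap⟩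
          · exact absurd ht he2
        obtain ⟨rfl, rfl⟩ := eq_of_edgeComp_leave T.acyclic hq.1 ht he2 hte.1
        refine ⟨rfl, ?_⟩
        rcases hz with ⟨_, hz⟩ | ⟨rfl, _⟩
        · exact absurd hte.2 hz
        · rfl
      | center => exact absurd huv refGraph_not_copy_center
    · rw [hq.below_eq hab]
      ext p
      simp only [Set.mem_ofPred_eq, refLabel, Set.mem_inter_iff, T.mem_side, part,
        RefNode.copy.injEq]
      constructor
      · rintro ⟨t, ht, h1, h2⟩
        exact ⟨h2 ▸ ht, h1⟩
      · rintro ⟨h1, h2⟩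
        exact ⟨_, h1, h2, rfl⟩
  have hmid : ∀ i : Fin 3, HasRefinedCut T a b c (.mid i) .center := by
    intro i
    refine ⟨{u | u = .mid i ∨ ∃ t, u = .copy i t}, Or.inl rfl, ?_, ?_, Or.inl ⟨i, Or.inl ?_⟩⟩
    · rintro (h | ⟨t, h⟩) <;> exact RefNode.noConfusion h
    · rintro u v huv (rfl | ⟨t, rfl⟩) hv
      · cases v with
        | copy j t' =>
          obtain ⟨rfl, _⟩ := refGraph_copy_mid.1 huv.symm
          exact absurd (Or.inr ⟨t', rfl⟩) hv
        | mid j => exact absurd huv refGraph_not_mid_mid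
        | center => exact ⟨rfl, rfl⟩
      · cases v with
        | copy j t' =>
          obtain ⟨rfl, _⟩ := refGraph_copy_copy.1 huv
          exact absurd (Or.inr ⟨t', rfl⟩) hv
        | mid j =>
          obtain ⟨rfl, _⟩ := refGraph_copy_mid.1 huv
          exact absurd (Or.inl rfl) hv
        | center => exact absurd huv refGraph_not_copy_center
    · ext p
      simp [refLabel, part]
  have hcm : ∀ x, x = a ∨ x = b → ∃ q, T.IsParent a b x q ∧ s(x, q) = s(a, b) := by
    rintro x (rfl | rfl)
    · exact ⟨b, isParent_root hab, rfl⟩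
    · exact ⟨a, isParent_swap.1 (isParent_root hab.symm), Sym2.eq_swap⟩
  cases x with
  | copy i x =>
    cases y with
    | copy j y =>
      obtain ⟨rfl, h1, h2⟩ := refGraph_copy_copy.1 h
      rcases isParent_total (a := a) (b := b) h1 with h' | h'
      · exact hcut i x y h' _ (Or.inl ⟨rfl, h2⟩)
      · exact (hcut i y x h' _ (Or.inl ⟨rfl, by rwa [Sym2.eq_swap]⟩)).symm
    | mid j =>
      obtain ⟨rfl, h1⟩ := refGraph_copy_mid.1 h
      obtain ⟨q, hq, he⟩ := hcm x h1
      exact hcut i x q hq _ (Or.inr ⟨rfl, he⟩)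
    | center => exact absurd h refGraph_not_copy_center
  | mid i =>
    cases y with
    | copy j y =>
      obtain ⟨rfl, h1⟩ := refGraph_copy_mid.1 h.symm
      obtain ⟨q, hq, he⟩ := hcm y h1
      exact (hcut j y q hq _ (Or.inr ⟨rfl, he⟩)).symm
    | mid j => exact absurd h refGraph_not_mid_mid
    | center => exact hmid i
  | center =>
    cases y with
    | copy j y => exact absurd h.symm refGraph_not_copy_center
    | mid j => exact (hmid j).symm
    | center => exact absurd h (SimpleGraph.irrefl _)

theorem refGraph_reachable (hab : T.graph.Adj a b) {z : RefNode} (hz : z ∈ refNodes T) :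
    (refGraph T a b).Reachable .center z := by
  have hm : ∀ i, (refGraph T a b).Reachable .center (.mid i) := fun i =>
    refGraph_mid_center.symm.reachable
  cases z with
  | copy i x =>
    have hx : x ∈ T.nodes := hz i x rfl
    have key : ∀ e e', s(e, e') = s(a, b) → x ∈ edgeComp T.graph e e' →
        (refGraph T a b).Reachable (.copy i e) (.copy i x) := by
      intro e e' he hxe
      refine edgeComp_subset (X := {x | (refGraph T a b).Reachable (.copy i e) (.copy i x)})
        (SimpleGraph.Reachable.refl _) ?_ hxe
      intro u u' hu _ huu hne
      exact SimpleGraph.Reachable.trans hu (SimpleGraph.Adj.reachable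
        (refGraph_copy_copy.2 ⟨rfl, huu, he ▸ hne⟩))
    rcases T.mem_edgeComp_or (T.mem_of_adj _ _ hab) hx with h | h
    · refine ((hm i).trans ?_).trans (key a b rfl h)
      exact (refGraph_copy_mid.2 ⟨rfl, Or.inl rfl⟩).symm.reachable
    · refine ((hm i).trans ?_).trans (key b a Sym2.eq_swap h)
      exact (refGraph_copy_mid.2 ⟨rfl, Or.inr rfl⟩).symm.reachable
  | mid i => exact hm i
  | center => exact SimpleGraph.Reachable.refl _

theorem isLabelledTree_refGraph (hab : T.graph.Adj a b) :
    IsLabelledTree (refLabel T c) {A | IsRefinedSide T a b c A ∨ IsRefinedSide T a b c Aᶜ}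
      (refNodes T) (refGraph T a b) := by
  have hac : (refGraph T a b).IsAcyclic := by
    refine isAcyclic_of_edgeComp fun x y hxy hy => ?_
    obtain ⟨X, h1, h2, h3, _⟩ := hasRefinedCut (c := c) hab hxy
    exact h2 ((edgeComp_subset_of_cut h1 h2 h3).1 hy)
  have hmem : ∀ x y, (refGraph T a b).Adj x y → x ∈ refNodes T := by
    rintro x y hxy i u rfl
    cases y with
    | copy j y => exact T.mem_of_adj _ _ (refGraph_copy_copy.1 hxy).2.1
    | mid j =>
      rcases (refGraph_copy_mid.1 hxy).2 with rfl | rfl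
      · exact T.mem_of_adj _ _ hab
      · exact T.mem_nodes_right hab
    | center => exact absurd hxy refGraph_not_copy_center
  have hlab : ∀ p, refLabel T c p ∈ refNodes T := by
    intro p i x h
    simp only [refLabel, RefNode.copy.injEq] at h
    exact h.2 ▸ T.leaf_mem p
  have hr : ∀ x ∈ refNodes T, ∀ y ∈ refNodes T, (refGraph T a b).Reachable x y :=
    fun x hx y hy => (refGraph_reachable hab hx).symm.trans (refGraph_reachable hab hy)
  refine ⟨hac, hmem, hr, hlab, fun x y hxy => ?_⟩
  obtain ⟨X, h1, h2, h3, h4⟩ := hasRefinedCut (c := c) hab hxy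
  obtain ⟨s1, s2⟩ := edgeComp_subset_of_cut h1 h2 h3
  have : {p | refLabel T c p ∈ edgeComp (refGraph T a b) x y} = {p | refLabel T c p ∈ X} := by
    ext p
    refine ⟨fun h => s1 h, fun h => ?_⟩
    exact (mem_edgeComp_or (hr x (hmem x y hxy) _ (hlab p))).resolve_right fun h' => s2 h' h
  rw [Set.mem_ofPred_eq, this]
  exact h4

/-- All sides of a refinement are refined sides, up to complements. -/
theorem IsRefinement.side (hab : T.graph.Adj a b) (h : IsRefinement T a b c T') {x y : ℕ}
    (hxy : T'.graph.Adj x y) :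
    IsRefinedSide T a b c (T'.side x y) ∨ IsRefinedSide T a b c (T'.side x y)ᶜ := by
  obtain ⟨S, G, φ, hstep, _, hφ, hadj, hleaf⟩ := h
  have hT : IsLabelledTree (refLabel T c) _ S G := (isLabelledTree_refGraph hab).simplify hstep
    fun p => hleaf p ▸ hφ.mapsTo (T'.leaf_mem p)
  have hG : G.Adj (φ x) (φ y) :=
    (hadj x (T'.mem_of_adj _ _ hxy) y (T'.mem_nodes_right hxy)).1 hxy
  have key : ∀ x y, T'.graph.Adj x y →
      ∀ z ∈ edgeComp T'.graph x y, φ z ∈ edgeComp G (φ x) (φ y) := by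
    intro x y hxy z hz
    have hxn := T'.mem_of_adj _ _ hxy
    have hyn := T'.mem_nodes_right hxy
    refine edgeComp_subset (X := {z | φ z ∈ edgeComp G (φ x) (φ y)}) self_mem_edgeComp ?_ hz
    intro u u' hu _ huu hne
    have hun := T'.mem_of_adj _ _ huu
    have hun' := T'.mem_nodes_right huu
    refine edgeComp_step hu ((hadj u hun u' hun').1 huu) fun he => hne ?_
    rcases Sym2.eq_iff.1 he with ⟨h1, h2⟩ | ⟨h1, h2⟩
    · rw [hφ.injOn hun hxn h1, hφ.injOn hun' hyn h2]
    · rw [hφ.injOn hun hyn h1, hφ.injOn hun' hxn h2, Sym2.eq_swap]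
  have heq := side_eq_of_subset (lab := refLabel T c) (lab' := T'.leaf) hT.acyclic hG
    (fun p => T'.reachable _ (T'.mem_of_adj _ _ hxy) _ (T'.leaf_mem p))
    (fun p hp => hleaf p ▸ key x y hxy _ hp) (fun p hp => hleaf p ▸ key y x hxy.symm _ hp)
  have hs := hT.side_mem _ _ hG
  rw [← heq] at hs
  exact hs

end Refinement

/-! ### Refinement in place -/

/-- `T'` arises from `T` by replacing the set of nodes `R` by the set of nodes `M`. -/
structure IsReplacement {V : Type u} (T : BranchDecomposition V) (R : Set ℕ)
    (T' : BranchDecomposition V) (M : Finset ℕ) : Prop where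
  leaf_eq : T'.leaf = T.leaf
  card_eq : M.card = R.ncard
  mem_of_mem : ∀ z ∈ M, z ∈ T.nodes → z ∈ R
  mem_nodes : ∀ z, z ∈ T'.nodes ↔ (z ∈ T.nodes ∧ z ∉ R) ∨ z ∈ M
  connected : (T'.graph.induce (M : Set ℕ)).Connected
  adj_iff : ∀ x ∈ T.nodes, x ∉ R → ∀ y ∈ T.nodes, y ∉ R → (T'.graph.Adj x y ↔ T.graph.Adj x y)

section Replacement

variable {V : Type u} {T T' : BranchDecomposition V} {R : Set ℕ} {M : Finset ℕ} {a b : ℕ}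
  {c : V → Fin 3} {r : ℕ × ℕ}

open BranchDecomposition

theorem IsInPlaceRefinement.exists_isReplacement (h : IsInPlaceRefinement T a b c T' r) :
    ∃ M : Finset ℕ, IsReplacement T (editSet T a b c) T' M ∧ r.1 ∈ M ∧ r.2 ∈ M ∧
      T'.graph.Adj r.1 r.2 := by
  obtain ⟨_, hl, M, h1, h2, h3, h4, h5, h6⟩ := h
  refine ⟨M, ⟨hl, h1, ?_, ?_, h4, ?_⟩, h6⟩
  · intro z hz hzT
    by_contra hzR
    exact Set.disjoint_left.1 h2 hz ⟨hzT, hzR⟩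
  · intro z
    rw [← Finset.mem_coe, h3]
    rfl
  · exact fun x hx hxR y hy hyR => h5 x ⟨hx, hxR⟩ y ⟨hy, hyR⟩

namespace IsReplacement

theorem ncard_eq_one_iff (T : BranchDecomposition V) {z : ℕ} (hz : z ∈ T.nodes) :
    (T.graph.neighborSet z).ncard = 1 ↔ z ∈ Set.range T.leaf := by
  constructor
  · intro h
    exact T.exists_leaf_eq hz h
  · rintro ⟨p, rfl⟩
    exact (T.leaf_bijOn.mapsTo (Set.mem_univ p)).2

theorem ncard_neighborSet_eq (h : IsReplacement T R T' M) {z : ℕ} (hz : z ∈ T.nodes)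
    (hzR : z ∉ R) : (T'.graph.neighborSet z).ncard = (T.graph.neighborSet z).ncard := by
  have hz' : z ∈ T'.nodes := (h.mem_nodes z).2 (Or.inl ⟨hz, hzR⟩)
  have h1 := ncard_eq_one_iff T hz
  have h2 := ncard_eq_one_iff T' hz'
  rw [h.leaf_eq, ← h1] at h2
  rcases T.cubic z hz with h3 | h3 <;> rcases T'.cubic z hz' with h4 | h4 <;> omega

/-- A node all of whose neighbours are kept keeps its neighbours. -/
theorem neighborSet_eq (h : IsReplacement T R T' M) {z : ℕ} (hz : z ∈ T.nodes) (hzR : z ∉ R)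
    (hnb : ∀ y, T.graph.Adj z y → y ∉ R) : T'.graph.neighborSet z = T.graph.neighborSet z := by
  symm
  refine Set.eq_of_subset_of_ncard_le ?_ (h.ncard_neighborSet_eq hz hzR).le
    (T'.neighborSet_finite z)
  intro y hy
  exact (h.adj_iff z hz hzR y (T.mem_nodes_right hy) (hnb y hy)).2 hy

end IsReplacement

/-- What becomes of the edge from a node `w` outside of the edit set to its parent: it keeps its
side, and it leads to an inserted node if it led to a removed one. -/
theorem IsReplacement.exists_parent {w q : ℕ} (h : IsReplacement T (editSet T a b c) T' M)
    (hab : T.graph.Adj a b) (hq : T.IsParent a b w q) (hw : w ∉ editSet T a b c) :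
    ∃ q', T'.graph.Adj w q' ∧ edgeComp T'.graph w q' = edgeComp T.graph w q ∧
      (∀ z, T'.graph.Adj w z → z ≠ q' → z ≠ q ∧ T.graph.Adj w z) ∧
      (q ∉ editSet T a b c → q' = q) ∧ (q ∈ editSet T a b c → q' ∈ M) := by
  have hG := T.acyclic
  set R := editSet T a b c with hR
  have hwn := T.mem_of_adj _ _ hq.1
  have hDn : ∀ z ∈ edgeComp T.graph w q, z ∈ T.nodes ∧ z ∉ R := fun z hz =>
    ⟨T.edgeComp_subset_nodes hq.1 hz, notMem_editSet_of_mem_edgeComp hab hq hw hz⟩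
  have hqD : q ∉ edgeComp T.graph w q := hG.notMem_edgeComp hq.1
  have hnbD : ∀ z, T.graph.Adj w z → z ≠ q → z ∈ edgeComp T.graph w q := by
    intro z hz hzq
    refine edgeComp_step self_mem_edgeComp hz fun he => ?_
    rcases Sym2.eq_iff.1 he with ⟨_, h2⟩ | ⟨h1, _⟩
    · exact hzq h2
    · exact hq.1.ne h1
  have hsub : T.graph.neighborSet w \ {q} ⊆ T'.graph.neighborSet w := by
    rintro z ⟨hz, hzq⟩
    obtain ⟨h1, h2⟩ := hDn z (hnbD z hz hzq)
    exact (h.adj_iff w hwn hw z h1 h2).2 hz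
  have hcard : (T.graph.neighborSet w \ {q}).ncard + 1 = (T'.graph.neighborSet w).ncard := by
    rw [h.ncard_neighborSet_eq hwn hw]
    exact Set.ncard_sdiff_singleton_add_one hq.1 (T.neighborSet_finite w)
  have hcard' : (T'.graph.neighborSet w \ (T.graph.neighborSet w \ {q})).ncard = 1 := by
    have := Set.ncard_sdiff_add_ncard_of_subset hsub (T'.neighborSet_finite w)
    omega
  obtain ⟨q', hq'⟩ := Set.ncard_eq_one.1 hcard'
  have hq'1 : q' ∈ T'.graph.neighborSet w \ (T.graph.neighborSet w \ {q}) := by rw [hq']; rfl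
  have hadj' : T'.graph.Adj w q' := hq'1.1
  have hother : ∀ z, T'.graph.Adj w z → z ≠ q' → z ≠ q ∧ T.graph.Adj w z := by
    intro z hz hne
    by_contra hcon
    have : z ∈ T'.graph.neighborSet w \ (T.graph.neighborSet w \ {q}) :=
      ⟨hz, fun h => hcon ⟨h.2, h.1⟩⟩
    rw [hq'] at this
    exact hne this
  have hq'D : q' ∉ edgeComp T.graph w q := by
    intro hD
    obtain ⟨h1, h2⟩ := hDn q' hD
    refine hq'1.2 ⟨(h.adj_iff w hwn hw q' h1 h2).1 hadj', ?_⟩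
    rintro rfl
    exact hqD hD
  refine ⟨q', hadj', ?_, hother, ?_, ?_⟩
  · apply Set.Subset.antisymm
    · refine edgeComp_subset self_mem_edgeComp fun z z' hz _ hzz hne => ?_
      obtain ⟨hzn, hzR⟩ := hDn z hz
      by_cases hzw : z = w
      · subst hzw
        have hzq' : z' ≠ q' := by
          rintro rfl
          exact hne rfl
        obtain ⟨h1, h2⟩ := hother z' hzz hzq'
        exact hnbD z' h2 h1
      · have hstep : ∀ y, T.graph.Adj z y → y ∈ edgeComp T.graph w q := by
          intro y hy
          by_contra hcon
          exact hzw (eq_of_edgeComp_leave hG hq.1 hz hcon hy).1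
        have hz' : z' ∈ T'.graph.neighborSet z := hzz
        rw [h.neighborSet_eq hzn hzR fun y hy => (hDn y (hstep y hy)).2] at hz'
        exact hstep z' hz'
    · suffices H : edgeComp T.graph w q ⊆ edgeComp T'.graph w q' ∩ edgeComp T.graph w q from
        fun z hz => (H hz).1
      refine edgeComp_subset ⟨self_mem_edgeComp, self_mem_edgeComp⟩ ?_
      rintro z z' ⟨hz1, hz2⟩ - hzz hne
      have hz'D := edgeComp_step hz2 hzz hne
      obtain ⟨h1, h2⟩ := hDn z hz2
      obtain ⟨h1', h2'⟩ := hDn z' hz'D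
      refine ⟨edgeComp_step hz1 ((h.adj_iff z h1 h2 z' h1' h2').2 hzz) fun he => ?_, hz'D⟩
      rcases Sym2.eq_iff.1 he with ⟨_, rfl⟩ | ⟨rfl, _⟩
      · exact hq'D hz'D
      · exact hq'D hz2
  · intro hqR
    by_contra hne
    have hqn := T.mem_nodes_right hq.1
    exact (hother q ((h.adj_iff w hwn hw q hqn hqR).2 hq.1) (Ne.symm hne)).1 rfl
  · intro hqR
    rcases (h.mem_nodes q').1 (T'.mem_nodes_right hadj') with ⟨h1, h2⟩ | h1
    · exfalso
      refine hq'1.2 ⟨(h.adj_iff w hwn hw q' h1 h2).1 hadj', ?_⟩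
      rintro rfl
      exact h2 hqR
    · exact h1

/-- Edges between kept nodes keep their sides. -/
theorem IsReplacement.side_eq {x y : ℕ} (h : IsReplacement T (editSet T a b c) T' M)
    (hab : T.graph.Adj a b) (hx : x ∉ editSet T a b c) (hy : y ∉ editSet T a b c)
    (hxy : T.graph.Adj x y) : T'.graph.Adj x y ∧ T'.side x y = T.side x y := by
  have hadj := (h.adj_iff x (T.mem_of_adj _ _ hxy) hx y (T.mem_nodes_right hxy) hy).2 hxy
  have key : ∀ x y, T.IsParent a b x y → x ∉ editSet T a b c → y ∉ editSet T a b c →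
      T'.side x y = T.side x y := by
    intro x y hxy hx hy
    obtain ⟨q', _, h2, _, h4, _⟩ := h.exists_parent hab hxy hx
    obtain rfl := h4 hy
    ext p
    rw [T'.mem_side, h2, h.leaf_eq, T.mem_side]
  refine ⟨hadj, ?_⟩
  rcases isParent_total (a := a) (b := b) hxy with h' | h'
  · exact key x y h' hx hy
  · rw [T'.side_compl hadj.symm, T.side_compl hxy.symm, key y x h' hy hx]

/-- An edge between a kept and an inserted node has the side of an edge to a removed node. -/
theorem IsReplacement.exists_removed {x y : ℕ} (h : IsReplacement T (editSet T a b c) T' M)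
    (hab : T.graph.Adj a b) (hxn : x ∈ T.nodes) (hx : x ∉ editSet T a b c) (hy : y ∈ M)
    (hxy : T'.graph.Adj x y) :
    ∃ q ∈ editSet T a b c, T.IsParent a b x q ∧ T'.side x y = T.side x q := by
  obtain ⟨q, hq⟩ := exists_isParent hab hxn
  obtain ⟨q', h1, h2, h3, h4, h5⟩ := h.exists_parent hab hq hx
  have hyR : y ∈ T.nodes → y ∈ editSet T a b c := h.mem_of_mem y hy
  have hyq : y = q' := by
    by_contra hne
    obtain ⟨h6, h7⟩ := h3 y hxy hne
    refine notMem_editSet_of_mem_edgeComp hab hq hx (z := y) ?_ (hyR (T.mem_nodes_right h7))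
    refine edgeComp_step self_mem_edgeComp h7 fun he => ?_
    rcases Sym2.eq_iff.1 he with ⟨_, h2⟩ | ⟨h1, _⟩
    · exact h6 h2
    · exact hq.1.ne h1
  subst hyq
  have hqR : q ∈ editSet T a b c := by
    by_contra hqR
    obtain rfl := h4 hqR
    exact hqR (hyR (T.mem_nodes_right hq.1))
  refine ⟨q, hqR, hq, ?_⟩
  ext p
  rw [T'.mem_side, h2, h.leaf_eq, T.mem_side]

/-- The kept neighbours of the edit set are adjacent to inserted nodes. -/
theorem IsReplacement.exists_inserted {x q : ℕ} (h : IsReplacement T (editSet T a b c) T' M)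
    (hab : T.graph.Adj a b) (hx : x ∉ editSet T a b c) (hq : q ∈ editSet T a b c)
    (hxq : T.IsParent a b x q) : ∃ y ∈ M, T'.graph.Adj x y := by
  obtain ⟨q', h1, h2, h3, h4, h5⟩ := h.exists_parent hab hxq hx
  exact ⟨q', h5 hq, h1⟩

variable {f : Set V → ℕ}

/-- The edges between inserted nodes have width less than that of the root, if the latter is the
width of the decomposition. -/
theorem IsReplacement.side_lt {x y : ℕ} (h : IsReplacement T (editSet T a b c) T' M)
    (href : IsRefinement T a b c T') (hf : IsConnectivityFunction f) (hab : T.graph.Adj a b)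
    (hc : IsGlobalImprovement f T a b c) (hw : T.width f ≤ f (T.side a b)) (hx : x ∈ M)
    (hy : y ∈ M) (hxy : T'.graph.Adj x y) : f (T'.side x y) < f (T.side a b) := by
  have key : ∀ x y, x ∈ M → y ∈ M → T'.graph.Adj x y → IsRefinedSide T a b c (T'.side x y) →
      f (T'.side x y) < f (T.side a b) := by
    rintro x y hx hy hxy ⟨i, hA | ⟨w, hw', hA⟩⟩
    · have := (hc.minimum.improvement i).1
      rw [hA]
      omega
    · obtain ⟨q, hq⟩ := exists_isParent hab hw'
      by_cases hwR : w ∈ editSet T a b c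
      · rw [hA]
        refine (hc.below_inter_part_lt hf hab hwR i).trans_le (le_trans ?_ hw)
        rw [hq.below_eq hab]
        exact T.le_width hq.1
      · exfalso
        obtain ⟨j, hj⟩ := exists_below_subset_part hab hw' hwR
        obtain ⟨p, hp⟩ := T'.side_nonempty hxy
        have hp' := hp
        rw [hA] at hp'
        have hij : j = i := (hj hp'.1).symm.trans hp'.2
        subst hij
        obtain ⟨q', h1, h2, _, _, _⟩ := h.exists_parent hab hq hwR
        have hside : T'.side x y = T'.side w q' := by
          rw [hA, Set.inter_eq_left.2 hj, hq.below_eq hab]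
          ext p
          rw [T'.mem_side, h2, h.leaf_eq, T.mem_side]
        obtain ⟨rfl, _⟩ := T'.side_injective hxy h1 hside
        exact hwR (h.mem_of_mem _ hx hw')
  rcases href.side hab hxy with h1 | h1
  · exact key x y hx hy hxy h1
  · rw [← T'.side_compl hxy] at h1
    have := key y x hy hx hxy.symm h1
    rwa [T'.side_compl hxy, hf.symm] at this

end Replacement

/-! ### The potential of a branch decomposition -/

section Potential

variable {V : Type u} {T T' : BranchDecomposition V} {a b : ℕ} {c : V → Fin 3} {f : Set V → ℕ}

open BranchDecomposition

open Classical in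
/-- The set of all sides of edges of a branch decomposition. -/
noncomputable def BranchDecomposition.sides (T : BranchDecomposition V) : Finset (Set V) :=
  ((T.nodes ×ˢ T.nodes).filter fun e => T.graph.Adj e.1 e.2).image fun e => T.side e.1 e.2

theorem BranchDecomposition.mem_sides {A : Set V} :
    A ∈ T.sides ↔ ∃ x y, T.graph.Adj x y ∧ T.side x y = A := by
  classical
  simp only [sides, Finset.mem_image, Finset.mem_filter, Finset.mem_product, Prod.exists]
  constructor
  · rintro ⟨x, y, ⟨_, h⟩, h'⟩
    exact ⟨x, y, h, h'⟩
  · rintro ⟨x, y, h, h'⟩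
    exact ⟨x, y, ⟨⟨T.mem_of_adj _ _ h, T.mem_nodes_right h⟩, h⟩, h'⟩

/-- The potential that pays for the refinements: the sum of `16 ^ f(A)` over all sides `A`. The
base is large enough for the at most six sides (with their complements) that replace a side of the
edit set, and for the six sides that separate the parts of the tripartition, to have together a
smaller potential. -/
noncomputable def BranchDecomposition.potential (T : BranchDecomposition V) (f : Set V → ℕ) : ℕ :=
  ∑ A ∈ T.sides, 16 ^ f A

theorem BranchDecomposition.mem_sides_compl {A : Set V} (h : A ∈ T.sides) : Aᶜ ∈ T.sides := by
  obtain ⟨x, y, hxy, rfl⟩ := mem_sides.1 h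
  exact mem_sides.2 ⟨y, x, hxy.symm, T.side_compl hxy⟩

theorem below_mem_sides (hab : T.graph.Adj a b) {w : ℕ} (hw : w ∈ T.nodes) :
    T.below a b w ∈ T.sides := by
  obtain ⟨q, hq⟩ := exists_isParent hab hw
  exact mem_sides.2 ⟨w, q, hq.1, (hq.below_eq hab).symm⟩

/-- The rooted subtrees of the edit set are no sides of the refinement. -/
theorem IsRefinement.below_notMem_sides (href : IsRefinement T a b c T')
    (hf : IsConnectivityFunction f) (hab : T.graph.Adj a b)
    (hc : IsImprovement f (T.side a b) c) {w : ℕ} (hw : w ∈ editSet T a b c) :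
    T.below a b w ∉ T'.sides := by
  intro hmem
  obtain ⟨_, p, hp, p', hp', hne⟩ := id hw
  have hsub : ∀ A, IsRefinedSide T a b c A → ∃ i, A ⊆ part c i := by
    rintro A ⟨i, rfl | ⟨w, _, rfl⟩⟩
    · exact ⟨i, subset_rfl⟩
    · exact ⟨i, Set.inter_subset_right⟩
  obtain ⟨x, y, hxy, he⟩ := mem_sides.1 hmem
  rcases href.side hab hxy with h | h
  · obtain ⟨i, hi⟩ := hsub _ h
    rw [he] at hi
    exact hne ((hi hp).trans (hi hp').symm)
  · -- The complement contains one side of the root, which meets two parts.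
    obtain ⟨i, hi⟩ := hsub _ h
    rw [he] at hi
    obtain ⟨ha, hb⟩ := hc.root_mem_editSet hf hab
    rcases below_subset_root hab hw.1 with h' | h'
    · refine absurd hb (notMem_editSet_of_below_subset (i := i) ?_)
      rw [below_root_right hab, T.side_compl hab]
      exact (Set.compl_subset_compl.2 h').trans hi
    · refine absurd ha (notMem_editSet_of_below_subset (i := i) ?_)
      rw [below_root_left hab]
      exact (Set.subset_compl_comm.1 h').trans hi

theorem sum_union_le_add {ι : Type*} [DecidableEq ι] (s t : Finset ι) (F : ι → ℕ) :
    ∑ x ∈ s ∪ t, F x ≤ ∑ x ∈ s, F x + ∑ x ∈ t, F x := by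
  rw [← Finset.sum_union_inter]
  exact Nat.le_add_right _ _

theorem sum_image_le_sum {ι κ : Type*} [DecidableEq ι] [DecidableEq κ] (s : Finset ι) (g : ι → κ)
    (F : κ → ℕ) : ∑ y ∈ s.image g, F y ≤ ∑ x ∈ s, F (g x) := by
  induction s using Finset.induction_on with
  | empty => simp
  | insert x s hx ih =>
    rw [Finset.image_insert, Finset.sum_insert hx]
    by_cases h : g x ∈ s.image g
    · rw [Finset.insert_eq_of_mem h]
      omega
    · rw [Finset.sum_insert h]
      omega

/-- Refinement with a global improvement decreases the potential by at least the size of the edit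
set. -/
theorem IsRefinement.potential_le (href : IsRefinement T a b c T')
    (hf : IsConnectivityFunction f) (hab : T.graph.Adj a b)
    (hc : IsGlobalImprovement f T a b c) :
    T'.potential f + (editSet T a b c).ncard ≤ T.potential f := by
  classical
  have himp := hc.minimum.improvement
  set R : Finset ℕ := (editSet_finite (T := T) (a := a) (b := b) (c := c)).toFinset with hRdef
  have hR : ∀ w, w ∈ R ↔ w ∈ editSet T a b c := fun w => Set.Finite.mem_toFinset _
  have hRcard : (editSet T a b c).ncard = R.card := Set.ncard_eq_toFinset_card _ _
  obtain ⟨haR, hbR⟩ := himp.root_mem_editSet hf hab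
  set removed : Finset (Set V) := R.image (T.below a b) with hrem
  have hremsub : removed ⊆ T.sides := by
    intro A hA
    obtain ⟨w, hw, rfl⟩ := Finset.mem_image.1 hA
    exact below_mem_sides hab ((hR w).1 hw).1
  set new : Finset (Set V) := (R ×ˢ Finset.univ).image
    (fun e : ℕ × Fin 3 => T.below a b e.1 ∩ part c e.2) ∪ Finset.univ.image (part c) with hnew
  have hsides : T'.sides ⊆ (T.sides \ removed) ∪ (new ∪ new.image compl) := by
    intro A hA
    obtain ⟨x, y, hxy, hxyA⟩ := mem_sides.1 hA
    have hAr : A ∉ removed := by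
      intro h
      obtain ⟨w, hw, rfl⟩ := Finset.mem_image.1 h
      exact href.below_notMem_sides hf hab himp ((hR w).1 hw) hA
    have key : ∀ B : Set V, B.Nonempty → IsRefinedSide T a b c B → B ∈ T.sides ∨ B ∈ new := by
      rintro B hBne ⟨i, rfl | ⟨w, hw, rfl⟩⟩
      · right
        exact Finset.mem_union_right _ (Finset.mem_image_of_mem _ (Finset.mem_univ i))
      · by_cases hwR : w ∈ editSet T a b c
        · right
          refine Finset.mem_union_left _ (Finset.mem_image.2 ⟨(w, i), ?_, rfl⟩)
          exact Finset.mem_product.2 ⟨(hR w).2 hwR, Finset.mem_univ i⟩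
        · left
          obtain ⟨j, hj⟩ := exists_below_subset_part hab hw hwR
          obtain ⟨p, hp⟩ := hBne
          have hij : j = i := (hj hp.1).symm.trans hp.2
          subst hij
          rw [Set.inter_eq_left.2 hj]
          exact below_mem_sides hab hw
    rcases href.side hab hxy with h | h
    · rcases key _ (T'.side_nonempty hxy) h with h' | h'
      · rw [hxyA] at h'
        exact Finset.mem_union_left _ (Finset.mem_sdiff.2 ⟨h', hAr⟩)
      · rw [hxyA] at h'
        exact Finset.mem_union_right _ (Finset.mem_union_left _ h')
    · rw [← T'.side_compl hxy] at h
      rcases key _ (T'.side_nonempty hxy.symm) h with h' | h'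
      · have := mem_sides_compl h'
        rw [T'.side_compl hxy, compl_compl, hxyA] at this
        exact Finset.mem_union_left _ (Finset.mem_sdiff.2 ⟨this, hAr⟩)
      · refine Finset.mem_union_right _ (Finset.mem_union_right _ (Finset.mem_image.2
          ⟨_, h', ?_⟩))
        rw [T'.side_compl hxy, compl_compl, hxyA]
  have hsum1 : T'.potential f ≤ (∑ A ∈ T.sides \ removed, 16 ^ f A) + 2 * ∑ A ∈ new, 16 ^ f A := by
    refine (Finset.sum_le_sum_of_subset hsides).trans ?_
    refine (sum_union_le_add _ _ _).trans ?_
    refine Nat.add_le_add_left ((sum_union_le_add _ _ _).trans ?_) _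
    have : ∑ A ∈ new.image compl, 16 ^ f A = ∑ A ∈ new, 16 ^ f A := by
      rw [Finset.sum_image fun A _ B _ h => compl_injective h]
      exact Finset.sum_congr rfl fun A _ => by rw [hf.symm]
    rw [this]
    omega
  have hsum2 : ∑ A ∈ new, 16 ^ f A ≤
      (∑ w ∈ R, 3 * 16 ^ (f (T.below a b w) - 1)) + 3 * 16 ^ (f (T.side a b) - 1) := by
    refine (sum_union_le_add _ _ _).trans (Nat.add_le_add ?_ ?_)
    · refine (sum_image_le_sum _ _ _).trans ?_
      rw [Finset.sum_product]
      refine Finset.sum_le_sum fun w hw => ?_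
      refine (Finset.sum_le_card_nsmul _ _ (16 ^ (f (T.below a b w) - 1)) fun i _ => ?_).trans
        (by simp)
      exact Nat.pow_le_pow_right (by norm_num)
        (Nat.le_sub_one_of_lt (hc.below_inter_part_lt hf hab ((hR w).1 hw) i))
    · refine (sum_image_le_sum _ _ _).trans ?_
      refine (Finset.sum_le_card_nsmul _ _ (16 ^ (f (T.side a b) - 1)) fun i _ => ?_).trans
        (by simp)
      have := (himp i).1
      exact Nat.pow_le_pow_right (by norm_num) (by omega)
  have hsum3 : (∑ A ∈ T.sides \ removed, 16 ^ f A) + ∑ A ∈ removed, 16 ^ f A = T.potential f :=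
    Finset.sum_sdiff hremsub
  have hsum4 : ∑ A ∈ removed, 16 ^ f A = ∑ w ∈ R, 16 ^ f (T.below a b w) :=
    Finset.sum_image fun w hw z hz he =>
      below_injective hab ((hR w).1 hw).1 ((hR z).1 hz).1 he
  have hpos : ∀ w ∈ R, 16 ^ f (T.below a b w) = 16 * 16 ^ (f (T.below a b w) - 1) := by
    intro w hw
    have := hc.below_inter_part_lt hf hab ((hR w).1 hw) 0
    rw [← pow_succ', Nat.sub_add_cancel (by omega)]
  have hsum5 : ∑ w ∈ R, 16 ^ f (T.below a b w) =
      16 * ∑ w ∈ R, 16 ^ (f (T.below a b w) - 1) := by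
    rw [Finset.mul_sum]
    exact Finset.sum_congr rfl hpos
  have hsum6 : 16 ^ (f (T.side a b) - 1) ≤ ∑ w ∈ R, 16 ^ (f (T.below a b w) - 1) := by
    rw [← below_root_left hab]
    exact Finset.single_le_sum (f := fun w => 16 ^ (f (T.below a b w) - 1))
      (fun _ _ => Nat.zero_le _) ((hR a).2 haR)
  have hsum7 : R.card ≤ ∑ w ∈ R, 16 ^ (f (T.below a b w) - 1) := by
    rw [Finset.card_eq_sum_ones]
    exact Finset.sum_le_sum fun w _ => Nat.one_le_pow _ _ (by norm_num)
  rw [← Finset.mul_sum] at hsum2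
  omega

theorem BranchDecomposition.card_directedEdges_le (T : BranchDecomposition V) :
    ∃ E : Finset (ℕ × ℕ), (∀ x y, (x, y) ∈ E ↔ T.graph.Adj x y) ∧ E.card ≤ 2 * T.nodes.card ∧
      E.card = ∑ x ∈ T.nodes, (T.graph.neighborSet x).ncard := by
  classical
  obtain ⟨a, ha⟩ := T.nonempty
  obtain ⟨b, hab⟩ : ∃ b, T.graph.Adj a b := by
    have : (T.graph.neighborSet a).ncard ≠ 0 := by rcases T.cubic a ha with h | h <;> omega
    exact Set.nonempty_of_ncard_ne_zero this
  choose! par hpar using fun w (hw : w ∈ T.nodes) => exists_isParent hab hw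
  let E : Finset (ℕ × ℕ) := (T.nodes ×ˢ T.nodes).filter fun e => T.graph.Adj e.1 e.2
  have hE : ∀ x y, (x, y) ∈ E ↔ T.graph.Adj x y := by
    intro x y
    simp only [E, Finset.mem_filter, Finset.mem_product]
    exact ⟨fun h => h.2, fun h => ⟨⟨T.mem_of_adj _ _ h, T.mem_nodes_right h⟩, h⟩⟩
  refine ⟨E, hE, ?_, ?_⟩
  · have hsub : E ⊆ T.nodes.image (fun w => (w, par w)) ∪ T.nodes.image (fun w => (par w, w)) := by
      rintro ⟨x, y⟩ hxy
      have hxy' := (hE x y).1 hxy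
      rw [Finset.mem_union, Finset.mem_image, Finset.mem_image]
      rcases isParent_total (a := a) (b := b) hxy' with h | h
      · have hx := T.mem_of_adj _ _ hxy'
        exact Or.inl ⟨x, hx, by rw [(hpar x hx).unique hab h]⟩
      · have hy := T.mem_nodes_right hxy'
        exact Or.inr ⟨y, hy, by rw [(hpar y hy).unique hab h]⟩
    refine (Finset.card_le_card hsub).trans ((Finset.card_union_le _ _).trans ?_)
    have h1 := Finset.card_image_le (s := T.nodes) (f := fun w => (w, par w))
    have h2 := Finset.card_image_le (s := T.nodes) (f := fun w => (par w, w))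
    omega
  · rw [Finset.card_eq_sum_card_fiberwise (f := Prod.fst) (t := T.nodes)]
    · refine Finset.sum_congr rfl fun x hx => ?_
      rw [Set.ncard_eq_toFinset_card _ (T.neighborSet_finite x)]
      refine Finset.card_bij (fun e _ => e.2) ?_ ?_ ?_
      · rintro ⟨x', y⟩ he
        rw [Finset.mem_filter] at he
        obtain ⟨he, rfl⟩ := he
        exact (Set.Finite.mem_toFinset _).2 ((hE _ _).1 he)
      · rintro ⟨x1, y1⟩ h1 ⟨x2, y2⟩ h2 he
        rw [Finset.mem_filter] at h1 h2
        exact Prod.ext (h1.2.trans h2.2.symm) he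
      · intro y hy
        rw [Set.Finite.mem_toFinset] at hy
        exact ⟨(x, y), Finset.mem_filter.2 ⟨(hE x y).2 hy, rfl⟩, rfl⟩
    · rintro ⟨x, y⟩ he
      exact T.mem_of_adj _ _ ((hE x y).1 he)

theorem BranchDecomposition.card_nodes_le [Finite V] (T : BranchDecomposition V) :
    T.nodes.card ≤ 2 * Nat.card V := by
  classical
  obtain ⟨E, _, h1, h2⟩ := T.card_directedEdges_le
  have hleaf : (T.nodes.filter fun x => (T.graph.neighborSet x).ncard = 1).card = Nat.card V := by
    rw [← Set.ncard_univ, ← T.leaf_bijOn.injOn.ncard_image, T.leaf_bijOn.image_eq,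
      ← Set.ncard_coe_finset]
    congr 1
    ext x
    simp
  have h3 : ∑ x ∈ T.nodes, (T.graph.neighborSet x).ncard +
      2 * (T.nodes.filter fun x => (T.graph.neighborSet x).ncard = 1).card =
        3 * T.nodes.card := by
    rw [Finset.card_filter, Finset.mul_sum, ← Finset.sum_add_distrib, mul_comm,
      ← smul_eq_mul, ← Finset.sum_const]
    refine Finset.sum_congr rfl fun x hx => ?_
    rcases T.cubic x hx with h | h <;> simp [h]
  omega

theorem BranchDecomposition.potential_le_mul (T : BranchDecomposition V) (f : Set V → ℕ) :
    T.potential f ≤ 2 * T.nodes.card * 16 ^ T.width f := by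
  classical
  obtain ⟨E, hE, h1, _⟩ := T.card_directedEdges_le
  have hsub : T.sides ⊆ E.image fun e => T.side e.1 e.2 := by
    intro A hA
    obtain ⟨x, y, h, rfl⟩ := mem_sides.1 hA
    exact Finset.mem_image.2 ⟨(x, y), (hE x y).2 h, rfl⟩
  refine (Finset.sum_le_card_nsmul _ _ (16 ^ T.width f) fun A hA => ?_).trans ?_
  · obtain ⟨x, y, h, rfl⟩ := mem_sides.1 hA
    exact Nat.pow_le_pow_right (by norm_num) (T.le_width h)
  · rw [smul_eq_mul]
    exact Nat.mul_le_mul_right _ ((Finset.card_le_card hsub).trans (Finset.card_image_le.trans h1))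

end Potential

/-! ### Depth-first search on a changing tree -/

section Search

variable {V : Type u} {f : Set V → ℕ}

open BranchDecomposition

/-- The stack of a depth-first search, with the current node first: `par` points from each node to
the next one, and the last node points to itself. The widths of the edges are less than `B`. -/
def IsStack (T : BranchDecomposition V) (f : Set V → ℕ) (B : ℕ) (par : ℕ → ℕ) : List ℕ → Prop
  | [] => False
  | [x] => par x = x
  | x :: y :: l => par x = y ∧ T.graph.Adj x y ∧ f (T.side x y) < B ∧ IsStack T f B par (y :: l)

/-- The invariant of a depth-first search at the node `v`, where `st` is the state of the nodes: `U`
for unseen nodes, 2 for nodes on the stack `v :: l`, and `C` for closed nodes. Widths of edges at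
closed nodes and on the stack are known to be less than `B`. -/
structure IsSearch (T : BranchDecomposition V) (f : Set V → ℕ) (U C B : ℕ) (st par : ℕ → ℕ)
    (v : ℕ) (l : List ℕ) : Prop where
  out : ∀ z, z ∉ T.nodes → st z = 0
  state : ∀ z ∈ T.nodes, st z = U ∨ st z = 2 ∨ st z = C
  mem_stack : ∀ z, z ∈ v :: l ↔ st z = 2
  nodup : (v :: l).Nodup
  stack : IsStack T f B par (v :: l)
  closed : ∀ z z', st z = C → T.graph.Adj z z' → f (T.side z z') < B
  /-- The nodes that are not closed are connected. -/
  alive : ∀ z ∈ T.nodes, st z ≠ C →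
    Relation.ReflTransGen (fun x y => T.graph.Adj x y ∧ st y ≠ C) v z

variable {T T' : BranchDecomposition V} {U C B B' : ℕ} {st st' par par' : ℕ → ℕ} {v w : ℕ}
  {l : List ℕ}

theorem reflTransGen_of_imp {α : Type*} {p q : α → α → Prop} (h : ∀ x y, p x y → q x y) {x y : α}
    (hxy : Relation.ReflTransGen p x y) : Relation.ReflTransGen q x y := by
  induction hxy with
  | refl => exact .refl
  | tail _ h' ih => exact ih.tail (h _ _ h')

theorem IsStack.congr {l : List ℕ} (h : IsStack T f B par l) (hB : B ≤ B')
    (hp : ∀ z ∈ l, par' z = par z) : IsStack T f B' par' l := by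
  induction l with
  | nil => exact h
  | cons x l ih =>
    cases l with
    | nil => exact (hp x (by simp)).trans h
    | cons y l =>
      obtain ⟨h1, h2, h3, h4⟩ := h
      exact ⟨(hp x (by simp)).trans h1, h2, h3.trans_le hB,
        ih h4 fun z hz => hp z (List.mem_cons_of_mem _ hz)⟩

/-- A stack avoiding `v` stays on one side of an edge at `v`. -/
theorem IsStack.subset_edgeComp {x y : ℕ} (h : IsStack T f B par (x :: l)) (hv : v ∉ x :: l)
    (hx : x ∈ edgeComp T.graph y v) : ∀ z ∈ x :: l, z ∈ edgeComp T.graph y v := by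
  induction l generalizing x with
  | nil =>
    intro z hz
    rw [List.mem_singleton] at hz
    exact hz ▸ hx
  | cons x' l ih =>
    intro z hz
    rcases List.mem_cons.1 hz with rfl | hz
    · exact hx
    · refine ih h.2.2.2 (fun h' => hv (List.mem_cons_of_mem _ h')) ?_ z hz
      refine edgeComp_step hx h.2.1 fun he => hv ?_
      rcases Sym2.eq_iff.1 he with ⟨_, h2⟩ | ⟨h1, _⟩
      · simp [← h2]
      · simp [← h1]

/-- The current node has at most one neighbour on the stack. -/
theorem IsStack.eq_of_adj {y z : ℕ} (h : IsStack T f B par (v :: y :: l))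
    (hnd : (v :: y :: l).Nodup) (hz : z ∈ y :: l) (hvz : T.graph.Adj v z) : z = y := by
  have hv : v ∉ y :: l := (List.nodup_cons.1 hnd).1
  have hzy := h.2.2.2.subset_edgeComp (y := y) hv self_mem_edgeComp z hz
  exact (eq_of_edgeComp_leave T.acyclic h.2.1.symm hzy
    (T.acyclic.notMem_edgeComp h.2.1.symm) hvz.symm).1

theorem IsStack.mono {l : List ℕ} (h : IsStack T f B par l) (hB : B ≤ B') :
    IsStack T f B' par l := h.congr hB fun _ _ => rfl

theorem side_swap (hf : IsConnectivityFunction f) {x y : ℕ} (h : T.graph.Adj x y) :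
    f (T.side y x) = f (T.side x y) := by
  rw [T.side_compl h, hf.symm]

/-- The weight of a node in the running time of the search: the number of times that the search
still has to deal with it. -/
def nodeWeight (U s : ℕ) : ℕ := if s = U then 2 else if s = 2 then 1 else 0

/-- The total weight of the nodes. -/
def searchWeight (T : BranchDecomposition V) (U : ℕ) (st : ℕ → ℕ) : ℕ :=
  ∑ z ∈ T.nodes, nodeWeight U (st z)

theorem searchWeight_update (hw : w ∈ T.nodes) {s : ℕ}
    (h : nodeWeight U s + 1 ≤ nodeWeight U (st w)) :
    searchWeight T U (Function.update st w s) + 1 ≤ searchWeight T U st := by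
  classical
  unfold searchWeight
  rw [← Finset.add_sum_erase _ _ hw, ← Finset.add_sum_erase (a := w)
    (f := fun z => nodeWeight U (st z)) _ hw, Function.update_self]
  have : ∑ z ∈ T.nodes.erase w, nodeWeight U (Function.update st w s z) =
      ∑ z ∈ T.nodes.erase w, nodeWeight U (st z) := by
    refine Finset.sum_congr rfl fun z hz => ?_
    rw [Function.update_of_ne (Finset.ne_of_mem_erase hz)]
  omega

theorem searchWeight_le (T : BranchDecomposition V) (U : ℕ) (st : ℕ → ℕ) :
    searchWeight T U st ≤ 2 * T.nodes.card := by
  refine (Finset.sum_le_card_nsmul _ _ 2 fun z _ => ?_).trans (by simp [mul_comm])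
  unfold nodeWeight
  split_ifs <;> omega

namespace IsSearch

theorem mono (h : IsSearch T f U C B st par v l) (hB : B ≤ B') :
    IsSearch T f U C B' st par v l :=
  ⟨h.out, h.state, h.mem_stack, h.nodup, h.stack.mono hB,
    fun z z' hz hzz => (h.closed z z' hz hzz).trans_le hB, h.alive⟩

theorem current_state (h : IsSearch T f U C B st par v l) : st v = 2 :=
  (h.mem_stack v).1 (by simp)

theorem mem_nodes (h : IsSearch T f U C B st par v l) {z : ℕ} (hz : z ∈ v :: l) :
    z ∈ T.nodes := by
  by_contra hcon
  have h1 := h.out z hcon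
  have h2 := (h.mem_stack z).1 hz
  omega

/-- The search starts at any node. -/
theorem start (hv : v ∈ T.nodes) (hU2 : U ≠ 2) (hC2 : C ≠ 2) (hUC : U ≠ C)
    (hst : ∀ z ∈ T.nodes, st z = U) (hout : ∀ z, z ∉ T.nodes → st z = 0) :
    IsSearch T f U C B (Function.update st v 2) (Function.update par v v) v [] := by
  have hne : ∀ z ∈ T.nodes, Function.update st v 2 z ≠ C := by
    intro z hz
    by_cases hzv : z = v
    · subst hzv
      rw [Function.update_self]
      exact hC2.symm
    · rw [Function.update_of_ne hzv, hst z hz]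
      exact hUC
  refine ⟨?_, ?_, ?_, by simp, by simp [IsStack], ?_, ?_⟩
  · intro z hz
    have hzv : z ≠ v := fun h => hz (h ▸ hv)
    rw [Function.update_of_ne hzv, hout z hz]
  · intro z hz
    by_cases hzv : z = v
    · subst hzv
      simp
    · rw [Function.update_of_ne hzv, hst z hz]
      exact Or.inl rfl
  · intro z
    rw [List.mem_singleton]
    constructor
    · rintro rfl
      simp
    · intro hz
      by_contra hzv
      rw [Function.update_of_ne hzv] at hz
      by_cases hzn : z ∈ T.nodes
      · exact hU2 ((hst z hzn).symm.trans hz)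
      · rw [hout z hzn] at hz
        omega
  · intro z z' hz hzz
    exact absurd hz (hne z (T.mem_of_adj _ _ hzz))
  · intro z hz _
    have h1 := (SimpleGraph.reachable_iff_reflTransGen _ _).1 (T.reachable v hv z hz)
    exact reflTransGen_of_imp (fun x y hxy => ⟨hxy, hne y (T.mem_nodes_right hxy)⟩) h1

/-- Opening an unseen neighbour of the current node. -/
theorem visit (h : IsSearch T f U C B st par v l) (hf : IsConnectivityFunction f) (hU2 : U ≠ 2)
    (hC2 : C ≠ 2) (hUC : U ≠ C) (hvw : T.graph.Adj v w) (hw : st w = U)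
    (hB : f (T.side v w) < B) :
    IsSearch T f U C B (Function.update st w 2) (Function.update par w v) w (v :: l) := by
  have hwl : w ∉ v :: l := fun hm => hU2 (hw.symm.trans ((h.mem_stack w).1 hm))
  have hiff : ∀ z, Function.update st w 2 z ≠ C ↔ st z ≠ C := by
    intro z
    by_cases hz : z = w
    · subst hz
      rw [Function.update_self, hw]
      exact ⟨fun _ => hUC, fun _ => hC2.symm⟩
    · rw [Function.update_of_ne hz]
  refine ⟨?_, ?_, ?_, List.nodup_cons.2 ⟨hwl, h.nodup⟩, ?_, ?_, ?_⟩
  · intro z hz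
    have hzw : z ≠ w := fun he => hz (he ▸ T.mem_nodes_right hvw)
    rw [Function.update_of_ne hzw, h.out z hz]
  · intro z hz
    by_cases hzw : z = w
    · subst hzw
      simp
    · rw [Function.update_of_ne hzw]
      exact h.state z hz
  · intro z
    by_cases hzw : z = w
    · subst hzw
      simp
    · rw [List.mem_cons, Function.update_of_ne hzw, h.mem_stack]
      exact ⟨fun h => h.resolve_left hzw, Or.inr⟩
  · refine ⟨Function.update_self _ _ _, hvw.symm, by rwa [side_swap hf hvw], ?_⟩
    refine h.stack.congr le_rfl fun z hz => ?_
    rw [Function.update_of_ne]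
    rintro rfl
    exact hwl hz
  · intro z z' hz hzz
    exact h.closed z z' (not_not.1 fun hne => (hiff z).2 hne hz) hzz
  · intro z hz hzC
    refine Relation.ReflTransGen.head (b := v) ⟨hvw.symm, (hiff v).2 ?_⟩ ?_
    · rw [h.current_state]
      exact hC2.symm
    · exact reflTransGen_of_imp (fun x y hxy => ⟨hxy.1, (hiff y).2 hxy.2⟩)
        (h.alive z hz ((hiff z).1 hzC))

theorem side_lt_of_forall_ne (h : IsSearch T f U C B st par v l)
    (hf : IsConnectivityFunction f) (hnU : ∀ w, T.graph.Adj v w → st w ≠ U) :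
    ∀ z, T.graph.Adj v z → f (T.side v z) < B := by
  intro z hz
  rcases h.state z (T.mem_nodes_right hz) with h1 | h1 | h1
  · exact absurd h1 (hnU z hz)
  · have hzl := (h.mem_stack z).2 h1
    rcases List.mem_cons.1 hzl with rfl | hzl
    · exact absurd hz (SimpleGraph.irrefl _)
    · cases l with
      | nil => simp at hzl
      | cons y l =>
        rw [h.stack.eq_of_adj h.nodup hzl hz]
        exact h.stack.2.2.1
  · rw [← side_swap hf hz]
    exact h.closed z v h1 hz.symm

/-- Closing the current node if it has no unseen neighbour, and going back to its parent. -/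
theorem close {y : ℕ} (h : IsSearch T f U C B st par v (y :: l)) (hf : IsConnectivityFunction f)
    (hC2 : C ≠ 2) (hnU : ∀ w, T.graph.Adj v w → st w ≠ U) :
    IsSearch T f U C B (Function.update st v C) par y l := by
  have hvl : v ∉ y :: l := (List.nodup_cons.1 h.nodup).1
  have hedge := h.side_lt_of_forall_ne hf hnU
  have hvn : v ∈ T.nodes := h.mem_nodes (by simp)
  refine ⟨?_, ?_, ?_, (List.nodup_cons.1 h.nodup).2, h.stack.2.2.2, ?_, ?_⟩
  · intro z hz
    have hzv : z ≠ v := fun he => hz (he ▸ hvn)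
    rw [Function.update_of_ne hzv, h.out z hz]
  · intro z hz
    by_cases hzv : z = v
    · subst hzv
      simp
    · rw [Function.update_of_ne hzv]
      exact h.state z hz
  · intro z
    by_cases hzv : z = v
    · subst hzv
      rw [Function.update_self]
      exact ⟨fun h => absurd h hvl, fun h => absurd h hC2⟩
    · rw [Function.update_of_ne hzv, ← h.mem_stack, List.mem_cons (a := z) (b := v)]
      exact ⟨Or.inr, fun h => h.resolve_left hzv⟩
  · intro z z' hz hzz
    by_cases hzv : z = v
    · subst hzv
      exact hedge z' hzz
    · rw [Function.update_of_ne hzv] at hz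
      exact h.closed z z' hz hzz
  · intro z hz hzC
    have hzv : z ≠ v := by
      rintro rfl
      exact hzC (Function.update_self _ _ _)
    rw [Function.update_of_ne hzv] at hzC
    -- A walk through nodes that are not closed can only leave `v` towards `y`.
    suffices H : ∀ z, Relation.ReflTransGen (fun x y => T.graph.Adj x y ∧ st y ≠ C) v z →
        z = v ∨ Relation.ReflTransGen
          (fun x y => T.graph.Adj x y ∧ Function.update st v C y ≠ C) y z from
      (H z (h.alive z hz hzC)).resolve_left hzv
    intro z hz
    induction hz with
    | refl => exact Or.inl rfl
    | @tail x x' _ hxx ih =>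
      by_cases hx' : x' = v
      · exact Or.inl hx'
      right
      rcases ih with rfl | ih
      · rcases h.state x' (T.mem_nodes_right hxx.1) with h1 | h1 | h1
        · exact absurd h1 (hnU x' hxx.1)
        · have := (h.mem_stack x').2 h1
          rw [h.stack.eq_of_adj h.nodup ((List.mem_cons.1 this).resolve_left hx') hxx.1]
        · exact absurd h1 hxx.2
      · refine ih.tail ⟨hxx.1, ?_⟩
        rw [Function.update_of_ne hx']
        exact hxx.2

/-- If the bottom of the stack has no unseen neighbour, then the search is finished. -/
theorem finish (h : IsSearch T f U C B st par v []) (hf : IsConnectivityFunction f)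
    (hnU : ∀ w, T.graph.Adj v w → st w ≠ U) :
    (∀ z ∈ T.nodes, Function.update st v C z = C) ∧
      ∀ x y, T.graph.Adj x y → f (T.side x y) < B := by
  have hedge := h.side_lt_of_forall_ne hf hnU
  have hcl : ∀ z ∈ T.nodes, z ≠ v → st z = C := by
    intro z hz hzv
    by_contra hzC
    rcases Relation.ReflTransGen.cases_head (h.alive z hz hzC) with h1 | ⟨x, hx, _⟩
    · exact hzv h1.symm
    · rcases h.state x (T.mem_nodes_right hx.1) with h1 | h1 | h1
      · exact hnU x hx.1 h1
      · have := (h.mem_stack x).2 h1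
        rw [List.mem_singleton] at this
        exact hx.1.ne this.symm
      · exact hx.2 h1
  constructor
  · intro z hz
    by_cases hzv : z = v
    · subst hzv
      simp
    · rw [Function.update_of_ne hzv]
      exact hcl z hz hzv
  · intro x y hxy
    by_cases hx : x = v
    · subst hx
      exact hedge y hxy
    · exact h.closed x y (hcl x (T.mem_of_adj _ _ hxy) hx) hxy

end IsSearch

/-! ### The effect of a refinement on the search -/

/-- A path, ending next to the node `o`, along which `par` points towards `o`. -/
def IsPathTo (T : BranchDecomposition V) (par : ℕ → ℕ) (o : ℕ) : List ℕ → Prop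
  | [] => True
  | x :: l => par x = l.headD o ∧ T.graph.Adj x (l.headD o) ∧ IsPathTo T par o l

variable {a b : ℕ} {c : V → Fin 3} {M : Finset ℕ} {o a' : ℕ} {π : List ℕ}

theorem IsStack.rest_notMem {x y : ℕ} (h : IsStack T f B par (y :: l)) (hnd : (y :: l).Nodup)
    (hf : IsConnectivityFunction f) (hab : T.graph.Adj a b)
    (hc : IsImprovement f (T.side a b) c) (hx : x ∉ y :: l) (hyx : T.IsParent a b y x)
    (hy : y ∉ editSet T a b c) :
    ∀ z ∈ l, z ∉ editSet T a b c ∧ ∃ q, q ∉ editSet T a b c ∧ T.IsParent a b z q := by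
  induction l generalizing x y with
  | nil => simp
  | cons z l ih =>
    have hzy : T.IsParent a b z y := by
      rcases isParent_total (a := a) (b := b) h.2.1 with h1 | h1
      · exact absurd (by rw [hyx.unique hab h1]; simp) hx
      · exact h1
    have hz : z ∉ editSet T a b c := fun hz => hy (hc.parent_mem_editSet hf hab hz hzy)
    intro z' hz'
    rcases List.mem_cons.1 hz' with rfl | hz'
    · exact ⟨hz, y, hy, hzy⟩
    · exact ih h.2.2.2 (List.nodup_cons.1 hnd).2 (List.nodup_cons.1 hnd).1 hzy hz z' hz'

/-- The stack consists of nodes of the edit set followed by nodes outside of it; of the latter only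
the first one has its parent in the edit set. -/
theorem IsStack.split {x q : ℕ} (h : IsStack T f B par (x :: l)) (hnd : (x :: l).Nodup)
    (hf : IsConnectivityFunction f) (hab : T.graph.Adj a b)
    (hc : IsImprovement f (T.side a b) c) (hq : q ∉ x :: l) (hxq : T.IsParent a b x q)
    (hx : x ∈ editSet T a b c) :
    ∃ pre suf, x :: l = pre ++ suf ∧ (∀ z ∈ pre, z ∈ editSet T a b c) ∧
      (∀ z ∈ suf, z ∉ editSet T a b c) ∧ (suf ≠ [] → IsStack T f B par suf) ∧
      ∀ o suf', suf = o :: suf' →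
        (∃ q ∈ editSet T a b c, T.IsParent a b o q ∧ f (T.side o q) < B) ∧
        ∀ z ∈ suf', ∃ q, q ∉ editSet T a b c ∧ T.IsParent a b z q := by
  induction l generalizing x q with
  | nil => exact ⟨[x], [], by simp, by simpa using hx, by simp, by simp, by simp⟩
  | cons y l ih =>
    have hyx : T.IsParent a b y x := by
      rcases isParent_total (a := a) (b := b) h.2.1 with h1 | h1
      · exact absurd (by rw [hxq.unique hab h1]; simp) hq
      · exact h1
    have hxl := (List.nodup_cons.1 hnd).1
    have hnd' := (List.nodup_cons.1 hnd).2
    by_cases hy : y ∈ editSet T a b c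
    · obtain ⟨pre, suf, h1, h2, h3⟩ := ih h.2.2.2 hnd' hxl hyx hy
      refine ⟨x :: pre, suf, by rw [h1]; rfl, ?_, h3⟩
      intro z hz
      rcases List.mem_cons.1 hz with rfl | hz
      · exact hx
      · exact h2 z hz
    · have hrest := h.2.2.2.rest_notMem hnd' hf hab hc hxl hyx hy
      refine ⟨[x], y :: l, rfl, by simpa using hx, ?_, fun _ => h.2.2.2, ?_⟩
      · intro z hz
        rcases List.mem_cons.1 hz with rfl | hz
        · exact hy
        · exact (hrest z hz).1
      · intro o suf' he
        injection he with h1 h2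
        subst h1 h2
        refine ⟨⟨x, hx, hyx, ?_⟩, fun z hz => (hrest z hz).2⟩
        rw [side_swap hf h.2.1]
        exact h.2.2.1

theorem IsStack.replacement {l : List ℕ} (h : IsStack T f B par l)
    (hR : IsReplacement T (editSet T a b c) T' M) (hab : T.graph.Adj a b)
    (hl : ∀ z ∈ l, z ∉ editSet T a b c) (hp : ∀ z ∈ l, par' z = par z) :
    IsStack T' f B par' l := by
  induction l with
  | nil => exact h
  | cons x l ih =>
    cases l with
    | nil => exact (hp x (by simp)).trans h
    | cons y l =>
      obtain ⟨h1, h2, h3, h4⟩ := h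
      obtain ⟨h5, h6⟩ := hR.side_eq hab (hl x (by simp)) (hl y (by simp)) h2
      exact ⟨(hp x (by simp)).trans h1, h5, by rwa [h6],
        ih h4 (fun z hz => hl z (List.mem_cons_of_mem _ hz))
          fun z hz => hp z (List.mem_cons_of_mem _ hz)⟩

theorem IsPathTo.append_stack {l : List ℕ} (h : IsPathTo T par o π)
    (hπ : ∀ x ∈ π, ∀ y, y = o ∨ y ∈ π → T.graph.Adj x y → f (T.side x y) < B)
    (hl : IsStack T f B par (o :: l)) : IsStack T f B par (π ++ o :: l) := by
  induction π with
  | nil => exact hl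
  | cons x π ih =>
    have ih' := ih h.2.2 fun x hx y hy => hπ x (List.mem_cons_of_mem _ hx) y
      (hy.imp id (List.mem_cons_of_mem _))
    cases π with
    | nil => exact ⟨h.1, h.2.1, hπ x (by simp) o (Or.inl rfl) h.2.1, hl⟩
    | cons y π => exact ⟨h.1, h.2.1, hπ x (by simp) y (by simp) h.2.1, ih'⟩

/-- How the memory has to be updated after a refinement: the inserted nodes are unseen (state 1),
except for a path `a' :: π` of them that is put on the stack. This path leads to a kept node `o`
on the stack; if there is none next to an inserted node, then it consists of `a'` only. -/
structure IsRepair (T' : BranchDecomposition V) (M : Finset ℕ) (st par st' par' : ℕ → ℕ)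
    (a' : ℕ) (π : List ℕ) : Prop where
  state_kept : ∀ z ∈ T'.nodes, z ∉ M → st' z = st z
  state_out : ∀ z, z ∉ T'.nodes → st' z = 0
  state_inserted : ∀ z ∈ M, st' z = 1 ∨ st' z = 2
  mem_path : ∀ z, z ∈ a' :: π ↔ z ∈ M ∧ st' z = 2
  nodup : (a' :: π).Nodup
  par_kept : ∀ z, z ∉ M → par' z = par z
  link : (∃ o ∈ T'.nodes, o ∉ M ∧ st o = 2 ∧ IsPathTo T' par' o (a' :: π)) ∨
    (π = [] ∧ par' a' = a' ∧ ∀ o ∈ T'.nodes, o ∉ M → st o = 2 → ∀ m ∈ M, ¬ T'.graph.Adj m o)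

/-- After a refinement, the search continues at an inserted node. -/
theorem IsSearch.repair (h : IsSearch T f 1 3 (f (T.side a b)) st par v l)
    (hf : IsConnectivityFunction f) (hab : T.graph.Adj a b) (hw : st w = 1)
    (hvw : s(v, w) = s(a, b)) (hwidth : T.width f ≤ f (T.side a b))
    (hc : IsGlobalImprovement f T a b c) (hR : IsReplacement T (editSet T a b c) T' M)
    (href : IsRefinement T a b c T') (hrep : IsRepair T' M st par st' par' a' π) :
    ∃ l', IsSearch T' f 1 3 (f (T.side a b)) st' par' a' l' := by
  set R := editSet T a b c with hRdef
  have himp := hc.minimum.improvement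
  have hkept : ∀ z, z ∈ T'.nodes → z ∉ M → z ∈ T.nodes ∧ z ∉ R := fun z hz hzM =>
    ((hR.mem_nodes z).1 hz).resolve_right hzM
  have hkept' : ∀ z, z ∈ T.nodes → z ∉ R → z ∈ T'.nodes ∧ z ∉ M := fun z hz hzR =>
    ⟨(hR.mem_nodes z).2 (Or.inl ⟨hz, hzR⟩), fun hzM => hzR (hR.mem_of_mem z hzM hz)⟩
  have hMn : ∀ z ∈ M, z ∈ T'.nodes := fun z hz => (hR.mem_nodes z).2 (Or.inr hz)
  have hMM : ∀ x ∈ M, ∀ y ∈ M, T'.graph.Adj x y → f (T'.side x y) < f (T.side a b) :=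
    fun x hx y hy hxy => hR.side_lt href hf hab hc hwidth hx hy hxy
  have hvR : v ∈ R := by
    obtain ⟨h1, h2⟩ := himp.root_mem_editSet hf hab
    rcases Sym2.eq_iff.1 hvw with ⟨rfl, _⟩ | ⟨rfl, _⟩
    · exact h1
    · exact h2
  have hpar : T.IsParent a b v w := by
    rcases Sym2.eq_iff.1 hvw with ⟨rfl, rfl⟩ | ⟨rfl, rfl⟩
    · exact isParent_root hab
    · exact isParent_swap.1 (isParent_root hab.symm)
  have hwl : w ∉ v :: l := fun hm => by
    have := (h.mem_stack w).1 hm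
    omega
  obtain ⟨pre, suf, hsplit, hpre, hsuf, hsufst, hsufpar⟩ :=
    h.stack.split h.nodup hf hab himp hwl hpar hvR
  have hsufmem : ∀ z, z ∈ suf → z ∈ T'.nodes ∧ z ∉ M ∧ st z = 2 := by
    intro z hz
    have hzl : z ∈ v :: l := by
      rw [hsplit]
      exact List.mem_append_right _ hz
    obtain ⟨h1, h2⟩ := hkept' z (h.mem_nodes hzl) (hsuf z hz)
    exact ⟨h1, h2, (h.mem_stack z).1 hzl⟩
  have hmemsuf : ∀ z, z ∈ T'.nodes → z ∉ M → st z = 2 → z ∈ suf := by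
    intro z hz hzM hz2
    have hzl := (h.mem_stack z).2 hz2
    rw [hsplit, List.mem_append] at hzl
    exact hzl.resolve_left fun h' => (hkept z hz hzM).2 (hpre z h')
  have hstack : IsStack T' f (f (T.side a b)) par' (a' :: π ++ suf) := by
    rcases hrep.link with ⟨o, ho, hoM, ho2, hpath⟩ | ⟨rfl, hpa, hno⟩
    · have hosuf := hmemsuf o ho hoM ho2
      obtain ⟨o', suf', rfl⟩ := List.exists_cons_of_ne_nil (List.ne_nil_of_mem hosuf)
      obtain ⟨⟨q, hq, hoq, hlt⟩, htail⟩ := hsufpar o' suf' rfl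
      -- The kept nodes on the stack other than the first one have no inserted neighbour.
      have hlast : ∀ l : List ℕ, l ≠ [] → IsPathTo T' par' o l → ∃ x ∈ l, T'.graph.Adj x o := by
        intro l hl hp
        induction l with
        | nil => exact absurd rfl hl
        | cons x l ih =>
          cases l with
          | nil => exact ⟨x, by simp, hp.2.1⟩
          | cons y l =>
            obtain ⟨z, hz, hzo⟩ := ih (by simp) hp.2.2
            exact ⟨z, List.mem_cons_of_mem _ hz, hzo⟩
      have hpar_o : ∀ m ∈ M, T'.graph.Adj m o → ∃ q ∈ R, T.IsParent a b o q ∧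
          T'.side o m = T.side o q := fun m hm hmo =>
        hR.exists_removed hab (hkept o ho hoM).1 (hkept o ho hoM).2 hm hmo.symm
      have hoo : o = o' := by
        by_contra hne
        obtain ⟨q1, hq1, h1⟩ := htail o ((List.mem_cons.1 hosuf).resolve_left hne)
        obtain ⟨x, hx, hxo⟩ := hlast _ (by simp) hpath
        obtain ⟨q2, hq2, h2, _⟩ := hpar_o x ((hrep.mem_path x).1 hx).1 hxo
        rw [h1.unique hab h2] at hq1
        exact hq1 hq2
      subst hoo
      refine hpath.append_stack ?_ ?_
      · intro x hx y hy hxy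
        have hxM := ((hrep.mem_path x).1 hx).1
        rcases hy with rfl | hy
        · obtain ⟨q2, hq2, h2, h3⟩ := hpar_o x hxM hxy
          rw [side_swap hf hxy.symm, h3, h2.unique hab hoq]
          exact hlt
        · exact hMM x hxM y ((hrep.mem_path y).1 hy).1 hxy
      · exact (hsufst (by simp)).replacement hR hab hsuf
          fun z hz => hrep.par_kept z (hsufmem z hz).2.1
    · cases suf with
      | nil => exact hpa
      | cons o suf' =>
        obtain ⟨⟨q, hq, hoq, hlt⟩, _⟩ := hsufpar o suf' rfl
        obtain ⟨h1, h2, h3⟩ := hsufmem o (by simp)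
        obtain ⟨m, hm, hmo⟩ := hR.exists_inserted hab (hsuf o (by simp)) hq hoq
        exact absurd hmo.symm (hno o h1 h2 h3 m hm)
  have ha'M : a' ∈ M := ((hrep.mem_path a').1 (by simp)).1
  have hne3 : ∀ m ∈ M, st' m ≠ 3 := by
    intro m hm
    rcases hrep.state_inserted m hm with h1 | h1 <;> omega
  refine ⟨π ++ suf, hrep.state_out, ?_, ?_, ?_, hstack, ?_, ?_⟩
  · intro z hz
    by_cases hzM : z ∈ M
    · rcases hrep.state_inserted z hzM with h1 | h1
      · exact Or.inl h1
      · exact Or.inr (Or.inl h1)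
    · rw [hrep.state_kept z hz hzM]
      exact h.state z (hkept z hz hzM).1
  · intro z
    rw [← List.cons_append, List.mem_append]
    constructor
    · rintro (hz | hz)
      · exact ((hrep.mem_path z).1 hz).2
      · obtain ⟨h1, h2, h3⟩ := hsufmem z hz
        rw [hrep.state_kept z h1 h2, h3]
    · intro hz
      by_cases hzM : z ∈ M
      · exact Or.inl ((hrep.mem_path z).2 ⟨hzM, hz⟩)
      · by_cases hzn : z ∈ T'.nodes
        · rw [hrep.state_kept z hzn hzM] at hz
          exact Or.inr (hmemsuf z hzn hzM hz)
        · rw [hrep.state_out z hzn] at hz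
          omega
  · rw [← List.cons_append, List.nodup_append]
    refine ⟨hrep.nodup, ?_, ?_⟩
    · have := h.nodup
      rw [hsplit, List.nodup_append] at this
      exact this.2.1
    · rintro x hx y hy rfl
      exact (hsufmem x hy).2.1 ((hrep.mem_path x).1 hx).1
  · intro z z' hz hzz
    have hzM : z ∉ M := fun hm => hne3 z hm hz
    have hzn := T'.mem_of_adj _ _ hzz
    rw [hrep.state_kept z hzn hzM] at hz
    obtain ⟨h1, h2⟩ := hkept z hzn hzM
    by_cases hz'M : z' ∈ M
    · obtain ⟨q, _, hq, he⟩ := hR.exists_removed hab h1 h2 hz'M hzz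
      rw [he]
      exact h.closed z q hz hq.1
    · obtain ⟨h1', h2'⟩ := hkept z' (T'.mem_nodes_right hzz) hz'M
      have hzz' := (hR.adj_iff z h1 h2 z' h1' h2').1 hzz
      rw [(hR.side_eq hab h2 h2' hzz').2]
      exact h.closed z z' hz hzz'
  · have hreachM : ∀ m ∈ M,
        Relation.ReflTransGen (fun x y => T'.graph.Adj x y ∧ st' y ≠ 3) a' m := by
      intro m hm
      have h1 := (SimpleGraph.reachable_iff_reflTransGen _ _).1
        (hR.connected.preconnected ⟨a', ha'M⟩ ⟨m, hm⟩)
      have key : ∀ z : (M : Set ℕ), Relation.ReflTransGen (T'.graph.induce (M : Set ℕ)).Adj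
          ⟨a', ha'M⟩ z →
          Relation.ReflTransGen (fun x y => T'.graph.Adj x y ∧ st' y ≠ 3) a' z := by
        intro z hz
        induction hz with
        | refl => exact .refl
        | @tail x y _ hxy ih => exact ih.tail ⟨hxy, hne3 y y.2⟩
      exact key ⟨m, hm⟩ h1
    have hreach : ∀ z, Relation.ReflTransGen (fun x y => T.graph.Adj x y ∧ st y ≠ 3) v z →
        z ∈ R ∨ Relation.ReflTransGen (fun x y => T'.graph.Adj x y ∧ st' y ≠ 3) a' z := by
      intro z hz
      induction hz with
      | refl => exact Or.inl hvR
      | @tail x y _ hxy ih =>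
        by_cases hy : y ∈ R
        · exact Or.inl hy
        right
        have hyn := T.mem_nodes_right hxy.1
        have hxn := T.mem_of_adj _ _ hxy.1
        obtain ⟨hy1, hy2⟩ := hkept' y hyn hy
        have hst : st' y ≠ 3 := by
          rw [hrep.state_kept y hy1 hy2]
          exact hxy.2
        by_cases hx : x ∈ R
        · have hyx : T.IsParent a b y x := by
            rcases isParent_total (a := a) (b := b) hxy.1 with h1 | h1
            · exact absurd (himp.parent_mem_editSet hf hab hx h1) hy
            · exact h1
          obtain ⟨m, hm, hmy⟩ := hR.exists_inserted hab hy hx hyx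
          exact (hreachM m hm).tail ⟨hmy.symm, hst⟩
        · exact (ih.resolve_left hx).tail
            ⟨(hR.adj_iff x hxn hx y hyn hy).2 hxy.1, hst⟩
    intro z hz hz3
    by_cases hzM : z ∈ M
    · exact hreachM z hzM
    · obtain ⟨h1, h2⟩ := hkept z hz hzM
      rw [hrep.state_kept z hz hzM] at hz3
      exact (hreach z (h.alive z h1 hz3)).resolve_left h2

theorem IsRepair.searchWeight_le (hR : IsReplacement T (editSet T a b c) T' M)
    (hrep : IsRepair T' M st par st' par' a' π) :
    searchWeight T' 1 st' ≤ searchWeight T 1 st + 2 * M.card := by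
  classical
  have hsub : T'.nodes ⊆ (T.nodes.filter fun z => z ∉ editSet T a b c) ∪ M := by
    intro z hz
    rw [Finset.mem_union, Finset.mem_filter]
    exact (hR.mem_nodes z).1 hz
  refine (Finset.sum_le_sum_of_subset hsub).trans ((sum_union_le_add _ _ _).trans ?_)
  refine Nat.add_le_add ?_ ?_
  · refine le_trans (Finset.sum_le_sum fun z hz => ?_)
      (Finset.sum_le_sum_of_subset (f := fun z => nodeWeight 1 (st z)) (Finset.filter_subset _ _))
    rw [Finset.mem_filter] at hz
    rw [hrep.state_kept z ((hR.mem_nodes z).2 (Or.inl hz))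
      fun hm => hz.2 (hR.mem_of_mem z hm hz.1)]
  · refine (Finset.sum_le_card_nsmul _ _ 2 fun z _ => ?_).trans (by simp [mul_comm])
    unfold nodeWeight
    split_ifs <;> omega

end Search

/-! ### Reasoning about programs -/

section Machine

variable {V : Type u} {f : Set V → ℕ} {k : ℕ} {D : RefinementDataStructure.{u, v} f k}
  {T₀ : StoredDecomposition V}

/-- The program `p`, started in `C`, halts after a number of steps and in a configuration that
satisfy `Q`. -/
def Runs (D : RefinementDataStructure.{u, v} f k) (T₀ : StoredDecomposition V) (p : Prog)
    (C : Config D) (Q : ℕ → Config D → Prop) : Prop :=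
  ∃ n C', Exec D T₀ p C n C' ∧ Q n C'

variable {C : Config D} {Q Q' : ℕ → Config D → Prop} {p q : Prog}

theorem Runs.imp (h : Runs D T₀ p C Q) (hQ : ∀ n C', Q n C' → Q' n C') : Runs D T₀ p C Q' := by
  obtain ⟨n, C', h1, h2⟩ := h
  exact ⟨n, C', h1, hQ _ _ h2⟩

@[simp] theorem runs_skip : Runs D T₀ .skip C Q ↔ Q 1 C :=
  ⟨fun ⟨_, _, h, hQ⟩ => by cases h; exact hQ, fun h => ⟨_, _, .skip _, h⟩⟩

@[simp] theorem runs_const {x m : ℕ} : Runs D T₀ (.const x m) C Q ↔ Q 1 (C.setReg x m) :=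
  ⟨fun ⟨_, _, h, hQ⟩ => by cases h; exact hQ, fun h => ⟨_, _, .const .., h⟩⟩

@[simp] theorem runs_copy {x y : ℕ} : Runs D T₀ (.copy x y) C Q ↔ Q 1 (C.setReg x (C.reg y)) :=
  ⟨fun ⟨_, _, h, hQ⟩ => by cases h; exact hQ, fun h => ⟨_, _, .copy .., h⟩⟩

@[simp] theorem runs_add {x y z : ℕ} :
    Runs D T₀ (.add x y z) C Q ↔ Q 1 (C.setReg x (C.reg y + C.reg z)) :=
  ⟨fun ⟨_, _, h, hQ⟩ => by cases h; exact hQ, fun h => ⟨_, _, .add .., h⟩⟩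

@[simp] theorem runs_load {x A y : ℕ} :
    Runs D T₀ (.load x A y) C Q ↔ Q 1 (C.setReg x (C.arr A (C.reg y))) :=
  ⟨fun ⟨_, _, h, hQ⟩ => by cases h; exact hQ, fun h => ⟨_, _, .load .., h⟩⟩

@[simp] theorem runs_store {A x y : ℕ} : Runs D T₀ (.store A x y) C Q ↔
    Q 1 (C.setArr A (Function.update (C.arr A) (C.reg x) (C.reg y))) :=
  ⟨fun ⟨_, _, h, hQ⟩ => by cases h; exact hQ, fun h => ⟨_, _, .store .., h⟩⟩

@[simp] theorem runs_degree {x y : ℕ} :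
    Runs D T₀ (.degree x y) C Q ↔ Q 1 (C.setReg x (C.nbrs T₀ (C.reg y)).length) :=
  ⟨fun ⟨_, _, h, hQ⟩ => by cases h; exact hQ, fun h => ⟨_, _, .degree .., h⟩⟩

@[simp] theorem runs_neighbor {x y z : ℕ} : Runs D T₀ (.neighbor x y z) C Q ↔
    Q 1 (C.setReg x ((C.nbrs T₀ (C.reg y)).getD (C.reg z) 0)) :=
  ⟨fun ⟨_, _, h, hQ⟩ => by cases h; exact hQ, fun h => ⟨_, _, .neighbor .., h⟩⟩

@[simp] theorem runs_conclude :
    Runs D T₀ .conclude C Q ↔ Q 1 (C.setOut .twoApproximation) :=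
  ⟨fun ⟨_, _, h, hQ⟩ => by cases h; exact hQ, fun h => ⟨_, _, .conclude _, h⟩⟩

@[simp] theorem runs_seq : Runs D T₀ (.seq p q) C Q ↔
    Runs D T₀ p C fun n C' => Runs D T₀ q C' fun n' C'' => Q (n + n') C'' := by
  constructor
  · rintro ⟨_, _, h, hQ⟩
    cases h with
    | seq h1 h2 => exact ⟨_, _, h1, _, _, h2, hQ⟩
  · rintro ⟨_, _, h1, _, _, h2, hQ⟩
    exact ⟨_, _, .seq h1 h2, hQ⟩

theorem runs_cond_pos {b : Test} (hb : b.Holds C.reg)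
    (h : Runs D T₀ p C fun n C' => Q (n + 1) C') : Runs D T₀ (.cond b p q) C Q := by
  obtain ⟨_, _, h, hQ⟩ := h
  exact ⟨_, _, .condTrue hb h, hQ⟩

theorem runs_cond_neg {b : Test} (hb : ¬ b.Holds C.reg)
    (h : Runs D T₀ q C fun n C' => Q (n + 1) C') : Runs D T₀ (.cond b p q) C Q := by
  obtain ⟨_, _, h, hQ⟩ := h
  exact ⟨_, _, .condFalse hb h, hQ⟩

/-- A loop with invariant `I` that also bounds the remaining running time. -/
theorem runs_loop {b : Test} (I : ℕ → Config D → Prop)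
    (hstep : ∀ m C, I m C → b.Holds C.reg →
      Runs D T₀ p C fun n C' => ∃ m', I m' C' ∧ n + 1 + m' ≤ m)
    {m : ℕ} (h : I m C) :
    Runs D T₀ (.loop b p) C fun n C' => ∃ m', I m' C' ∧ ¬ b.Holds C'.reg ∧ n + m' ≤ m + 1 := by
  induction m using Nat.strong_induction_on generalizing C with
  | _ m ih =>
    by_cases hb : b.Holds C.reg
    · obtain ⟨n₁, C₁, h1, m', hI, hm'⟩ := hstep m C h hb
      obtain ⟨n₂, C₂, h2, m'', hI', hb', hm''⟩ := ih m' (by omega) hI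
      exact ⟨_, _, .loopTrue hb h1 h2, m'', hI', hb', by omega⟩
    · exact ⟨_, _, .loopFalse hb, m, h, hb, by omega⟩

/-- A loop in which the register `x` runs from 0 to the value `N` of the register `y`. -/
theorem runs_for {x y N cost : ℕ} (J : ℕ → Config D → Prop)
    (hJ : ∀ i C, J i C → C.reg x = i ∧ C.reg y = N)
    (hstep : ∀ i < N, ∀ C, J i C → Runs D T₀ p C fun n C' => J (i + 1) C' ∧ n ≤ cost)
    (h : J 0 C) :
    Runs D T₀ (.loop (.lt x y) p) C fun n C' => J N C' ∧ n ≤ N * (cost + 1) + 1 := by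
  refine (runs_loop (fun m C => ∃ i ≤ N, J i C ∧ m = (N - i) * (cost + 1)) ?_
    ⟨0, Nat.zero_le _, h, rfl⟩).imp ?_
  · rintro m C ⟨i, hi, hC, rfl⟩ hb
    have hb' : C.reg x < C.reg y := hb
    obtain ⟨h1, h2⟩ := hJ i C hC
    have hiN : i < N := by omega
    refine (hstep i hiN C hC).imp ?_
    rintro n C' ⟨h3, h4⟩
    refine ⟨_, ⟨i + 1, hiN, h3, rfl⟩, ?_⟩
    have : N - i = (N - (i + 1)) + 1 := by omega
    rw [this, Nat.succ_mul]
    omega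
  · rintro n C' ⟨m', ⟨i, hi, hC, rfl⟩, hb, hn⟩
    have hb' : ¬ C'.reg x < C'.reg y := hb
    obtain ⟨h1, h2⟩ := hJ i C' hC
    have hiN : i = N := by omega
    subst hiN
    refine ⟨hC, ?_⟩
    simp only [Nat.sub_zero] at hn
    omega

/-! The components of configurations after assignments. -/

@[simp] theorem reg_setReg {x m : ℕ} : (C.setReg x m).reg = Function.update C.reg x m := rfl
@[simp] theorem arr_setReg {x m : ℕ} : (C.setReg x m).arr = C.arr := rfl
@[simp] theorem ds_setReg {x m : ℕ} : (C.setReg x m).ds = C.ds := rfl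
@[simp] theorem out_setReg {x m : ℕ} : (C.setReg x m).out = C.out := rfl
@[simp] theorem reg_setArr {A : ℕ} {g : ℕ → ℕ} : (C.setArr A g).reg = C.reg := rfl
@[simp] theorem arr_setArr {A : ℕ} {g : ℕ → ℕ} :
    (C.setArr A g).arr = Function.update C.arr A g := rfl
@[simp] theorem reg_setDS {s : D.State} : (C.setDS s).reg = C.reg := rfl
@[simp] theorem arr_setDS {s : D.State} : (C.setDS s).arr = C.arr := rfl
@[simp] theorem out_setDS {s : D.State} : (C.setDS s).out = C.out := rfl
@[simp] theorem reg_setOut {o : Answer V} : (C.setOut o).reg = C.reg := rfl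

theorem nbrs_of_ds {s : D.State} (h : C.ds = some s) : C.nbrs T₀ = (D.tree s).nbrs := by
  unfold Config.nbrs
  rw [h]

theorem nbrs_congr {C C' : Config D} (h : C'.ds = C.ds) : C'.nbrs T₀ = C.nbrs T₀ := by
  unfold Config.nbrs
  rw [h]


/-! ### Loops over the neighbours of a node -/

/-- For all neighbours of the node in the register `v`, put the neighbour into the register 14 and
run `body`. The registers 12 and 13 hold the index of the next neighbour and the degree. In all parts
of the program, the registers 2, 3 and 4 hold the constants 0, 1 and 2. -/
def forNeighbors (v : ℕ) (body : Prog) : Prog :=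
  .seq (.degree 13 v) <| .seq (.const 12 0) <|
    .loop (.lt 12 13) <| .seq (.neighbor 14 v 12) <| .seq (.add 12 12 3) body

theorem runs_forNeighbors {v cost : ℕ} {L : List ℕ} (hv : v ≠ 12 ∧ v ≠ 13 ∧ v ≠ 14)
    (J : ℕ → Config D → Prop)
    (hJ : ∀ i C, J i C → C.nbrs T₀ (C.reg v) = L ∧ C.reg 3 = 1)
    (hset : ∀ i C x m, x = 12 ∨ x = 13 ∨ x = 14 → J i C → J i (C.setReg x m))
    (hstep : ∀ (i : ℕ) (hi : i < L.length), ∀ C, J i C → C.reg 14 = L[i] →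
      Runs D T₀ p C fun n C' => J (i + 1) C' ∧ C'.reg 12 = C.reg 12 ∧ C'.reg 13 = C.reg 13 ∧
        n ≤ cost)
    (h : J 0 C) :
    Runs D T₀ (forNeighbors v p) C fun n C' => J L.length C' ∧
      n ≤ L.length * (cost + 3) + 3 := by
  obtain ⟨hv1, hv2, hv3⟩ := hv
  simp only [forNeighbors, runs_seq, runs_degree, runs_const]
  have hL := (hJ 0 C h).1
  refine (runs_for (J := fun i C => J i C ∧ C.reg 12 = i ∧ C.reg 13 = L.length)
    (N := L.length) (cost := cost + 2) (fun i C h => h.2) ?_ ?_).imp ?_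
  · rintro i hi C ⟨h1, h2, h3⟩
    simp only [runs_seq, runs_neighbor, runs_add]
    have h4 := hset i _ 12 (i + 1) (Or.inl rfl) (hset i C 14 L[i] (Or.inr (Or.inr rfl)) h1)
    obtain ⟨h5, h6⟩ := hJ i C h1
    have e : ((C.setReg 14 ((C.nbrs T₀ (C.reg v)).getD (C.reg 12) 0)).setReg 12
        ((C.setReg 14 ((C.nbrs T₀ (C.reg v)).getD (C.reg 12) 0)).reg 12 +
          (C.setReg 14 ((C.nbrs T₀ (C.reg v)).getD (C.reg 12) 0)).reg 3)) =
        (C.setReg 14 L[i]).setReg 12 (i + 1) := by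
      simp [h5, h2, h6, hi]
    rw [e]
    refine (hstep i hi _ h4 (by simp)).imp ?_
    rintro n C' ⟨h7, h8, h9, h10⟩
    refine ⟨⟨h7, ?_, ?_⟩, by omega⟩
    · rw [h8]
      simp
    · rw [h9]
      simpa using h3
  · refine ⟨hset _ _ _ _ (Or.inl rfl) (hset _ _ _ _ (Or.inr (Or.inl rfl)) h), by simp, ?_⟩
    simp [hL]
  · rintro n C' ⟨⟨h1, _⟩, h2⟩
    have : L.length * (cost + 2 + 1) = L.length * (cost + 3) := rfl
    exact ⟨h1, by omega⟩

/-- Look for an unseen neighbour of the current node in register 0. Register 5 holds the state of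
unseen nodes; the answer is in the registers 10 and 11. -/
def scanProg : Prog :=
  .seq (.const 11 0) <| forNeighbors 0 <| .seq (.load 15 0 14) <|
    .cond (.eq 15 5) (.seq (.copy 10 14) (.const 11 1)) .skip

/-- The configuration `C'` differs from `C` at most in the registers from 10 on. -/
structure SameUpTo (C C' : Config D) : Prop where
  arr : C'.arr = C.arr
  ds : C'.ds = C.ds
  out : C'.out = C.out
  reg : ∀ r < 10, C'.reg r = C.reg r

theorem SameUpTo.setReg {C C' : Config D} (h : SameUpTo C C') {x m : ℕ} (hx : 10 ≤ x) :
    SameUpTo C (C'.setReg x m) := by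
  refine ⟨h.arr, h.ds, h.out, fun r hr => ?_⟩
  rw [reg_setReg, Function.update_of_ne (by omega), h.reg r hr]

theorem runs_scanProg {L : List ℕ} (hL : C.nbrs T₀ (C.reg 0) = L) (h3 : C.reg 3 = 1)
    (hlen : L.length ≤ 3) :
    Runs D T₀ scanProg C fun n C' => SameUpTo C C' ∧ n ≤ 30 ∧
      ((C'.reg 11 = 1 ∧ C'.reg 10 ∈ L ∧ C.arr 0 (C'.reg 10) = C.reg 5) ∨
        (C'.reg 11 = 0 ∧ ∀ w ∈ L, C.arr 0 w ≠ C.reg 5)) := by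
  simp only [scanProg, runs_seq, runs_const]
  refine (runs_forNeighbors (L := L) (cost := 5) (by simp)
    (fun i C' => SameUpTo C C' ∧
      ((C'.reg 11 = 1 ∧ C'.reg 10 ∈ L ∧ C.arr 0 (C'.reg 10) = C.reg 5) ∨
        (C'.reg 11 = 0 ∧ ∀ j (hj : j < L.length), j < i → C.arr 0 L[j] ≠ C.reg 5)))
    ?_ ?_ ?_ ?_).imp ?_
  · rintro i C' ⟨h, _⟩
    rw [nbrs_congr h.ds, h.reg 0 (by norm_num), h.reg 3 (by norm_num)]
    exact ⟨hL, h3⟩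
  · rintro i C' x m hx ⟨h1, h2⟩
    refine ⟨h1.setReg (by omega), ?_⟩
    have e1 : (C'.setReg x m).reg 11 = C'.reg 11 := by
      rw [reg_setReg, Function.update_of_ne (by omega)]
    have e2 : (C'.setReg x m).reg 10 = C'.reg 10 := by
      rw [reg_setReg, Function.update_of_ne (by omega)]
    rwa [e1, e2]
  · rintro i hi C' ⟨h1, h2⟩ h14
    simp only [runs_seq, runs_load]
    by_cases hU : C'.arr 0 (C'.reg 14) = C'.reg 5
    · refine runs_cond_pos (by simpa [Test.Holds] using hU) ?_
      simp only [runs_seq, runs_copy, runs_const]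
      refine ⟨⟨((h1.setReg (by norm_num)).setReg (by norm_num)).setReg (by norm_num), Or.inl ?_⟩,
        by simp, by simp, by norm_num⟩
      rw [h1.arr, h1.reg 5 (by norm_num)] at hU
      refine ⟨by simp, ?_, by simpa using hU⟩
      simp [h14]
    · refine runs_cond_neg (by simpa [Test.Holds] using hU) ?_
      simp only [runs_skip]
      refine ⟨⟨h1.setReg (by norm_num), ?_⟩, by simp, by simp, by norm_num⟩
      rcases h2 with h2 | ⟨h2, h4⟩
      · exact Or.inl (by simpa using h2)
      · refine Or.inr ⟨by simpa using h2, fun j hj hji => ?_⟩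
        by_cases hj' : j = i
        · subst hj'
          rw [h1.arr, h1.reg 5 (by norm_num), h14] at hU
          exact hU
        · exact h4 j hj (by omega)
  · refine ⟨⟨rfl, rfl, rfl, fun r hr => ?_⟩, Or.inr ⟨by simp, by simp⟩⟩
    rw [reg_setReg, Function.update_of_ne (by omega)]
  · rintro n C' ⟨⟨h1, h2⟩, h4⟩
    refine ⟨h1, ?_, ?_⟩
    · have : L.length * (5 + 3) ≤ 3 * 8 := Nat.mul_le_mul hlen le_rfl
      omega
    · rcases h2 with h2 | ⟨h2, h3⟩
      · exact Or.inl h2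
      · refine Or.inr ⟨h2, fun w hw => ?_⟩
        obtain ⟨j, hj, rfl⟩ := List.getElem_of_mem hw
        exact h3 j hj hj

end Machine

/-! ### Repairing the memory after a refinement -/

section Repair

variable {V : Type u} {f : Set V → ℕ} {k : ℕ} {D : RefinementDataStructure.{u, v} f k}
  {T₀ : StoredDecomposition V} {C : Config D} {s : D.State} {T' : BranchDecomposition V}
  {M : Finset ℕ} {st par : ℕ → ℕ} {a' : ℕ}

/-- Process a neighbour in register 14 of the node at the position in register 18 of the queue
(array 2): append it to the queue if it is a new node (state 0), and remember it in register 20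
together with the position in register 21 if it is on the stack (state 2). Array 3 holds for each
position the position of the predecessor. -/
def bfsBody : Prog :=
  .seq (.load 15 0 14) <| .cond (.eq 15 2)
    (.seq (.store 0 14 3) <| .seq (.store 2 19 14) <| .seq (.store 3 19 18) (.add 19 19 3))
    (.cond (.eq 15 4) (.seq (.copy 20 14) (.copy 21 18)) .skip)

/-- Breadth-first search through the new nodes. -/
def bfsProg : Prog :=
  .loop (.lt 18 19) <| .seq (.load 22 2 18) <| .seq (forNeighbors 22 bfsBody) (.add 18 18 3)

/-- Follow the predecessors from the position in register 21 to the start of the search, put the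
nodes on the stack and make each of them point to the one before. -/
def traceProg : Prog :=
  .loop (.lt 2 21) <| .seq (.load 14 2 21) <| .seq (.store 1 14 20) <| .seq (.store 0 14 4) <|
    .seq (.copy 20 14) (.load 21 3 21)

/-- Restore the memory after a refinement, for the search to continue at the node in register 0. -/
def repairProg : Prog :=
  .seq (.store 2 2 0) <| .seq (.store 0 0 3) <| .seq (.const 18 0) <| .seq (.const 19 1) <|
    .seq (.copy 20 0) <| .seq (.const 21 0) <| .seq bfsProg <| .seq traceProg <|
    .seq (.store 1 0 20) (.store 0 0 4)

/-- The registers that hold constants. -/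
structure HasConsts (C : Config D) : Prop where
  zero : C.reg 2 = 0
  one : C.reg 3 = 1
  two : C.reg 4 = 2

/-- The assumptions of the repair: the state is 0 for inserted nodes, and not 0 for kept ones. -/
structure NeedsRepair (T' : BranchDecomposition V) (M : Finset ℕ) (st : ℕ → ℕ) (a' : ℕ) :
    Prop where
  start_mem : a' ∈ M
  subset : ∀ z ∈ M, z ∈ T'.nodes
  connected : (T'.graph.induce (M : Set ℕ)).Connected
  zero : ∀ z, z ∈ M ∨ z ∉ T'.nodes → st z = 0
  ne_zero : ∀ z ∈ T'.nodes, z ∉ M → st z ≠ 0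

/-- The invariant of the breadth-first search, started at `a'` in `C₀`, when the nodes with `P` have
been looked at. The queue holds the positions below register 19; `found` tells what is known about
kept nodes on the stack. -/
structure IsBfs (T' : BranchDecomposition V) (M : Finset ℕ) (st par : ℕ → ℕ) (a' : ℕ)
    (P : ℕ → Prop) (C₀ C : Config D) : Prop where
  ds : C.ds = C₀.ds
  out : C.out = C₀.out
  reg : ∀ r < 10, C.reg r = C₀.reg r
  pos : 0 < C.reg 19
  le : C.reg 18 ≤ C.reg 19
  mem : ∀ i < C.reg 19, C.arr 2 i ∈ M
  inj : ∀ i < C.reg 19, ∀ j < C.reg 19, C.arr 2 i = C.arr 2 j → i = j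
  start : C.arr 2 0 = a'
  state_mem : ∀ i < C.reg 19, C.arr 0 (C.arr 2 i) = 1
  state_of_notMem : ∀ z, (∀ i < C.reg 19, C.arr 2 i ≠ z) → C.arr 0 z = st z
  par_eq : C.arr 1 = par
  pred : ∀ j < C.reg 19, 0 < j →
    C.arr 3 j < j ∧ T'.graph.Adj (C.arr 2 j) (C.arr 2 (C.arr 3 j))
  processed : ∀ y, P y → y ∈ M → ∃ j < C.reg 19, C.arr 2 j = y
  found : (C.reg 20 = a' ∧ C.reg 21 = 0 ∧ ∀ y, P y → y ∉ M → st y ≠ 2) ∨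
    (C.reg 21 < C.reg 19 ∧ C.reg 20 ∈ T'.nodes ∧ C.reg 20 ∉ M ∧ st (C.reg 20) = 2 ∧
      T'.graph.Adj (C.arr 2 (C.reg 21)) (C.reg 20))

theorem IsBfs.setReg {P : ℕ → Prop} {C₀ : Config D} (h : IsBfs T' M st par a' P C₀ C) {x m : ℕ}
    (hx : (10 ≤ x ∧ x < 18) ∨ x = 22) : IsBfs T' M st par a' P C₀ (C.setReg x m) := by
  have e : ∀ r, r < 10 ∨ r = 18 ∨ r = 19 ∨ r = 20 ∨ r = 21 → (C.setReg x m).reg r = C.reg r := by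
    intro r hr
    rw [reg_setReg, Function.update_of_ne (by omega)]
  obtain ⟨h1, h2, h3, h4, h5, h6, h7, h8, h9, h10, h11, h12, h13, h14⟩ := h
  rw [← e 19 (by simp)] at h4 h5 h6 h7 h9 h10 h12 h13 h14
  rw [← e 18 (by simp)] at h5
  rw [← e 20 (by simp), ← e 21 (by simp)] at h14
  exact ⟨h1, h2, fun r hr => (e r (Or.inl hr)).trans (h3 r hr), h4, h5, h6, h7, h8, h9, h10, h11,
    h12, h13, h14⟩

theorem StoredDecomposition.length_nbrs_le (T : StoredDecomposition V) {x : ℕ} (hx : x ∈ T.nodes) :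
    (T.nbrs x).length ≤ 3 := by
  have h1 : (T.nbrs x).length = (T.graph.neighborSet x).ncard := by
    rw [← List.toFinset_card_of_nodup (T.nbrs_nodup x hx), ← Set.ncard_coe_finset]
    congr 1
    ext y
    simp [T.mem_nbrs x hx]
  rcases T.cubic x hx with h2 | h2 <;> omega

theorem runs_bfsBody {P : ℕ → Prop} {C₀ : Config D} (hs : NeedsRepair T' M st a')
    (hc : HasConsts C₀) (h : IsBfs T' M st par a' P C₀ C) (hlt : C.reg 18 < C.reg 19) {y : ℕ}
    (hy : C.reg 14 = y) (hadj : T'.graph.Adj (C.arr 2 (C.reg 18)) y) :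
    Runs D T₀ bfsBody C fun n C' => IsBfs T' M st par a' (fun z => P z ∨ z = y) C₀ C' ∧
      C'.reg 12 = C.reg 12 ∧ C'.reg 13 = C.reg 13 ∧ C'.reg 18 = C.reg 18 ∧
      C'.reg 22 = C.reg 22 ∧ C.reg 19 ≤ C'.reg 19 ∧
      (∀ i < C.reg 19, C'.arr 2 i = C.arr 2 i) ∧ n ≤ 7 := by
  have hyn := T'.mem_nodes_right hadj
  have c2 : C.reg 2 = 0 := (h.reg 2 (by norm_num)).trans hc.zero
  have c3 : C.reg 3 = 1 := (h.reg 3 (by norm_num)).trans hc.one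
  have c4 : C.reg 4 = 2 := (h.reg 4 (by norm_num)).trans hc.two
  simp only [bfsBody, runs_seq, runs_load]
  by_cases h0 : C.arr 0 y = 0
  · refine runs_cond_pos (by simpa [Test.Holds, hy, c2] using h0) ?_
    simp only [runs_seq, runs_store, runs_add]
    have hyX : ∀ i < C.reg 19, C.arr 2 i ≠ y := by
      rintro i hi rfl
      have := h.state_mem i hi
      omega
    have hyM : y ∈ M := by
      by_contra hyM
      rw [h.state_of_notMem y hyX] at h0
      exact hs.ne_zero y hyn hyM h0
    refine ⟨?_, by simp, by simp, by simp, by simp, by simp [c3], ?_, by norm_num⟩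
    · have hq : ∀ i < C.reg 19, (if i = C.reg 19 then y else C.arr 2 i) = C.arr 2 i :=
        fun i hi => if_neg hi.ne
      refine ⟨h.ds, h.out, fun r hr => ?_, ?_, ?_, ?_, ?_, ?_, ?_, ?_, ?_, ?_, ?_, ?_⟩
      · simp only [reg_setReg, reg_setArr]
        rw [Function.update_of_ne (by omega), Function.update_of_ne (by omega), h.reg r hr]
      all_goals simp only [reg_setReg, reg_setArr, arr_setReg, arr_setArr, ne_eq,
        Nat.reduceEqDiff, not_false_eq_true, Function.update_of_ne, Function.update_self,
        Function.update_apply, c3, hy, OfNat.ofNat_ne_zero, OfNat.zero_ne_ofNat,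
        OfNat.one_ne_ofNat, one_ne_zero]
      · omega
      · omega
      · intro i hi
        split_ifs with hi'
        · exact hyM
        · exact h.mem i (by omega)
      · intro i hi j hj
        split_ifs with hi' hj' hj'
        · omega
        · exact fun he => absurd he.symm (hyX j (by omega))
        · exact fun he => absurd he (hyX i (by omega))
        · exact h.inj i (by omega) j (by omega)
      · rw [if_neg h.pos.ne]
        exact h.start
      · intro i hi
        by_cases hi' : i = C.reg 19
        · simp [hi']
        · rw [if_neg hi', h.state_mem i (by omega)]
          simp
      · intro z hz
        have hzy : z ≠ y := by
          have := hz (C.reg 19) (by omega)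
          rw [if_pos rfl] at this
          exact fun he => this he.symm
        rw [if_neg hzy]
        refine h.state_of_notMem z fun i hi => ?_
        have := hz i (by omega)
        rwa [hq i hi] at this
      · exact h.par_eq
      · intro j hj hj0
        by_cases hj' : j = C.reg 19
        · rw [if_pos hj', if_pos hj', hq _ hlt]
          exact ⟨by omega, hadj.symm⟩
        · rw [if_neg hj', if_neg hj']
          obtain ⟨h1, h2⟩ := h.pred j (by omega) hj0
          rw [if_neg (by omega)]
          exact ⟨h1, h2⟩
      · rintro z (hz | rfl) hzM
        · obtain ⟨j, hj, he⟩ := h.processed z hz hzM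
          exact ⟨j, by omega, by rw [hq j hj]; exact he⟩
        · exact ⟨C.reg 19, by omega, if_pos rfl⟩
      · rcases h.found with ⟨h1, h2, h3⟩ | ⟨h1, h2⟩
        · refine Or.inl ⟨h1, h2, ?_⟩
          rintro z (hz | rfl) hzM
          · exact h3 z hz hzM
          · exact absurd hyM hzM
        · refine Or.inr ⟨by omega, ?_⟩
          rw [hq _ h1]
          exact h2
    · intro i hi
      simp [hi.ne]
  · refine runs_cond_neg (by simpa [Test.Holds, hy, c2] using h0) ?_
    have hproc : y ∈ M → ∃ j < C.reg 19, C.arr 2 j = y := by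
      intro hyM
      by_contra hcon
      push Not at hcon
      exact h0 ((h.state_of_notMem y hcon).trans (hs.zero y (Or.inl hyM)))
    by_cases h2 : C.arr 0 y = 2
    · have hyX : ∀ i < C.reg 19, C.arr 2 i ≠ y := by
        rintro i hi rfl
        have := h.state_mem i hi
        omega
      have hyM : y ∉ M := fun hyM => by
        obtain ⟨j, hj, he⟩ := hproc hyM
        exact hyX j hj he
      have hst : st y = 2 := (h.state_of_notMem y hyX).symm.trans h2
      refine runs_cond_pos (by simpa [Test.Holds, hy, c4] using h2) ?_
      simp only [runs_seq, runs_copy]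
      refine ⟨?_, by simp, by simp, by simp, by simp, by simp, by simp, by norm_num⟩
      refine ⟨h.ds, h.out, fun r hr => ?_, ?_, ?_, ?_, ?_, h.start, ?_, ?_, h.par_eq, ?_, ?_, ?_⟩
      · simp only [reg_setReg]
        rw [Function.update_of_ne (by omega), Function.update_of_ne (by omega),
          Function.update_of_ne (by omega), h.reg r hr]
      · simpa using h.pos
      · simpa using h.le
      · simpa using h.mem
      · simpa using h.inj
      · simpa using h.state_mem
      · simpa using h.state_of_notMem
      · simpa using h.pred
      · rintro z (hz | rfl) hzM
        · simpa using h.processed z hz hzM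
        · exact absurd hzM hyM
      · right
        simpa [hy, hst, hyM, hyn, hadj] using hlt
    · refine runs_cond_neg (by simpa [Test.Holds, hy, c4] using h2) ?_
      simp only [runs_skip]
      refine ⟨?_, by simp, by simp, by simp, by simp, by simp, by simp, by norm_num⟩
      have h' := h.setReg (x := 15) (m := C.arr 0 (C.reg 14)) (Or.inl (by norm_num))
      refine { h' with processed := ?_, found := ?_ }
      · rintro z (hz | rfl) hzM
        · exact h'.processed z hz hzM
        · exact hproc hzM
      · refine h'.found.imp (fun h => ⟨h.1, h.2.1, ?_⟩) id
        rintro z (hz | rfl) hzM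
        · exact h.2.2 z hz hzM
        · have hyX : ∀ i < C.reg 19, C.arr 2 i ≠ z := fun i hi he => hzM (he ▸ h'.mem i hi)
          have := (h'.state_of_notMem z hyX)
          exact fun h => h2 (this.trans h)

/-- The breadth-first search visits all inserted nodes, and their kept neighbours. -/
theorem runs_bfsProg {C₀ : Config D} (hds : C₀.ds = some s)
    (hT' : (D.tree s).toBranchDecomposition = T') (hs : NeedsRepair T' M st a')
    (hc : HasConsts C₀) (h : IsBfs T' M st par a' (fun _ => False) C₀ C) (h18 : C.reg 18 = 0) :
    Runs D T₀ bfsProg C fun n C' =>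
      IsBfs T' M st par a' (fun y => ∃ x ∈ M, T'.graph.Adj x y) C₀ C' ∧
      (∀ m ∈ M, ∃ i < C'.reg 19, C'.arr 2 i = m) ∧ C'.reg 19 ≤ M.card ∧ n ≤ 40 * M.card + 1 := by
  have hcard : ∀ {P : ℕ → Prop} {C : Config D}, IsBfs T' M st par a' P C₀ C →
      C.reg 19 ≤ M.card := by
    intro P C h
    have h1 : ((Finset.range (C.reg 19)).image (C.arr 2)).card = C.reg 19 := by
      rw [Finset.card_image_of_injOn, Finset.card_range]
      intro i hi j hj he
      exact h.inj i (by simpa using hi) j (by simpa using hj) he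
    rw [← h1]
    refine Finset.card_le_card fun z hz => ?_
    obtain ⟨i, hi, rfl⟩ := Finset.mem_image.1 hz
    exact h.mem i (by simpa using hi)
  refine (runs_loop (fun m C => IsBfs T' M st par a'
    (fun y => ∃ i < C.reg 18, T'.graph.Adj (C.arr 2 i) y) C₀ C ∧
    m = 40 * (M.card - C.reg 18)) ?_ ⟨?_, rfl⟩).imp ?_
  · rintro m C ⟨h, rfl⟩ hb
    have hlt : C.reg 18 < C.reg 19 := hb
    simp only [runs_seq, runs_load]
    set x := C.arr 2 (C.reg 18) with hx
    have hxM : x ∈ M := h.mem _ hlt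
    have hxn := hs.subset x hxM
    set L := (D.tree s).nbrs x with hLdef
    have hmemL : ∀ y, y ∈ L ↔ T'.graph.Adj x y := by
      intro y
      rw [hLdef, (D.tree s).mem_nbrs x (by rw [hT']; exact hxn), hT']
    have hlen : L.length ≤ 3 := (D.tree s).length_nbrs_le (by rw [hT']; exact hxn)
    refine (runs_forNeighbors (L := L) (cost := 7) (by norm_num) (fun i C' =>
      IsBfs T' M st par a' (fun y => (∃ i < C.reg 18, T'.graph.Adj (C.arr 2 i) y) ∨
        ∃ j, ∃ hj : j < L.length, j < i ∧ y = L[j]) C₀ C' ∧ C'.reg 18 = C.reg 18 ∧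
      C'.reg 22 = x ∧ C.reg 19 ≤ C'.reg 19 ∧ ∀ i < C.reg 19, C'.arr 2 i = C.arr 2 i)
      ?_ ?_ ?_ ?_).imp ?_
    · rintro i C' ⟨h1, h2, h3, _⟩
      have e : C'.ds = some s := h1.ds.trans hds
      rw [nbrs_of_ds e, h3, h1.reg 3 (by norm_num)]
      exact ⟨rfl, hc.one⟩
    · rintro i C' y m hy ⟨h1, h2, h3, h4, h5⟩
      refine ⟨h1.setReg (by omega), ?_, ?_, ?_, h5⟩ <;>
      · rw [reg_setReg, Function.update_of_ne (by omega)]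
        assumption
    · rintro i hi C' ⟨h1, h2, h3, h4, h5⟩ h14
      have hadj : T'.graph.Adj (C'.arr 2 (C'.reg 18)) L[i] := by
        rw [h2, h5 _ hlt]
        exact (hmemL _).1 (List.getElem_mem hi)
      refine (runs_bfsBody hs hc h1 (by omega) h14 hadj).imp ?_
      rintro n C'' ⟨g1, g2, g3, g4, g5, g6, g7, g8⟩
      refine ⟨⟨?_, by omega, by omega, by omega, fun j hj => ?_⟩, g2, g3, g8⟩
      · refine { g1 with processed := fun y hy hyM => g1.processed y ?_ hyM
                         found := g1.found.imp (fun h => ⟨h.1, h.2.1, fun y hy => h.2.2 y ?_⟩) id }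
        all_goals
          rcases hy with hy | ⟨j, hj, hji, rfl⟩
          · exact Or.inl (Or.inl hy)
          · by_cases hji' : j = i
            · subst hji'
              exact Or.inr rfl
            · exact Or.inl (Or.inr ⟨j, hj, by omega, rfl⟩)
      · rw [g7 j (by omega), h5 j hj]
    · refine ⟨?_, by simp, by simp [hx], by simp, by simp⟩
      have h' := h.setReg (x := 22) (m := C.arr 2 (C.reg 18)) (Or.inr rfl)
      refine { h' with processed := fun y hy hyM => h'.processed y ?_ hyM
                       found := h'.found.imp (fun h => ⟨h.1, h.2.1, fun y hy => h.2.2 y ?_⟩) id }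
      all_goals
        rcases hy with hy | ⟨j, hj, hji, _⟩
        · exact hy
        · omega
    · rintro n C' ⟨⟨h1, h2, h3, h4, h5⟩, hn⟩
      simp only [runs_add]
      have c3 : C'.reg 3 = 1 := (h1.reg 3 (by norm_num)).trans hc.one
      refine ⟨_, ⟨?_, rfl⟩, ?_⟩
      · have hP : ∀ y, (∃ i < C.reg 18 + 1, T'.graph.Adj (C'.arr 2 i) y) →
            (∃ i < C.reg 18, T'.graph.Adj (C.arr 2 i) y) ∨
            ∃ j, ∃ hj : j < L.length, j < L.length ∧ y = L[j] := by
          rintro y ⟨i, hi, hy⟩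
          rw [h5 i (by omega)] at hy
          by_cases hi' : i = C.reg 18
          · subst hi'
            obtain ⟨j, hj, he⟩ := List.getElem_of_mem ((hmemL y).2 hy)
            exact Or.inr ⟨j, hj, hj, he.symm⟩
          · exact Or.inl ⟨i, by omega, hy⟩
        obtain ⟨g1, g2, g3, g4, g5, g6, g7, g8, g9, g10, g11, g12, g13, g14⟩ := h1
        refine ⟨g1, g2, fun r hr => ?_, by simpa using g4, ?_, by simpa using g6,
          by simpa using g7, g8, by simpa using g9, by simpa using g10, g11, by simpa using g12,
          fun y hy hyM => ?_, ?_⟩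
        · rw [reg_setReg, Function.update_of_ne (by omega), g3 r hr]
        · simp only [reg_setReg, Function.update_self, c3, ne_eq, Nat.reduceEqDiff,
            not_false_eq_true, Function.update_of_ne]
          omega
        · have := g13 y (hP y (by simpa [h2, c3] using hy)) hyM
          simpa using this
        · refine g14.imp (fun h => ⟨by simpa using h.1, by simpa using h.2.1, fun y hy =>
            h.2.2 y (hP y (by simpa [h2, c3] using hy))⟩) fun h => by simpa using h
      · have := hcard h
        have e : ((C'.setReg 18 (C'.reg 18 + C'.reg 3))).reg 18 = C.reg 18 + 1 := by
          simp [h2, c3]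
        rw [e]
        have : L.length * (7 + 3) ≤ 3 * 10 := Nat.mul_le_mul hlen le_rfl
        omega
  · refine { h with processed := ?_, found := h.found.imp (fun h => ⟨h.1, h.2.1, ?_⟩) id }
    all_goals
      rintro y ⟨i, hi, _⟩
      omega
  · rintro n C' ⟨m', ⟨h1, rfl⟩, hb, hn⟩
    have hb' : ¬ C'.reg 18 < C'.reg 19 := hb
    have heq : C'.reg 18 = C'.reg 19 := le_antisymm h1.le (not_lt.1 hb')
    -- The visited nodes are closed under adjacency in the connected set of inserted nodes.
    have hall : ∀ m ∈ M, ∃ i < C'.reg 19, C'.arr 2 i = m := by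
      intro m hm
      have key : ∀ z : (M : Set ℕ), Relation.ReflTransGen (T'.graph.induce (M : Set ℕ)).Adj
          ⟨a', hs.start_mem⟩ z → ∃ i < C'.reg 19, C'.arr 2 i = z := by
        intro z hz
        induction hz with
        | refl => exact ⟨0, h1.pos, h1.start⟩
        | @tail x y _ hxy ih =>
          obtain ⟨i, hi, he⟩ := ih
          refine h1.processed y ⟨i, by omega, ?_⟩ y.2
          rw [he]
          exact hxy
      exact key ⟨m, hm⟩ ((SimpleGraph.reachable_iff_reflTransGen _ _).1
        (hs.connected.preconnected _ _))
    refine ⟨?_, hall, hcard h1, by omega⟩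
    refine { h1 with processed := fun y _ hyM => hall y hyM
                     found := h1.found.imp (fun h => ⟨h.1, h.2.1, fun y hy => h.2.2 y ?_⟩) id }
    obtain ⟨x, hx, hxy⟩ := hy
    obtain ⟨i, hi, rfl⟩ := hall x hx
    exact ⟨i, by omega, hxy⟩

theorem IsPathTo.congr {par par' : ℕ → ℕ} {o : ℕ} {l : List ℕ} (h : IsPathTo T' par o l)
    (hp : ∀ z ∈ l, par' z = par z) : IsPathTo T' par' o l := by
  induction l with
  | nil => trivial
  | cons x l ih =>
    exact ⟨(hp x (by simp)).trans h.1, h.2.1,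
      ih h.2.2 fun z hz => hp z (List.mem_cons_of_mem _ hz)⟩

/-- The invariant when the predecessors are followed from the end of the search to its start: `l` is
the part of the path to `o` that has been found so far. -/
structure IsTrace (T' : BranchDecomposition V) (o : ℕ) (l : List ℕ) (C₁ C : Config D) : Prop where
  ds : C.ds = C₁.ds
  out : C.out = C₁.out
  reg : ∀ r < 10, C.reg r = C₁.reg r
  queue : C.arr 2 = C₁.arr 2
  pred : C.arr 3 = C₁.arr 3
  lt : C.reg 21 < C₁.reg 19
  state_eq : ∀ z, C.arr 0 z = if z ∈ l then 2 else C₁.arr 0 z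
  par_eq : ∀ z ∉ l, C.arr 1 z = C₁.arr 1 z
  path : IsPathTo T' (C.arr 1) o l
  head : C.reg 20 = l.headD o
  adj : T'.graph.Adj (C₁.arr 2 (C.reg 21)) (l.headD o)
  nodup : l.Nodup
  pos : ∀ x ∈ l, ∃ i < C₁.reg 19, C.reg 21 < i ∧ C₁.arr 2 i = x

theorem runs_traceProg {C₀ C₁ : Config D} {P : ℕ → Prop} {o : ℕ} (hc : HasConsts C₀)
    (h : IsBfs T' M st par a' P C₀ C₁) (hlt : C₁.reg 21 < C₁.reg 19) (ho : C₁.reg 20 = o)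
    (hadj : T'.graph.Adj (C₁.arr 2 (C₁.reg 21)) o) :
    Runs D T₀ traceProg C₁ fun n C' => ∃ l, IsTrace T' o l C₁ C' ∧ C'.reg 21 = 0 ∧
      n ≤ 6 * C₁.reg 19 + 1 := by
  have c2 : ∀ {l} {C : Config D}, IsTrace T' o l C₁ C → C.reg 2 = 0 := fun ht =>
    ((ht.reg 2 (by norm_num)).trans (h.reg 2 (by norm_num))).trans hc.zero
  refine (runs_loop (fun m C => (∃ l, IsTrace T' o l C₁ C) ∧ m = 6 * C.reg 21) ?_
    ⟨⟨[], rfl, rfl, fun _ _ => rfl, rfl, rfl, hlt, by simp, fun _ _ => rfl, trivial, by simpa,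
      by simpa, by simp, by simp⟩, rfl⟩).imp ?_
  · rintro m C ⟨⟨l, ht⟩, rfl⟩ hb
    have hpos : 0 < C.reg 21 := by
      have hb' : C.reg 2 < C.reg 21 := hb
      rwa [c2 ht] at hb'
    have c4 : C.reg 4 = 2 :=
      ((ht.reg 4 (by norm_num)).trans (h.reg 4 (by norm_num))).trans hc.two
    simp only [runs_seq, runs_load, runs_store, runs_copy]
    set j := C.reg 21 with hj
    set x := C₁.arr 2 j with hx
    obtain ⟨hp1, hp2⟩ := h.pred j ht.lt hpos
    have hxl : x ∉ l := fun hm => by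
      obtain ⟨i, hi, hji, he⟩ := ht.pos x hm
      have := h.inj i hi j ht.lt he
      omega
    have e : C.arr 2 j = x := by rw [ht.queue]
    refine ⟨_, ⟨⟨x :: l, ?_⟩, rfl⟩, ?_⟩
    · refine ⟨ht.ds, ht.out, fun r hr => ?_, by simpa using ht.queue, by simpa using ht.pred, ?_,
        fun z => ?_, fun z hz => ?_, ⟨?_, ht.adj, ?_⟩, ?_, ?_, List.nodup_cons.2 ⟨hxl, ht.nodup⟩,
        ?_⟩
      · simp only [reg_setReg, reg_setArr]
        rw [Function.update_of_ne (by omega), Function.update_of_ne (by omega),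
          Function.update_of_ne (by omega), ht.reg r hr]
      · have : C₁.arr 3 j < C₁.reg 19 := hp1.trans ht.lt
        simpa [ht.pred, ← hj] using this
      · have := ht.state_eq z
        by_cases hz : z = x
        · simp [hz, ← hj, e, c4]
        · simp [hz, ← hj, e, this]
      · have hzx : z ≠ x := fun he => hz (by simp [he])
        have := ht.par_eq z fun hm => hz (List.mem_cons_of_mem _ hm)
        simpa [← hj, e, hzx] using this
      · simpa [← hj, e] using ht.head
      · refine ht.path.congr fun z hz => ?_
        have hzx : z ≠ x := fun he => hxl (he ▸ hz)
        simp [← hj, e, hzx]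
      · simp [← hj, e]
      · simpa [← hj, ht.pred] using hp2.symm
      · intro z hz
        have hp : C.arr 3 j < j := by rwa [ht.pred]
        rcases List.mem_cons.1 hz with rfl | hz
        · refine ⟨j, ht.lt, ?_, rfl⟩
          simpa [← hj] using hp
        · obtain ⟨i, hi, hji, he⟩ := ht.pos z hz
          refine ⟨i, hi, ?_, he⟩
          have := hp.trans hji
          simpa [← hj] using this
    · have hp : C.arr 3 j < j := by rwa [ht.pred]
      simp [← hj]
      omega
  · rintro n C' ⟨m', ⟨⟨l, ht⟩, rfl⟩, hb, hn⟩
    have hb' : ¬ C'.reg 2 < C'.reg 21 := hb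
    rw [c2 ht] at hb'
    exact ⟨l, ht, by omega, by omega⟩

theorem runs_repairProg (hds : C.ds = some s)
    (hT' : (D.tree s).toBranchDecomposition = T') (hs : NeedsRepair T' M (C.arr 0) (C.reg 0))
    (hc : HasConsts C) :
    Runs D T₀ repairProg C fun n C' => C'.ds = C.ds ∧ C'.out = C.out ∧
      (∀ r < 10, C'.reg r = C.reg r) ∧ n ≤ 60 * M.card + 20 ∧
      ∃ π, IsRepair T' M (C.arr 0) (C.arr 1) (C'.arr 0) (C'.arr 1) (C.reg 0) π := by
  set a' := C.reg 0 with ha'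
  simp only [repairProg, runs_seq, runs_const, runs_copy, runs_store]
  refine (runs_bfsProg (M := M) (st := C.arr 0) (par := C.arr 1) (C₀ := C) (by simpa using hds) hT'
    hs hc ?_ (by simp)).imp ?_
  · refine ⟨rfl, rfl, fun r hr => ?_, by simp, by simp, ?_, ?_, ?_, ?_, ?_, by simp, ?_, by simp,
      Or.inl ⟨by simp [ha'], by simp, by simp⟩⟩
    · simp only [reg_setReg, reg_setArr]
      rw [Function.update_of_ne (by omega), Function.update_of_ne (by omega),
        Function.update_of_ne (by omega), Function.update_of_ne (by omega)]
    · simpa [hc.zero, ← ha'] using hs.start_mem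
    · simp
    · simp [hc.zero, ← ha']
    · simp [hc.zero, hc.one]
    · intro z hz
      have hz' : z ≠ a' := by
        have := hz 0 (by simp)
        simp [hc.zero, ← ha'] at this
        exact fun h => this h.symm
      simp [hz', ← ha']
    · intro j hj
      simp at hj
      omega
  rintro n C₂ ⟨h, hall, hcard, hn⟩
  have hst2 : ∀ z, C₂.arr 0 z = if z ∈ M then 1 else C.arr 0 z := by
    intro z
    split_ifs with hz
    · obtain ⟨i, hi, rfl⟩ := hall z hz
      exact h.state_mem i hi
    · exact h.state_of_notMem z fun i hi he => hz (he ▸ h.mem i hi)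
  have main : ∀ (l : List ℕ) (C₃ : Config D), C₃.arr 0 = (fun z => if z ∈ l then 2 else C₂.arr 0 z) →
      (∀ z ∉ l, C₃.arr 1 z = C.arr 1 z) → (∀ r < 10, C₃.reg r = C.reg r) → (a' :: l).Nodup →
      (∀ x ∈ l, x ∈ M) →
      ((∃ o ∈ T'.nodes, o ∉ M ∧ C.arr 0 o = 2 ∧ C₃.reg 20 = l.headD o ∧
        T'.graph.Adj a' (l.headD o) ∧ IsPathTo T' (C₃.arr 1) o l) ∨
        (l = [] ∧ C₃.reg 20 = a' ∧
          ∀ o ∈ T'.nodes, o ∉ M → C.arr 0 o = 2 → ∀ m ∈ M, ¬ T'.graph.Adj m o)) →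
      IsRepair T' M (C.arr 0) (C.arr 1) (Function.update (C₃.arr 0) a' 2)
        (Function.update (C₃.arr 1) a' (C₃.reg 20)) a' l := by
    intro l C₃ h0 h1 hr hnd hl hlink
    have hal : a' ∉ l := (List.nodup_cons.1 hnd).1
    have hnot : ∀ z ∉ M, Function.update (C₃.arr 0) a' 2 z = C.arr 0 z := by
      intro z hz
      have hza : z ≠ a' := fun he => hz (he ▸ hs.start_mem)
      rw [Function.update_of_ne hza, h0]
      simp only
      rw [if_neg fun hm => hz (hl z hm), hst2, if_neg hz]
    have hin : ∀ z ∈ M, Function.update (C₃.arr 0) a' 2 z = if z ∈ a' :: l then 2 else 1 := by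
      intro z hz
      by_cases hza : z = a'
      · simp [hza]
      · rw [Function.update_of_ne hza, h0]
        simp [hza, hst2, hz]
    refine ⟨fun z _ hz => hnot z hz, fun z hz => ?_, fun z hz => ?_, fun z => ?_, hnd,
      fun z hz => ?_, ?_⟩
    · rw [hnot z fun hm => hz (hs.subset z hm), hs.zero z (Or.inr hz)]
    · rw [hin z hz]
      split_ifs <;> simp
    · constructor
      · intro hz
        have hzM : z ∈ M := by
          rcases List.mem_cons.1 hz with rfl | hz
          · exact hs.start_mem
          · exact hl z hz
        exact ⟨hzM, by rw [hin z hzM, if_pos hz]⟩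
      · rintro ⟨hzM, hz⟩
        by_contra hcon
        rw [hin z hzM, if_neg hcon] at hz
        omega
    · have hza : z ≠ a' := fun he => hz (he ▸ hs.start_mem)
      rw [Function.update_of_ne hza, h1 z fun hm => hz (hl z hm)]
    · rcases hlink with ⟨o, ho, hoM, ho2, h20, hadj, hpath⟩ | ⟨rfl, h20, hno⟩
      · refine Or.inl ⟨o, ho, hoM, ho2, ?_, hadj, hpath.congr fun z hz => ?_⟩
        · rw [Function.update_self, h20]
        · have hza : z ≠ a' := fun he => hal (he ▸ hz)
          rw [Function.update_of_ne hza]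
      · exact Or.inr ⟨rfl, by rw [Function.update_self, h20], hno⟩
  have fin : ∀ C₃ : Config D, C₃.ds = C₂.ds → C₃.out = C₂.out → (∀ r < 10, C₃.reg r = C₂.reg r) →
      ∀ n', n' ≤ 6 * M.card + 1 →
      (∃ π, IsRepair T' M (C.arr 0) (C.arr 1) (Function.update (C₃.arr 0) a' 2)
        (Function.update (C₃.arr 1) a' (C₃.reg 20)) a' π) →
      Runs D T₀ (.seq (.store 1 0 20) (.store 0 0 4)) C₃ fun n'' C' =>
        (C'.ds = C.ds ∧ C'.out = C.out ∧ (∀ r < 10, C'.reg r = C.reg r) ∧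
        1 + (1 + (1 + (1 + (1 + (1 + (n + (n' + n''))))))) ≤ 60 * M.card + 20 ∧
        ∃ π, IsRepair T' M (C.arr 0) (C.arr 1) (C'.arr 0) (C'.arr 1) a' π) := by
    intro C₃ h1 h2 h3 n' hn' hπ
    have r0 : C₃.reg 0 = a' := (h3 0 (by norm_num)).trans (h.reg 0 (by norm_num))
    have r4 : C₃.reg 4 = 2 :=
      ((h3 4 (by norm_num)).trans (h.reg 4 (by norm_num))).trans hc.two
    simp only [runs_seq, runs_store]
    refine ⟨h1.trans h.ds, h2.trans h.out, fun r hr => (h3 r hr).trans (h.reg r hr), by omega, ?_⟩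
    simpa [r0, r4] using hπ
  simp only [runs_seq, runs_store] at fin
  rcases h.found with ⟨h20, h21, hno⟩ | ⟨hlt, hon, hoM, hst, hadj⟩
  · -- No inserted node is next to a kept node on the stack.
    refine (runs_loop (fun m C' => m = 0 ∧ C' = C₂) ?_ ⟨rfl, rfl⟩).imp ?_
    · rintro _ C₃ ⟨rfl, hC⟩ hb
      have hb' : C₃.reg 2 < C₃.reg 21 := hb
      rw [hC] at hb'
      omega
    · rintro n' C₃ ⟨_, ⟨rfl, hC⟩, _, hn'⟩
      rw [hC]
      refine fin C₂ rfl rfl (fun _ _ => rfl) n' (by omega) ⟨[], main [] C₂ (by simp) ?_ h.reg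
        (by simp) (by simp) (Or.inr ⟨rfl, h20, fun o _ hoM ho2 m hm hmo => ?_⟩)⟩
      · intro z _
        rw [h.par_eq]
      · exact hno o ⟨m, hm, hmo⟩ hoM ho2
  · refine (runs_traceProg hc h hlt rfl hadj).imp ?_
    rintro n' C₃ ⟨l, ht, h21, hn'⟩
    have hal : a' ∉ l := by
      intro hm
      obtain ⟨i, hi, hpos, he⟩ := ht.pos a' hm
      rw [← h.start] at he
      have := h.inj i hi 0 h.pos he
      omega
    refine fin C₃ ht.ds ht.out ht.reg n' (by omega) ⟨l, main l C₃ (funext ht.state_eq) ?_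
      (fun r hr => (ht.reg r hr).trans (h.reg r hr)) (List.nodup_cons.2 ⟨hal, ht.nodup⟩) ?_
      (Or.inl ⟨_, hon, hoM, hst, ht.head, ?_, ht.path⟩)⟩
    · intro z hz
      rw [ht.par_eq z hz, h.par_eq]
    · intro x hx
      obtain ⟨i, hi, _, rfl⟩ := ht.pos x hx
      exact h.mem i hi
    · have := ht.adj
      rwa [h21, h.start] at this

end Repair

/-! ### The search program -/

section Program

variable {V : Type u} {f : Set V → ℕ} {k N : ℕ} {D : RefinementDataStructure.{u, v} f k}
  {T₀ : StoredDecomposition V} {C : Config D} {T T' : BranchDecomposition V}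
  {M : Finset ℕ} {x y w a' : ℕ} {st st₁ par st' par' : ℕ → ℕ} {π : List ℕ}

/-- Bounds by natural numbers on the running times of the operations. -/
structure RefinementDataStructure.IsTimeBound (D : RefinementDataStructure.{u, v} f k) (N : ℕ) :
    Prop where
  init : ∀ T a b hw h, D.initTime T a b hw h ≤ N * T.nodes.card
  move : ∀ s a b h₁ h₂ h₃, D.moveTime s a b h₁ h₂ h₃ ≤ N
  width : ∀ s, D.widthTime s ≤ N
  canRefine : ∀ s, D.canRefineTime s ≤ N
  editSet : ∀ s h, D.editSetTime s h ≤ N * (D.editSetValue s h).R.length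
  refine : ∀ s e h, D.refineTime s e h ≤ N * e.R.length
  output : ∀ s, D.outputTime s ≤ N * (D.tree s).nodes.card

/-- Make the edge from the current node (register 0) to the node in register 10 the root. The other
end of the current root edge is in register 1. -/
def gotoProg : Prog := .cond (.eq 10 1) .skip (.callMove 0 10)

/-- Compute the width of the edge to the node in register 10, and update the maximum of the widths
in register 7. -/
def checkEdgeProg : Prog :=
  .seq gotoProg <| .seq (.callWidth 16) <| .cond (.lt 7 16) (.copy 7 16) .skip

/-- Put the node in register 10 on the stack. -/
def visitProg : Prog :=
  .seq (.store 1 10 0) <| .seq (.store 0 10 4) <| .seq (.copy 1 0) (.copy 0 10)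

/-- Close the current node, and go back to the next node on the stack if there is one. Register 6
holds the state of closed nodes, and register 8 tells whether the search goes on. -/
def backProg : Prog :=
  .seq (.store 0 0 6) <| .seq (.load 10 1 0) <| .cond (.eq 10 0) (.const 8 0) <|
    .seq gotoProg <| .seq (.copy 1 0) (.copy 0 10)

/-- Set the state of the nodes of the edit set, listed in array 4, to 0. -/
def clearProg : Prog :=
  .seq (.load 13 4 2) <| .seq (.const 12 0) <| .loop (.lt 12 13) <|
    .seq (.add 12 12 3) <| .seq (.load 14 4 12) (.store 0 14 2)

/-- Refine, and repair the memory. -/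
def refineProg : Prog :=
  .seq (.callEditSet 4 5 6 7) <| .seq clearProg <| .seq (.callRefine 4 5 6 7 23 24) <|
    .seq (.copy 0 23) <| .seq (.copy 1 24) repairProg

/-- At an edge of maximum width: refine, or stop if that is impossible. -/
def improveProg : Prog :=
  .seq (.callCanRefine 17) <| .cond (.eq 17 3) refineProg <|
    .seq .conclude <| .seq (.const 9 1) (.const 8 0)

/-- One step of the search. Register 5 holds the state of unseen nodes, which is 0 in the first
search, where the width is computed, and 1 in the second search. -/
def stepProg : Prog :=
  .seq scanProg <| .cond (.eq 11 3)
    (.seq checkEdgeProg <| .cond (.eq 5 3) (.cond (.eq 16 7) improveProg visitProg) visitProg)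
    backProg

/-- A depth-first search from the node in register 0. -/
def searchProg : Prog :=
  .seq (.store 0 0 4) <| .seq (.store 1 0 0) <| .seq (.const 8 1) <| .loop (.eq 8 3) stepProg

/-- The algorithm: compute the width in one search, and refine at the edges of that width in a
second one. The registers 0 and 1 hold the current node and the other end of the root edge, the
registers 2, 3 and 4 the constants 0, 1 and 2, the registers 5 and 6 the states of unseen and of
closed nodes, register 7 the maximum of the widths seen so far; register 8 tells whether the search
goes on, and register 9 whether the answer has been given. The arrays 0 and 1 hold the state of each
node and the next node on the stack, the arrays 2 and 3 the queue of the repair, and the arrays from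
4 to 7 the edit set and the neighbor partition. -/
def mainProg : Prog :=
  .seq (.const 3 1) <| .seq (.const 4 2) <| .seq (.neighbor 1 0 2) <| .seq (.callInit 0 1) <|
  .seq (.const 6 1) <| .seq searchProg <| .seq (.const 5 1) <| .seq (.const 6 3) <|
  .seq searchProg <| .cond (.eq 9 3) .skip .callOutput

/-- The data structure holds the tree `T`, rooted at the edge `xy` in one of its orientations. -/
def Maintains (C : Config D) (T : BranchDecomposition V) (x y : ℕ) : Prop :=
  ∃ s, C.ds = some s ∧ (D.tree s).toBranchDecomposition = T ∧
    s((D.root s).1, (D.root s).2) = s(x, y)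

theorem Exec.runs {p : Prog} {n : ℕ} {C' : Config D} {Q : ℕ → Config D → Prop}
    (h : Exec D T₀ p C n C') (hQ : Q n C') : Runs D T₀ p C Q :=
  ⟨n, C', h, hQ⟩

theorem Maintains.congr {C' : Config D} (h : Maintains C T x y) (hds : C'.ds = C.ds) :
    Maintains C' T x y := by
  unfold Maintains
  rwa [hds]

theorem Maintains.swap (h : Maintains C T x y) : Maintains C T y x := by
  obtain ⟨s, h1, h2, h3⟩ := h
  exact ⟨s, h1, h2, h3.trans Sym2.eq_swap⟩

theorem Maintains.adj (h : Maintains C T x y) : T.graph.Adj x y := by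
  obtain ⟨s, _, rfl, h3⟩ := h
  have := D.root_adj s
  rw [← SimpleGraph.mem_edgeSet] at this ⊢
  rwa [← h3]

theorem Maintains.width_le (h : Maintains C T x y) : T.width f ≤ k := by
  obtain ⟨s, _, rfl, _⟩ := h
  exact D.width_le s

theorem Maintains.nbrs (h : Maintains C T x y) {z : ℕ} (hz : z ∈ T.nodes) :
    (C.nbrs T₀ z).length ≤ 3 ∧ ∀ z', z' ∈ C.nbrs T₀ z ↔ T.graph.Adj z z' := by
  obtain ⟨s, h1, rfl, _⟩ := h
  rw [nbrs_of_ds h1]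
  exact ⟨(D.tree s).length_nbrs_le hz, (D.tree s).mem_nbrs z hz⟩

theorem runs_gotoProg (hN : D.IsTimeBound N) (h : Maintains C T (C.reg 0) (C.reg 1))
    (hw : T.graph.Adj (C.reg 0) (C.reg 10)) :
    Runs D T₀ gotoProg C fun n C' => Maintains C' T (C.reg 0) (C.reg 10) ∧ C'.reg = C.reg ∧
      C'.arr = C.arr ∧ C'.out = C.out ∧ n ≤ N + 2 := by
  by_cases he : C.reg 10 = C.reg 1
  · refine runs_cond_pos he ?_
    rw [runs_skip, he]
    exact ⟨h, rfl, rfl, rfl, by omega⟩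
  · refine runs_cond_neg he ?_
    obtain ⟨s, h1, rfl, h3⟩ := h
    have hx : C.reg 0 = (D.root s).1 ∨ C.reg 0 = (D.root s).2 := by
      have : C.reg 0 ∈ s((D.root s).1, (D.root s).2) := by simp [h3]
      simpa using this
    have hne : s(C.reg 0, C.reg 10) ≠ s((D.root s).1, (D.root s).2) := by
      rw [h3]
      intro h
      exact he (Sym2.congr_right.1 h)
    refine (Exec.callMove 0 10 C s h1 hx hw hne).runs ⟨⟨_, rfl, D.move_tree .., ?_⟩, rfl, rfl, rfl, ?_⟩
    · rw [D.move_root]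
    · have := hN.move s (C.reg 0) (C.reg 10) hx hw hne
      omega

theorem runs_checkEdgeProg (hf : IsConnectivityFunction f) (hN : D.IsTimeBound N)
    (h : Maintains C T (C.reg 0) (C.reg 1)) (hw : T.graph.Adj (C.reg 0) (C.reg 10)) :
    Runs D T₀ checkEdgeProg C fun n C' => Maintains C' T (C.reg 0) (C.reg 10) ∧
      (∀ r ≠ 16, r ≠ 7 → C'.reg r = C.reg r) ∧ C'.reg 16 = f (T.side (C.reg 0) (C.reg 10)) ∧
      C'.reg 7 = max (C.reg 7) (C'.reg 16) ∧ C'.arr = C.arr ∧ C'.out = C.out ∧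
      n ≤ 2 * N + 6 := by
  simp only [checkEdgeProg, runs_seq]
  refine (runs_gotoProg hN h hw).imp ?_
  rintro n C₁ ⟨h1, h2, h3, h4, h5⟩
  obtain ⟨s, g1, rfl, g3⟩ := h1
  refine (Exec.callWidth 16 C₁ s g1).runs ?_
  have hval : D.widthValue s = f ((D.tree s).side (C.reg 0) (C.reg 10)) := by
    rw [D.width_value]
    rcases Sym2.eq_iff.1 g3 with ⟨e1, e2⟩ | ⟨e1, e2⟩
    · rw [e1, e2]
    · rw [e1, e2, side_swap hf hw]
  have hm : ∃ s', some (D.width s) = some s' ∧ (D.tree s').toBranchDecomposition =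
      (D.tree s).toBranchDecomposition ∧
      s((D.root s').1, (D.root s').2) = s(C.reg 0, C.reg 10) :=
    ⟨_, rfl, D.width_tree s, by rw [D.width_root, g3]⟩
  have ht := hN.width s
  by_cases hlt : C₁.reg 7 < D.widthValue s
  · refine runs_cond_pos (by simpa [Test.Holds] using hlt) ?_
    rw [runs_copy]
    refine ⟨hm, fun r hr hr' => ?_, by simpa using hval, ?_, h3, h4, by omega⟩
    · simp [hr, hr', h2]
    · rw [h2] at hlt
      simp [hlt.le]
  · refine runs_cond_neg (by simpa [Test.Holds] using hlt) ?_
    rw [runs_skip]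
    refine ⟨hm, fun r hr hr' => ?_, by simpa using hval, ?_, h3, h4, by omega⟩
    · simp [hr, h2]
    · rw [h2] at hlt
      simp [h2, not_lt.1 hlt]

theorem IsRepair.congr (h : IsRepair T' M st par st' par' a' π)
    (hst : ∀ z ∈ T'.nodes, z ∉ M → st z = st₁ z) : IsRepair T' M st₁ par st' par' a' π := by
  refine { h with state_kept := fun z hz hzM => (h.state_kept z hz hzM).trans (hst z hz hzM)
                  link := ?_ }
  refine h.link.imp ?_ fun ⟨h1, h2, h3⟩ => ⟨h1, h2, fun o ho hoM ho2 => ?_⟩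
  · rintro ⟨o, ho, hoM, ho2, h'⟩
    exact ⟨o, ho, hoM, (hst o ho hoM) ▸ ho2, h'⟩
  · exact h3 o ho hoM ((hst o ho hoM).trans ho2)

theorem runs_clearProg {R : List ℕ} (hc : HasConsts C) (hR : HoldsList (C.arr 4) R) :
    Runs D T₀ clearProg C fun n C' => C'.ds = C.ds ∧ C'.out = C.out ∧
      (∀ r < 10, C'.reg r = C.reg r) ∧ (∀ A ≠ 0, C'.arr A = C.arr A) ∧
      (∀ z, C'.arr 0 z = if z ∈ R then 0 else C.arr 0 z) ∧ n ≤ 4 * R.length + 3 := by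
  simp only [clearProg, runs_seq, runs_load, runs_const]
  refine (runs_for (N := R.length) (cost := 3) (fun i C' => C'.reg 12 = i ∧
    C'.reg 13 = R.length ∧ C'.ds = C.ds ∧ C'.out = C.out ∧ (∀ r < 10, C'.reg r = C.reg r) ∧
    (∀ A ≠ 0, C'.arr A = C.arr A) ∧
    ∀ z, C'.arr 0 z = if z ∈ R.take i then 0 else C.arr 0 z) ?_ ?_ ?_).imp ?_
  · rintro i C' ⟨h1, h2, _⟩
    exact ⟨h1, h2⟩
  · rintro i hi C' ⟨h1, h2, h3, h4, h5, h6, h7⟩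
    simp only [runs_seq, runs_add, runs_load, runs_store]
    have c2 := (h5 2 (by norm_num)).trans hc.zero
    have c3 := (h5 3 (by norm_num)).trans hc.one
    have e : C'.arr 4 (i + 1) = R[i] := by
      rw [h6 4 (by norm_num), hR.2 i hi]
      simp [hi]
    refine ⟨⟨by simp [h1, c3], by simpa using h2, h3, h4, fun r hr => ?_, fun A hA => ?_,
      fun z => ?_⟩, le_rfl⟩
    · simp only [reg_setReg, reg_setArr]
      rw [Function.update_of_ne (by omega), Function.update_of_ne (by omega), h5 r hr]
    · simpa [hA] using h6 A hA
    · have ht : z ∈ R.take (i + 1) ↔ z ∈ R.take i ∨ z = R[i] := by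
        rw [← List.take_concat_get' R i hi, List.mem_append, List.mem_singleton]
      simp only [ht]
      have := h7 z
      by_cases hz : z = R[i]
      · simp [hz, h1, c3, e, c2]
      · simp [hz, h1, c3, e, this]
  · refine ⟨by simp, by simp [hc.zero, hR.1], rfl, rfl, fun r hr => ?_, fun _ _ => rfl, by simp⟩
    simp only [reg_setReg]
    rw [Function.update_of_ne (by omega), Function.update_of_ne (by omega)]
  · rintro n C' ⟨⟨_, _, h3, h4, h5, h6, h7⟩, hn⟩
    refine ⟨h3, h4, h5, h6, fun z => ?_, by omega⟩
    rw [h7, List.take_length]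

theorem holdsList_writeList (g : ℕ → ℕ) (l : List ℕ) : HoldsList (writeList g l) l := by
  refine ⟨by simp [writeList], fun i hi => ?_⟩
  simp [writeList, Nat.succ_le_of_lt hi]

/-- After `CanRefine` has returned true at an unseen node next to the current one, the tree is
refined and the search continues in the refinement. -/
theorem runs_refineProg {s : D.State} {l : List ℕ} (hf : IsConnectivityFunction f)
    (hN : D.IsTimeBound N) (hc : HasConsts C) (hds : C.ds = some s) (hready : D.Ready s)
    (hT : (D.tree s).toBranchDecomposition = T)
    (hroot : s((D.root s).1, (D.root s).2) = s(C.reg 0, w))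
    (h : IsSearch T f 1 3 k (C.arr 0) (C.arr 1) (C.reg 0) l)
    (hw : C.arr 0 w = 1) (hk : f (T.side (C.reg 0) w) = k) :
    Runs D T₀ refineProg C fun n C' => ∃ T' l', Maintains C' T' (C'.reg 0) (C'.reg 1) ∧
      C'.out = C.out ∧ (∀ r < 10, r ≠ 0 → r ≠ 1 → C'.reg r = C.reg r) ∧
      IsSearch T' f 1 3 k (C'.arr 0) (C'.arr 1) (C'.reg 0) l' ∧
      ∃ m, 2 ≤ m ∧ T'.potential f + m ≤ T.potential f ∧
        searchWeight T' 1 (C'.arr 0) ≤ searchWeight T 1 (C.arr 0) + 2 * m ∧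
        n ≤ (2 * N + 64) * m + 30 := by
  have hwidth : T.width f ≤ k := hT ▸ D.width_le s
  have hab : T.graph.Adj (D.root s).1 (D.root s).2 := hT ▸ D.root_adj s
  have hside : f (T.side (D.root s).1 (D.root s).2) = k := by
    rcases Sym2.eq_iff.1 hroot with ⟨e1, e2⟩ | ⟨e1, e2⟩
    · rw [e1, e2, hk]
    · rw [e1, e2] at hab ⊢
      rw [side_swap hf hab.symm, hk]
  simp only [refineProg, runs_seq]
  set s₁ := D.editSet s hready with hs₁
  set e := D.editSetValue s hready with he
  have hinfo := D.editSet_value s hready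
  rw [hT, ← he] at hinfo
  have hpend : D.pending s₁ = some e := D.editSet_pending s hready
  have ht₁ : (D.tree s₁).toBranchDecomposition = T := (D.editSet_tree s hready).trans hT
  have hr₁ : D.root s₁ = D.root s := D.editSet_root s hready
  have hRcard : (editSet T (D.root s).1 (D.root s).2 e.c).ncard = e.R.length := by
    rw [← List.toFinset_card_of_nodup hinfo.R_nodup, ← Set.ncard_coe_finset]
    congr 1
    ext z
    simp [hinfo.mem_R]
  refine (Exec.callEditSet 4 5 6 7 C s hds hready).runs ?_
  have hte := hN.editSet s hready
  rw [← he] at hte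
  refine (runs_clearProg (R := e.R) ?_ ?_).imp ?_
  · exact ⟨hc.zero, hc.one, hc.two⟩
  · simpa using holdsList_writeList (C.arr 4) e.R
  rintro n₁ C₁ ⟨g1, g2, g3, g4, g5, g6⟩
  have hA4 : HoldsList (C₁.arr 4) e.R := by
    rw [g4 4 (by norm_num)]
    simpa using holdsList_writeList (C.arr 4) e.R
  have hA5 : HoldsList (C₁.arr 5) (e.N 0) := by
    rw [g4 5 (by norm_num)]
    simpa using holdsList_writeList (C.arr 5) (e.N 0)
  have hA6 : HoldsList (C₁.arr 6) (e.N 1) := by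
    rw [g4 6 (by norm_num)]
    simpa using holdsList_writeList (C.arr 6) (e.N 1)
  have hA7 : HoldsList (C₁.arr 7) (e.N 2) := by
    rw [g4 7 (by norm_num)]
    simpa using holdsList_writeList (C.arr 7) (e.N 2)
  refine (Exec.callRefine 4 5 6 7 23 24 C₁ s₁ e g1 hpend hA4 hA5 hA6 hA7).runs ?_
  have htr := hN.refine s₁ e hpend
  have hin := D.refine_tree s₁ e hpend
  set s₂ := D.refine s₁ e hpend with hs₂
  rw [ht₁, hr₁] at hin
  set T' := (D.tree s₂).toBranchDecomposition with hT'
  obtain ⟨M, hrep, hM1, hM2, hadj⟩ := hin.exists_isReplacement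
  simp only [runs_copy]
  have hst : ∀ z, C₁.arr 0 z = if z ∈ e.R then 0 else C.arr 0 z := by
    intro z
    rw [g5 z]
    rfl
  have hout := h.out
  refine (runs_repairProg (s := s₂) (T' := T') (M := M) rfl rfl ?_ ?_).imp ?_
  · refine ⟨by simpa using hM1, fun z hz => (hrep.mem_nodes z).2 (Or.inr hz), hrep.connected,
      fun z hz => ?_, fun z hz hzM => ?_⟩
    · change C₁.arr 0 z = 0
      rw [hst]
      split_ifs with hzR
      · rfl
      · rw [hinfo.mem_R] at hzR
        refine hout z fun hzn => ?_
        rcases hz with hz | hz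
        · exact hzR (hrep.mem_of_mem z hz hzn)
        · exact hz ((hrep.mem_nodes z).2 (Or.inl ⟨hzn, hzR⟩))
    · change C₁.arr 0 z ≠ 0
      obtain ⟨hzn, hzR⟩ := ((hrep.mem_nodes z).1 hz).resolve_right hzM
      rw [hst, if_neg (mt (hinfo.mem_R z).1 hzR)]
      rcases h.state z hzn with h1 | h1 | h1 <;> omega
  · have e2 := g3 2 (by norm_num)
    have e3 := g3 3 (by norm_num)
    have e4 := g3 4 (by norm_num)
    exact ⟨by simpa using e2.trans hc.zero, by simpa using e3.trans hc.one,
      by simpa using e4.trans hc.two⟩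
  rintro n₂ C₂ ⟨q1, q2, q3, q4, π, hπ⟩
  have hc0 : C₂.reg 0 = (D.root s₂).1 := by
    rw [q3 0 (by norm_num)]
    simp
  have hc1 : C₂.reg 1 = (D.root s₂).2 := by
    rw [q3 1 (by norm_num)]
    simp
  have hπ' : IsRepair T' M (C.arr 0) (C.arr 1) (C₂.arr 0) (C₂.arr 1) (C₂.reg 0) π := by
    rw [q3 0 (by norm_num)]
    have hpar : C₁.arr 1 = C.arr 1 := by
      rw [g4 1 (by norm_num)]
      rfl
    have hπ := hπ.congr (st₁ := C.arr 0) fun z hz hzM => by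
      obtain ⟨hzn, hzR⟩ := ((hrep.mem_nodes z).1 hz).resolve_right hzM
      change C₁.arr 0 z = _
      rw [hst, if_neg (mt (hinfo.mem_R z).1 hzR)]
    change IsRepair T' M (C.arr 0) (C₁.arr 1) _ _ _ π at hπ
    rwa [hpar] at hπ
  replace h : IsSearch T f 1 3 (f (T.side (D.root s).1 (D.root s).2)) (C.arr 0) (C.arr 1)
      (C.reg 0) l := by
    simpa only [hside] using h
  obtain ⟨l', hl'⟩ := h.repair hf hab hw (hroot.symm) (by rwa [hside]) hinfo.globalImprovement
    hrep hin.1 hπ'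
  have hMcard : M.card = e.R.length := hrep.card_eq.trans hRcard
  refine ⟨T', l', ⟨s₂, q1, rfl, ?_⟩, ?_, ?_, ?_, e.R.length, ?_, ?_, ?_, ?_⟩
  · rw [hc0, hc1]
  · rw [q2]
    exact g2
  · intro r hr h0 h1
    rw [q3 r hr]
    have := g3 r hr
    simp only [reg_setReg, reg_setDS]
    rw [Function.update_of_ne h1, Function.update_of_ne h0, Function.update_of_ne (by omega),
      Function.update_of_ne (by omega), this]
    rfl
  · rwa [hside] at hl'
  · obtain ⟨h1, h2⟩ := hinfo.globalImprovement.minimum.improvement.root_mem_editSet hf hab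
    rw [← hRcard]
    exact (Set.one_lt_ncard editSet_finite).2 ⟨_, h1, _, h2, hab.ne⟩
  · have := hin.1.potential_le hf hab hinfo.globalImprovement
    rwa [hRcard] at this
  · have := hπ'.searchWeight_le hrep
    rwa [hMcard] at this
  · rw [hMcard] at q4
    have e1 : (2 * N + 64) * e.R.length =
      N * e.R.length + N * e.R.length + 4 * e.R.length + 60 * e.R.length := by ring
    omega

end Program

/-! ### Correctness and running time of the search -/

section Search

variable {V : Type u} {f : Set V → ℕ} {k N : ℕ} {D : RefinementDataStructure.{u, v} f k}
  {T₀ : StoredDecomposition V} {C : Config D} {T T₁ : BranchDecomposition V} {U Cl y : ℕ} {l : List ℕ}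

/-- The states of unseen and of closed nodes: 0 and 1 in the first search, 1 and 3 in the second
one, so that the nodes closed by the first search are the ones unseen by the second. -/
def IsPhase (U Cl : ℕ) : Prop := U = 0 ∧ Cl = 1 ∨ U = 1 ∧ Cl = 3

/-- What holds throughout a search: the meaning of the registers from 2 to 9 except 8. The register
7 holds the maximum of the widths computed so far. -/
structure IsActive (U Cl : ℕ) (C : Config D) : Prop where
  consts : HasConsts C
  unseen : C.reg 5 = U
  closed : C.reg 6 = Cl
  result : C.reg 9 = 0
  out : C.out = none
  max_le : C.reg 7 ≤ k
  max_eq : U = 1 → C.reg 7 = k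

/-- The search goes on at the node in register 0; the root is the edge from there to `y`. Widths of
edges at closed nodes and on the stack are at most the current maximum in the first search, and less
than it in the second one. -/
structure IsRunning (U Cl y : ℕ) (C : Config D) (T : BranchDecomposition V) (l : List ℕ) :
    Prop extends IsActive U Cl C where
  run : C.reg 8 = 1
  maintains : Maintains C T (C.reg 0) y
  search : IsSearch T f U Cl (C.reg 7 + 1 - U) (C.arr 0) (C.arr 1) (C.reg 0) l

/-- The search has come to its end. -/
structure IsFinished (U Cl : ℕ) (C : Config D) (T : BranchDecomposition V) : Prop
    extends IsActive U Cl C where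
  run : C.reg 8 = 0
  maintains : Maintains C T (C.reg 0) (C.reg 1)
  state : ∀ z ∈ T.nodes, C.arr 0 z = Cl
  state_out : ∀ z, z ∉ T.nodes → C.arr 0 z = 0
  side_lt : ∀ x y, T.graph.Adj x y → f (T.side x y) < C.reg 7 + 1 - U

/-- The algorithm has stopped with the answer that `k` is at most twice the branchwidth. -/
structure IsConcluded (C : Config D) : Prop where
  consts : HasConsts C
  run : C.reg 8 = 0
  result : C.reg 9 = 1
  out : C.out = some .twoApproximation
  le : k ≤ 2 * branchwidth f

/-- A bound for the remaining running time of a search. Each step of the search without refinement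
lowers the weight of the nodes. A refinement on `m` nodes makes this weight grow by at most `2 * m`,
but lowers three times the potential by at least `3 * m`, which leaves `200 * (N + 1) * m` steps for
its execution. -/
noncomputable def searchCost (N U : ℕ) (T : BranchDecomposition V) (C : Config D) : ℕ :=
  200 * (N + 1) * (searchWeight T U (C.arr 0) + U * (3 * T.potential f))

/-- The invariant of a search with remaining running time `m`. The first search does not change the
tree `T₁`. -/
def SearchInvariant (N U Cl : ℕ) (T₁ : BranchDecomposition V) (m : ℕ) (C : Config D) : Prop :=
  (∃ T l, IsRunning U Cl (C.reg 1) C T l ∧ (U = 0 → T = T₁) ∧ m = searchCost N U T C) ∨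
  (∃ T, IsFinished U Cl C T ∧ (U = 0 → T = T₁) ∧ m = 0) ∨ (U = 1 ∧ IsConcluded C ∧ m = 0)

theorem IsActive.congr {C' : Config D} (h : IsActive U Cl C) (hout : C'.out = C.out)
    (hreg : ∀ r < 10, r ≠ 0 → r ≠ 1 → r ≠ 8 → C'.reg r = C.reg r) : IsActive U Cl C' := by
  obtain ⟨⟨h1, h2, h3⟩, h4, h5, h6, h7, h8, h9⟩ := h
  refine ⟨⟨?_, ?_, ?_⟩, ?_, ?_, ?_, hout.trans h7, ?_, fun hU => ?_⟩ <;>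
  · rw [hreg _ (by norm_num) (by norm_num) (by norm_num) (by norm_num)]
    first | assumption | exact h9 hU

theorem IsRunning.congr {C' : Config D} (h : IsRunning U Cl y C T l) (hs : SameUpTo C C') :
    IsRunning U Cl y C' T l := by
  refine ⟨h.toIsActive.congr hs.out fun r hr _ _ _ => hs.reg r hr, ?_, ?_, ?_⟩
  · rw [hs.reg 8 (by norm_num), h.run]
  · rw [hs.reg 0 (by norm_num)]
    exact h.maintains.congr hs.ds
  · rw [hs.reg 0 (by norm_num), hs.reg 7 (by norm_num), hs.arr]
    exact h.search

theorem IsPhase.ne (h : IsPhase U Cl) : U ≠ 2 ∧ Cl ≠ 2 ∧ U ≠ Cl := by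
  rcases h with ⟨rfl, rfl⟩ | ⟨rfl, rfl⟩ <;> norm_num

theorem searchCost_add_le {C' : Config D}
    (h : searchWeight T U (C'.arr 0) + 1 ≤ searchWeight T U (C.arr 0)) :
    searchCost N U T C' + 200 * (N + 1) ≤ searchCost N U T C := by
  unfold searchCost
  have := Nat.mul_le_mul_left (200 * (N + 1)) (Nat.add_le_add_right h (U * (3 * T.potential f)))
  refine le_trans (le_of_eq ?_) this
  ring

theorem IsRunning.searchCost_pos (h : IsRunning U Cl y C T l) (hp : IsPhase U Cl) :
    200 * (N + 1) ≤ searchCost N U T C := by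
  have hw := searchWeight_update (T := T) (U := U) (st := C.arr 0) (w := C.reg 0) (s := Cl)
    (h.search.mem_nodes (by simp)) (by
      rw [h.search.current_state]
      have := hp.ne
      simp [nodeWeight, this.1.symm, this.2.1, this.2.2.symm])
  unfold searchCost
  exact Nat.le_mul_of_pos_right _ (by omega)

theorem runs_visitProg (hf : IsConnectivityFunction f) (hp : IsPhase U Cl)
    (h : IsRunning U Cl (C.reg 10) C T l) (hw : C.arr 0 (C.reg 10) = U)
    (hlt : f (T.side (C.reg 0) (C.reg 10)) < C.reg 7 + 1 - U) :
    Runs D T₀ visitProg C fun n C' => (∃ l', IsRunning U Cl (C'.reg 1) C' T l') ∧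
      searchCost N U T C' + 200 * (N + 1) ≤ searchCost N U T C ∧ n ≤ 4 := by
  simp only [visitProg, runs_seq, runs_store, runs_copy]
  have hadj := h.maintains.adj
  have h4 := h.consts.two
  obtain ⟨hU2, hC2, hUC⟩ := hp.ne
  refine ⟨⟨C.reg 0 :: l, h.toIsActive.congr rfl fun r hr h0 h1 _ => ?_, ?_, ?_, ?_⟩, ?_, le_rfl⟩
  · simp only [reg_setReg, reg_setArr]
    rw [Function.update_of_ne h0, Function.update_of_ne h1]
  · simpa using h.run
  · exact h.maintains.swap.congr rfl
  · simpa [h4] using h.search.visit hf hU2 hC2 hUC hadj hw hlt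
  · refine searchCost_add_le ?_
    simpa [h4] using searchWeight_update (T := T) (st := C.arr 0) (s := 2) (U := U)
      (T.mem_nodes_right hadj) (by simp [nodeWeight, hw, hU2.symm])

theorem runs_backProg (hf : IsConnectivityFunction f) (hN : D.IsTimeBound N) (hp : IsPhase U Cl)
    (h : IsRunning U Cl (C.reg 1) C T l) (hT₁ : U = 0 → T = T₁)
    (hnU : ∀ w, T.graph.Adj (C.reg 0) w → C.arr 0 w ≠ U) :
    Runs D T₀ backProg C fun n C' => ∃ m, SearchInvariant N U Cl T₁ m C' ∧
      n + 100 + m ≤ searchCost N U T C := by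
  obtain ⟨hU2, hC2, hUC⟩ := hp.ne
  have hs := h.search
  have h6 := h.closed
  have hpos := h.searchCost_pos (N := N) hp
  simp only [backProg, runs_seq, runs_store, runs_load]
  cases l with
  | nil =>
    have hpar : C.arr 1 (C.reg 0) = C.reg 0 := hs.stack
    refine runs_cond_pos (by simpa [Test.Holds] using hpar) ?_
    rw [runs_const]
    obtain ⟨g1, g2⟩ := hs.finish hf hnU
    refine ⟨0, Or.inr (Or.inl ⟨T, ⟨h.toIsActive.congr rfl fun r hr _ _ h8 => ?_, by simp, ?_, ?_,
      fun z hz => ?_, ?_⟩, hT₁, rfl⟩), by omega⟩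
    · simp only [reg_setReg, reg_setArr]
      rw [Function.update_of_ne h8, Function.update_of_ne (by omega)]
    · exact h.maintains.congr rfl
    · simpa [h6] using g1
    · have hne : z ≠ C.reg 0 := fun he => hz (he ▸ hs.mem_nodes (by simp))
      simpa [hne] using hs.out z hz
    · simpa using g2
  | cons q l =>
    have hpar : C.arr 1 (C.reg 0) = q := hs.stack.1
    have hadj : T.graph.Adj (C.reg 0) q := hs.stack.2.1
    refine runs_cond_neg (by simpa [Test.Holds, hpar] using hadj.ne') ?_
    simp only [runs_seq]
    refine (runs_gotoProg (T := T) hN ?_ ?_).imp ?_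
    · simpa using h.maintains.congr (C' := (C.setArr 0 (Function.update (C.arr 0) (C.reg 0)
        (C.reg 6))).setReg 10 (C.arr 1 (C.reg 0))) rfl
    · simpa [hpar] using hadj
    · rintro n C' ⟨g1, g2, g3, g4, g5⟩
      simp only [runs_copy]
      have hcost := searchCost_add_le (N := N) (U := U) (T := T) (C := C)
        (C' := (C'.setReg 1 (C'.reg 0)).setReg 0 ((C'.setReg 1 (C'.reg 0)).reg 10)) (by
          simpa [g3, h6] using searchWeight_update (T := T) (st := C.arr 0) (s := Cl) (U := U)
            (hs.mem_nodes (z := C.reg 0) (by simp)) (by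
            simp [nodeWeight, hs.current_state, hU2.symm, hC2, hUC.symm]))
      refine ⟨_, Or.inl ⟨T, l, ⟨h.toIsActive.congr g4 fun r hr h0 h1 _ => ?_, ?_, ?_, ?_⟩, hT₁, rfl⟩,
        ?_⟩
      · simp only [reg_setReg]
        rw [Function.update_of_ne h0, Function.update_of_ne h1, g2]
        simp only [reg_setReg, reg_setArr]
        rw [Function.update_of_ne (by omega)]
      · simpa [g2] using h.run
      · have := (g1.congr (C' := (C'.setReg 1 (C'.reg 0)).setReg 0
          ((C'.setReg 1 (C'.reg 0)).reg 10)) rfl).swap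
        simpa [g2] using this
      · simpa [g2, g3, hpar, h6] using hs.close hf hC2 hnU
      · omega

theorem runs_improveProg (hf : IsConnectivityFunction f) (hN : D.IsTimeBound N)
    (h : IsRunning 1 3 (C.reg 10) C T l) (hw : C.arr 0 (C.reg 10) = 1)
    (hk : f (T.side (C.reg 0) (C.reg 10)) = k) :
    Runs D T₀ improveProg C fun n C' => ∃ m, SearchInvariant N 1 3 T₁ m C' ∧
      n + 2 * N + 50 + m ≤ searchCost N 1 T C := by
  have hpos := h.searchCost_pos (N := N) (Or.inr ⟨rfl, rfl⟩)
  obtain ⟨s, h1, h2, h3⟩ := h.maintains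
  have hadj := h.maintains.adj
  simp only [improveProg, runs_seq]
  refine (Exec.callCanRefine 17 C s h1).runs ?_
  have ht := hN.canRefine s
  cases hval : D.canRefineValue s with
  | true =>
    refine runs_cond_pos (by simp [Test.Holds, h.consts.one]) ?_
    refine (runs_refineProg (T := T) (w := C.reg 10) (l := l) hf hN ?_ rfl
      (D.canRefine_ready s hval) ((D.canRefine_tree s).trans h2) ?_ ?_ ?_ ?_).imp ?_
    · exact ⟨by simpa using h.consts.zero, by simpa using h.consts.one, by simpa using h.consts.two⟩
    · rw [D.canRefine_root, h3]
      simp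
    · have := h.search
      rw [h.max_eq rfl] at this
      simpa using this
    · exact hw
    · simpa using hk
    · rintro n C' ⟨T', l', g1, g2, g3, g4, m, hm, g5, g6, g7⟩
      have hreg : ∀ r < 10, r ≠ 0 → r ≠ 1 → C'.reg r = C.reg r := by
        intro r hr h0 h1
        rw [g3 r hr h0 h1, reg_setReg, Function.update_of_ne (by omega), reg_setDS]
      have g6' : searchWeight T' 1 (C'.arr 0) ≤ searchWeight T 1 (C.arr 0) + 2 * m := g6
      refine ⟨_, Or.inl ⟨T', l', ⟨h.toIsActive.congr g2 fun r hr h0 h1 _ => hreg r hr h0 h1, ?_,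
        g1, ?_⟩, by simp, rfl⟩, ?_⟩
      · rw [hreg 8 (by norm_num) (by norm_num) (by norm_num), h.run]
      · have e : C'.reg 7 = k := by
          rw [hreg 7 (by norm_num) (by norm_num) (by norm_num), h.max_eq rfl]
        rw [e]
        exact g4
      · have e1 : searchCost N 1 T' C' + 200 * (N + 1) * m ≤ searchCost N 1 T C := by
          unfold searchCost
          rw [← Nat.mul_add]
          exact Nat.mul_le_mul_left _ (by omega)
        have e2 : (2 * N + 64) * m + 30 + 4 * N + 60 ≤ 200 * (N + 1) * m := by
          nlinarith [Nat.mul_le_mul_left N hm]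
        omega
  | false =>
    refine runs_cond_neg (by simp [Test.Holds, h.consts.one]) ?_
    simp only [runs_seq, runs_conclude, runs_const]
    refine ⟨0, Or.inr (Or.inr ⟨rfl, ⟨⟨?_, ?_, ?_⟩, by simp, by simp, rfl, ?_⟩, rfl⟩), by omega⟩
    · simpa using h.consts.zero
    · simpa using h.consts.one
    · simpa using h.consts.two
    · by_contra hlt
      obtain ⟨c, hc⟩ := exists_isImprovement hf T
        (W := T.side (D.root s).1 (D.root s).2) (by
          rcases Sym2.eq_iff.1 h3 with ⟨e1, e2⟩ | ⟨e1, e2⟩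
          · rw [e1, e2]
            omega
          · rw [e1, e2, side_swap hf hadj]
            omega)
      rw [← h2] at hc
      rw [(D.canRefine_value s).2 ⟨c, hc⟩] at hval
      exact absurd hval (by simp)

theorem runs_stepProg (hf : IsConnectivityFunction f) (hN : D.IsTimeBound N) (hp : IsPhase U Cl)
    (h : IsRunning U Cl (C.reg 1) C T l) (hT₁ : U = 0 → T = T₁) :
    Runs D T₀ stepProg C fun n C' => ∃ m, SearchInvariant N U Cl T₁ m C' ∧
      n + 1 + m ≤ searchCost N U T C := by
  simp only [stepProg, runs_seq]
  have hcur : C.reg 0 ∈ T.nodes := h.search.mem_nodes (by simp)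
  obtain ⟨hlen, hnb⟩ := h.maintains.nbrs (T₀ := T₀) hcur
  refine (runs_scanProg rfl h.consts.one hlen).imp ?_
  rintro n C₁ ⟨hs, hn, hscan⟩
  have h₁ := h.congr hs
  have e0 := hs.reg 0 (by norm_num)
  have e1 := hs.reg 1 (by norm_num)
  rw [← e1] at h₁
  have hcost : searchCost N U T C₁ = searchCost N U T C := by
    unfold searchCost
    rw [hs.arr]
  rcases hscan with ⟨h11, hw, hU⟩ | ⟨h11, hnU⟩
  · refine runs_cond_pos (by simp [Test.Holds, h11, h₁.consts.one]) ?_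
    rw [hnb, ← e0] at hw
    rw [h.unseen, ← hs.arr] at hU
    simp only [runs_seq]
    refine (runs_checkEdgeProg hf hN h₁.maintains hw).imp ?_
    rintro n₂ C₂ ⟨g1, g2, g3, g4, g5, g6, g7⟩
    have r0 := g2 0 (by norm_num) (by norm_num)
    have r10 := g2 10 (by norm_num) (by norm_num)
    have hk : f (T.side (C₁.reg 0) (C₁.reg 10)) ≤ k := (T.le_width hw).trans h₁.maintains.width_le
    have hmax := h₁.max_le
    have h₂ : IsRunning U Cl (C₂.reg 10) C₂ T l := by
      refine ⟨⟨⟨?_, ?_, ?_⟩, ?_, ?_, ?_, ?_, ?_, fun hU => ?_⟩, ?_, ?_, ?_⟩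
      · rw [g2 2 (by norm_num) (by norm_num), h₁.consts.zero]
      · rw [g2 3 (by norm_num) (by norm_num), h₁.consts.one]
      · rw [g2 4 (by norm_num) (by norm_num), h₁.consts.two]
      · rw [g2 5 (by norm_num) (by norm_num), h₁.unseen]
      · rw [g2 6 (by norm_num) (by norm_num), h₁.closed]
      · rw [g2 9 (by norm_num) (by norm_num), h₁.result]
      · rw [g6, h₁.out]
      · omega
      · have := h₁.max_eq hU
        omega
      · rw [g2 8 (by norm_num) (by norm_num), h₁.run]
      · rw [r0, r10]
        exact g1
      · rw [r0, g5]
        exact h₁.search.mono (by omega)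
    have hcost₂ : searchCost N U T C₂ = searchCost N U T C := by
      unfold searchCost
      rw [g5, hs.arr]
    rw [← g5, ← r10] at hU
    rw [← r0, ← r10] at g3 hk
    have hvisit : f (T.side (C₂.reg 0) (C₂.reg 10)) < C₂.reg 7 + 1 - U →
        Runs D T₀ visitProg C₂ fun n' C' => ∃ m, SearchInvariant N U Cl T₁ m C' ∧
          n' + 200 * (N + 1) + m ≤ searchCost N U T C + 4 := by
      intro hlt
      refine (runs_visitProg (N := N) hf hp h₂ hU hlt).imp ?_
      rintro n' C' ⟨⟨l', hl'⟩, q1, q2⟩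
      exact ⟨_, Or.inl ⟨T, l', hl', hT₁, rfl⟩, by omega⟩
    rcases hp with ⟨rfl, rfl⟩ | ⟨rfl, rfl⟩
    · refine runs_cond_neg (by simp [Test.Holds, h₂.unseen, h₂.consts.one]) ?_
      refine (hvisit (by omega)).imp ?_
      rintro n' C' ⟨m, q1, q2⟩
      exact ⟨m, q1, by omega⟩
    · refine runs_cond_pos (by simp [Test.Holds, h₂.unseen, h₂.consts.one]) ?_
      have hmax₂ := h₂.max_eq rfl
      by_cases he : C₂.reg 16 = C₂.reg 7
      · refine runs_cond_pos he ?_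
        refine (runs_improveProg (T₁ := T₁) hf hN h₂ hU (by omega)).imp ?_
        rintro n' C' ⟨m, q1, q2⟩
        exact ⟨m, q1, by omega⟩
      · refine runs_cond_neg he ?_
        refine (hvisit (by omega)).imp ?_
        rintro n' C' ⟨m, q1, q2⟩
        exact ⟨m, q1, by omega⟩
  · refine runs_cond_neg (by simp [Test.Holds, h11, h₁.consts.one]) ?_
    refine (runs_backProg hf hN hp h₁ hT₁ fun w hw => ?_).imp ?_
    · rw [hs.arr, ← h.unseen]
      rw [e0] at hw
      exact hnU w ((hnb w).2 hw)
    · rintro n' C' ⟨m, q1, q2⟩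
      exact ⟨m, q1, by omega⟩

/-- A search from a node of a tree all of whose nodes are unseen. -/
theorem runs_searchProg (hf : IsConnectivityFunction f) (hN : D.IsTimeBound N) (hp : IsPhase U Cl)
    (h : IsActive U Cl C) (hT : Maintains C T (C.reg 0) (C.reg 1))
    (hst : ∀ z ∈ T.nodes, C.arr 0 z = U) (hout : ∀ z, z ∉ T.nodes → C.arr 0 z = 0) :
    Runs D T₀ searchProg C fun n C' => ((∃ T', IsFinished U Cl C' T' ∧ (U = 0 → T' = T)) ∨
      U = 1 ∧ IsConcluded C') ∧
      n ≤ 200 * (N + 1) * (2 * T.nodes.card + U * (3 * T.potential f)) + 4 := by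
  obtain ⟨hU2, hC2, hUC⟩ := hp.ne
  simp only [searchProg, runs_seq, runs_store, runs_const]
  have hadj := hT.adj
  have htwo := h.consts.two
  refine (runs_loop (fun m C => SearchInvariant N U Cl T m C) ?_
    (Or.inl ⟨T, [], ⟨?_, ?_, ?_, ?_⟩, fun _ => rfl, rfl⟩)).imp ?_
  · rintro m C (⟨T', l, hC, hT', rfl⟩ | ⟨T', hC, _, rfl⟩ | ⟨rfl, hC, rfl⟩) hb
    · exact (runs_stepProg hf hN hp hC hT').imp fun _ _ ⟨m', h1, h2⟩ => ⟨m', h1, h2⟩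
    · have hb' : C.reg 8 = C.reg 3 := hb
      rw [hC.run, hC.consts.one] at hb'
      omega
    · have hb' : C.reg 8 = C.reg 3 := hb
      rw [hC.run, hC.consts.one] at hb'
      omega
  · refine h.congr rfl fun r hr h0 h1 h8 => ?_
    simp only [reg_setReg, reg_setArr]
    rw [Function.update_of_ne h8]
  · simp
  · exact hT.congr rfl
  · simpa [htwo] using IsSearch.start (f := f) (B := C.reg 7 + 1 - U) (par := C.arr 1)
      (T.mem_of_adj _ _ hadj) hU2 hC2 hUC hst hout
  · rintro n C' ⟨m', hinv, hb, hn⟩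
    have hle := Nat.mul_le_mul_left (200 * (N + 1)) (Nat.add_le_add_right
      (searchWeight_le T U (Function.update (C.arr 0) (C.reg 0) 2)) (U * (3 * T.potential f)))
    constructor
    · rcases hinv with ⟨T', l, hC, _, rfl⟩ | ⟨T', hC, hT', rfl⟩ | ⟨rfl, hC, rfl⟩
      · exact absurd (hC.run.trans hC.consts.one.symm) hb
      · exact Or.inl ⟨T', hC, hT'⟩
      · exact Or.inr ⟨rfl, hC⟩
    · unfold searchCost at hn
      simp [htwo] at hn
      omega

end Search

/-! ### The algorithm -/

section Main

variable {V : Type u} {f : Set V → ℕ} {k N : ℕ} {D : RefinementDataStructure.{u, v} f k}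
  {T₀ : StoredDecomposition V}

theorem runs_callInit {C : Config D} {x y : ℕ} {Q : ℕ → Config D → Prop} (hN : D.IsTimeBound N)
    (hC : C.ds = none) (hw : T₀.width f ≤ k) (h : T₀.graph.Adj (C.reg x) (C.reg y))
    (hQ : ∀ n s, (D.tree s).toBranchDecomposition = T₀.toBranchDecomposition →
      D.root s = (C.reg x, C.reg y) → n ≤ N * T₀.nodes.card → Q (n + 1) (C.setDS s)) :
    Runs D T₀ (.callInit x y) C Q :=
  (Exec.callInit x y C hC hw h).runs
    (hQ _ _ (D.init_tree ..) (D.init_root ..) (hN.init T₀ _ _ hw h))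

theorem runs_mainProg [Finite V] (hf : IsConnectivityFunction f) (hN : D.IsTimeBound N)
    (hk : T₀.width f = k) {p : ℕ} (hp : p ∈ T₀.nodes) :
    Runs D T₀ mainProg (Config.start D p) fun n C' =>
      n ≤ 5000 * (N + 1) * (16 ^ k * Nat.card V) ∧
      ((∃ T' : BranchDecomposition V, C'.out = some (.decomposition T') ∧ T'.width f + 1 ≤ k) ∨
        (C'.out = some .twoApproximation ∧ k ≤ 2 * branchwidth f)) := by
  have hpos : 1 ≤ 16 ^ k * Nat.card V := by
    have h1 := T₀.card_nodes_le
    have h2 := Finset.card_pos.2 T₀.nonempty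
    exact Nat.mul_pos (by positivity) (by omega)
  have hcardle : ∀ T : BranchDecomposition V, T.nodes.card ≤ 2 * (16 ^ k * Nat.card V) :=
    fun T => T.card_nodes_le.trans
      (Nat.mul_le_mul_left 2 (Nat.le_mul_of_pos_left _ (by positivity)))
  have hpot : ∀ T : BranchDecomposition V, T.width f ≤ k →
      T.potential f ≤ 4 * (16 ^ k * Nat.card V) := by
    intro T hT
    refine (T.potential_le_mul f).trans ?_
    have h1 := T.card_nodes_le
    have h2 : 16 ^ T.width f ≤ 16 ^ k := Nat.pow_le_pow_right (by norm_num) hT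
    calc 2 * T.nodes.card * 16 ^ T.width f ≤ 2 * (2 * Nat.card V) * 16 ^ k := by gcongr
      _ = 4 * (16 ^ k * Nat.card V) := by ring
  have hsearch : ∀ c Φ U : ℕ, c ≤ 2 * (16 ^ k * Nat.card V) → Φ ≤ 4 * (16 ^ k * Nat.card V) →
      U ≤ 1 → 200 * (N + 1) * (2 * c + U * (3 * Φ)) + 4 ≤
        200 * (N + 1) * ((4 + U * 12) * (16 ^ k * Nat.card V)) + 4 := by
    intro c Φ U hc hΦ _
    refine Nat.add_le_add_right (Nat.mul_le_mul_left _ ?_) 4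
    have := Nat.mul_le_mul_left U (Nat.mul_le_mul_left 3 hΦ)
    calc 2 * c + U * (3 * Φ)
        ≤ 2 * (2 * (16 ^ k * Nat.card V)) + U * (3 * (4 * (16 ^ k * Nat.card V))) := by gcongr
      _ = _ := by ring
  obtain ⟨q, hq⟩ : ∃ q, T₀.graph.Adj p q := by
    have h1 := T₀.cubic p hp
    have h2 : (T₀.graph.neighborSet p).Nonempty := Set.nonempty_of_ncard_ne_zero (by omega)
    exact h2
  have hnb : T₀.nbrs p ≠ [] := List.ne_nil_of_mem ((T₀.mem_nbrs p hp q).2 hq)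
  have hadj : T₀.graph.Adj p ((T₀.nbrs p).getD 0 0) := by
    rw [← T₀.mem_nbrs p hp]
    cases hL : T₀.nbrs p with
    | nil => exact absurd hL hnb
    | cons z L => simp
  simp only [mainProg, runs_seq, runs_const, runs_neighbor]
  refine runs_callInit hN rfl hk.le (by simpa [Config.start, Config.nbrs] using hadj) ?_
  intro n₀ s₀ htree hroot hti
  refine (runs_searchProg (T := T₀.toBranchDecomposition) (U := 0) (Cl := 1) hf hN
    (Or.inl ⟨rfl, rfl⟩) ⟨⟨?_, ?_, ?_⟩, ?_, ?_, ?_, ?_, ?_, ?_⟩ ⟨_, rfl, htree, ?_⟩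
    ?_ ?_).imp ?_
  iterate 9 · simp [Config.start]
  · rw [hroot]
    simp
  · exact fun _ _ => rfl
  · exact fun _ _ => rfl
  rintro n₁ C₁ ⟨hfin, hn₁⟩
  obtain ⟨T₁, h₁, hT₁⟩ := hfin.resolve_right (by simp)
  obtain rfl := hT₁ rfl
  have hmax : C₁.reg 7 = k := by
    refine le_antisymm h₁.max_le (hk.ge.trans ?_)
    rw [BranchDecomposition.width_le_iff]
    exact fun x y hxy => Nat.lt_succ_iff.1 (h₁.side_lt x y hxy)
  refine (runs_searchProg (T := T₀.toBranchDecomposition) (U := 1) (Cl := 3) hf hN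
    (Or.inr ⟨rfl, rfl⟩) ⟨⟨?_, ?_, ?_⟩, ?_, ?_, ?_, ?_, ?_, ?_⟩ ?_ ?_ ?_).imp ?_
  · simpa using h₁.consts.zero
  · simpa using h₁.consts.one
  · simpa using h₁.consts.two
  · simp
  · simp
  · simpa using h₁.result
  · exact h₁.out
  · simpa using h₁.max_le
  · simpa using hmax
  · exact h₁.maintains.congr rfl
  · exact h₁.state
  · exact h₁.state_out
  rintro n₂ C₂ ⟨hfin₂, hn₂⟩
  have hs₁ := hsearch _ _ 0 (hcardle T₀.toBranchDecomposition) (hpot _ hk.le) (by norm_num)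
  have hs₂ := hsearch _ _ 1 (hcardle T₀.toBranchDecomposition) (hpot _ hk.le) (by norm_num)
  have htime : ∀ T : BranchDecomposition V, ∀ m, m ≤ N * T.nodes.card →
      m ≤ 2 * (N * (16 ^ k * Nat.card V)) := by
    intro T m hm
    refine hm.trans ((Nat.mul_le_mul_left N (hcardle T)).trans (le_of_eq ?_))
    ring
  have hti' := htime _ _ hti
  set X := 16 ^ k * Nat.card V with hX
  have hNX : N ≤ N * X := Nat.le_mul_of_pos_right _ hpos
  have e₁ : 200 * (N + 1) * ((4 + 0 * 12) * X) = 800 * (N * X) + 800 * X := by ring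
  have e₂ : 200 * (N + 1) * ((4 + 1 * 12) * X) = 3200 * (N * X) + 3200 * X := by ring
  have e₃ : 5000 * (N + 1) * X = 5000 * (N * X) + 5000 * X := by ring
  rcases hfin₂ with ⟨T₂, h₂, _⟩ | ⟨_, h₂⟩
  · refine runs_cond_neg (by simp [Test.Holds, h₂.result, h₂.consts.one]) ?_
    obtain ⟨s, g1, g2, _⟩ := h₂.maintains
    refine (Exec.callOutput C₂ s g1).runs ?_
    have hto := htime _ _ (hN.output s)
    refine ⟨by omega, Or.inl ⟨_, rfl, ?_⟩⟩
    rw [D.output_value, g2]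
    -- The tree has an edge, so that `k` is positive.
    have hlt := h₂.side_lt
    rw [h₂.max_eq rfl] at hlt
    have h0 := hlt _ _ h₂.maintains.adj
    have : T₂.width f ≤ k - 1 := by
      rw [BranchDecomposition.width_le_iff]
      intro x y hxy
      have := hlt x y hxy
      omega
    omega
  · refine runs_cond_pos (by simp [Test.Holds, h₂.result, h₂.consts.one]) ?_
    rw [runs_skip]
    exact ⟨by omega, Or.inr ⟨h₂.out, h₂.le⟩⟩

end Main

theorem mainTheorem6 :
    ∃ (P : Prog) (c : ℕ), ∀ A : ℝ, ∃ B : ℝ,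
      ∀ (V : Type u) [Finite V] (f : Set V → ℕ), IsConnectivityFunction f →
      ∀ t : ℕ → ℝ, (∀ k, 1 ≤ t k) →
      ∀ D : ∀ k : ℕ, RefinementDataStructure.{u, v} f k, (∀ k, (D k).RunsInTime (A * t k)) →
      ∀ (T : StoredDecomposition V) (k : ℕ), T.width f = k →
      ∀ p ∈ T.nodes,
        ∃ (n : ℕ) (C : Config (D k)),
          Exec (D k) T P (Config.start (D k) p) n C ∧
          (n : ℝ) ≤ B * t k * 2 ^ (c * k) * Nat.card V ∧
          ((∃ T' : BranchDecomposition V,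
              C.out = some (.decomposition T') ∧ T'.width f + 1 ≤ k) ∨
            (C.out = some .twoApproximation ∧ k ≤ 2 * branchwidth f)) := by
  refine ⟨mainProg, 4, fun A => ⟨5000 * (|A| + 2), ?_⟩⟩
  intro V _ f hf t ht D hD T k hk p hp
  have htk := ht k
  have hτ : 0 ≤ |A| * t k := by positivity
  have hN : (D k).IsTimeBound ⌈|A| * t k⌉₊ := by
    have hle : A * t k ≤ (⌈|A| * t k⌉₊ : ℝ) :=
      (mul_le_mul_of_nonneg_right (le_abs_self A) (by linarith)).trans (Nat.le_ceil _)
    have hmul : ∀ m n : ℕ, (m : ℝ) ≤ A * t k * n → m ≤ ⌈|A| * t k⌉₊ * n := by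
      intro m n h
      have := h.trans (mul_le_mul_of_nonneg_right hle (Nat.cast_nonneg n))
      exact_mod_cast this
    have hone : ∀ m : ℕ, (m : ℝ) ≤ A * t k → m ≤ ⌈|A| * t k⌉₊ := fun m h => by
      exact_mod_cast h.trans hle
    exact ⟨fun T a b hw h => hmul _ _ ((hD k).init T a b hw h),
      fun s a b h₁ h₂ h₃ => hone _ ((hD k).move s a b h₁ h₂ h₃), fun s => hone _ ((hD k).width s),
      fun s => hone _ ((hD k).canRefine s), fun s h => hmul _ _ ((hD k).editSet s h),
      fun s e h => hmul _ _ ((hD k).refine s e h), fun s => hmul _ _ ((hD k).output s)⟩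
  obtain ⟨n, C, h1, h2, h3⟩ := runs_mainProg hf hN hk hp
  refine ⟨n, C, h1, ?_, h3⟩
  have hceil := (Nat.ceil_lt_add_one hτ).le
  have h2' : (n : ℝ) ≤ 5000 * (⌈|A| * t k⌉₊ + 1) * (16 ^ k * Nat.card V) := by exact_mod_cast h2
  refine h2'.trans ?_
  have e : (2 : ℝ) ^ (4 * k) = 16 ^ k := by
    rw [pow_mul]
    norm_num
  rw [e]
  calc (5000 : ℝ) * (⌈|A| * t k⌉₊ + 1) * (16 ^ k * Nat.card V)
      ≤ 5000 * ((|A| + 2) * t k) * (16 ^ k * Nat.card V) := by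
        gcongr
        nlinarith
    _ = 5000 * (|A| + 2) * t k * 16 ^ k * Nat.card V := by ring
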